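/- Let $\mathcal I$ be a family of $n\ge 1$ nonempty half-open intervals $[x_i,y_i)$ on the real line, of $\kappa$ distinct lengths and of total length $\ell_{\mathcal I}$, let $B$ be another nonempty half-open interval, and let $0\le\tau\le n$. Consider the problems of deciding whether one can translate $\tau$ of the intervals (a translation by distance zero is allowed) and keep the other $n-\tau$ intervals unmoved so that, afterwards, - Pack: the $n$ intervals are pairwise disjoint and contained in $B$; - Cover: the union of the $n$ intervals contains $B$; - Join: the $n$ intervals are joined into (that is, are pairwise disjoint with union) a contiguous half-open interval of length $\ell_{\mathcal I}$ (here $B$ is not part of the input); - J-Pack, J-Cover, Tile: the $n$ intervals are joined into a contiguous half-open interval of length $\ell_{\mathcal I}$ that, respectively, is contained in $B$, contains $B$, coincides with $B$. The input consists of $n$, $\tau$, the endpoints of the intervals and, except for Join, the endpoints of $B$. Running time is the number of steps on a random access machine with natural-number cells and exact real-number cells, whose unit-cost operations are addition, (on natural numbers truncated) subtraction, comparison and indirectly addressed memory access. Then there is a function $f:\mathbb N^2\to\mathbb N$ such that $f(\kappa,\tau)$, for $\kappa,\tau\le n$, is bounded by a polynomial in $n$ whenever either $\kappa$ or $\tau$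 is constant (the polynomial may depend on the constant), and such that Pack, Join, J-Pack, J-Cover and Tile admit algorithms running in $O(n\log n+n\cdot f(\kappa,\tau))$ time, and Cover admits an algorithm running in $O(n^2\cdot f(\kappa,\tau))$ time, where the constants in $O(\cdot)$ are absolute. -/

import Mathlib

/-! ### The machine: a random access machine with natural and real cells

Control data (counters, addresses, table entries) are natural numbers, coordinates are exact real
numbers. On natural numbers the machine can add and subtract (truncated) and compare; on reals it
can add, subtract and compare. There is no multiplication, no rounding, no conversion between the
two sorts and no real constant. Every operation, memory access and test costs one step. -/

namespace RealRAM

/-- Memory contents: registers and (infinite) arrays of both sorts. A program mentions only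
finitely many registers and arrays; array cells are addressed indirectly. -/
structure State where
  natReg : ℕ → ℕ
  realReg : ℕ → ℝ
  natArr : ℕ → ℕ → ℕ
  realArr : ℕ → ℕ → ℝ

/-- Natural-number expressions; `read a e` is the content of cell number `e` of array `a`. -/
inductive NExp where
  | const (c : ℕ)
  | reg (r : ℕ)
  | read (a : ℕ) (e : NExp)
  | add (e₁ e₂ : NExp)
  | sub (e₁ e₂ : NExp)

/-- Real expressions. -/
inductive RExp where
  | reg (r : ℕ)
  | read (a : ℕ) (e : NExp)
  | add (e₁ e₂ : RExp)
  | sub (e₁ e₂ : RExp)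

/-- Tests. -/
inductive BExp where
  | natLe (e₁ e₂ : NExp)
  | realLe (e₁ e₂ : RExp)
  | not (b : BExp)
  | and (b₁ b₂ : BExp)

/-- Programs. -/
inductive Cmd where
  | skip
  | setNat (r : ℕ) (e : NExp)
  | setReal (r : ℕ) (e : RExp)
  | writeNat (a : ℕ) (i : NExp) (e : NExp)
  | writeReal (a : ℕ) (i : NExp) (e : RExp)
  | seq (c₁ c₂ : Cmd)
  | branch (b : BExp) (c₁ c₂ : Cmd)
  | loop (b : BExp) (c : Cmd)

def NExp.eval (s : State) : NExp → ℕ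
  | const c => c
  | reg r => s.natReg r
  | read a e => s.natArr a (e.eval s)
  | add e₁ e₂ => e₁.eval s + e₂.eval s
  | sub e₁ e₂ => e₁.eval s - e₂.eval s

noncomputable def RExp.eval (s : State) : RExp → ℝ
  | reg r => s.realReg r
  | read a e => s.realArr a (e.eval s)
  | add e₁ e₂ => e₁.eval s + e₂.eval s
  | sub e₁ e₂ => e₁.eval s - e₂.eval s

def BExp.Holds (s : State) : BExp → Prop
  | natLe e₁ e₂ => e₁.eval s ≤ e₂.eval s
  | realLe e₁ e₂ => e₁.eval s ≤ e₂.eval s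
  | not b => ¬ b.Holds s
  | and b₁ b₂ => b₁.Holds s ∧ b₂.Holds s

/-- The cost of evaluating an expression is its number of nodes. -/
def NExp.cost : NExp → ℕ
  | const _ => 1
  | reg _ => 1
  | read _ e => e.cost + 1
  | add e₁ e₂ => e₁.cost + e₂.cost + 1
  | sub e₁ e₂ => e₁.cost + e₂.cost + 1

def RExp.cost : RExp → ℕ
  | reg _ => 1
  | read _ e => e.cost + 1
  | add e₁ e₂ => e₁.cost + e₂.cost + 1
  | sub e₁ e₂ => e₁.cost + e₂.cost + 1

def BExp.cost : BExp → ℕ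
  | natLe e₁ e₂ => e₁.cost + e₂.cost + 1
  | realLe e₁ e₂ => e₁.cost + e₂.cost + 1
  | not b => b.cost + 1
  | and b₁ b₂ => b₁.cost + b₂.cost + 1

def State.setNat (s : State) (r : ℕ) (v : ℕ) : State :=
  { s with natReg := Function.update s.natReg r v }

def State.setReal (s : State) (r : ℕ) (v : ℝ) : State :=
  { s with realReg := Function.update s.realReg r v }

def State.writeNat (s : State) (a i : ℕ) (v : ℕ) : State :=
  { s with natArr := Function.update s.natArr a (Function.update (s.natArr a) i v) }

def State.writeReal (s : State) (a i : ℕ) (v : ℝ) : State :=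
  { s with realArr := Function.update s.realArr a (Function.update (s.realArr a) i v) }

/-- `Exec c s t s'`: started in state `s`, the program `c` halts in state `s'` after exactly `t`
steps. -/
inductive Exec : Cmd → State → ℕ → State → Prop
  | skip (s : State) : Exec .skip s 1 s
  | setNat (s : State) (r : ℕ) (e : NExp) :
      Exec (.setNat r e) s (e.cost + 1) (s.setNat r (e.eval s))
  | setReal (s : State) (r : ℕ) (e : RExp) :
      Exec (.setReal r e) s (e.cost + 1) (s.setReal r (e.eval s))
  | writeNat (s : State) (a : ℕ) (i e : NExp) :
      Exec (.writeNat a i e) s (i.cost + e.cost + 1) (s.writeNat a (i.eval s) (e.eval s))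
  | writeReal (s : State) (a : ℕ) (i : NExp) (e : RExp) :
      Exec (.writeReal a i e) s (i.cost + e.cost + 1) (s.writeReal a (i.eval s) (e.eval s))
  | seq {c₁ c₂ : Cmd} {s s₁ s₂ : State} {t₁ t₂ : ℕ} :
      Exec c₁ s t₁ s₁ → Exec c₂ s₁ t₂ s₂ → Exec (.seq c₁ c₂) s (t₁ + t₂) s₂
  | branch_true {b : BExp} {c₁ c₂ : Cmd} {s s' : State} {t : ℕ} :
      b.Holds s → Exec c₁ s t s' → Exec (.branch b c₁ c₂) s (b.cost + 1 + t) s'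
  | branch_false {b : BExp} {c₁ c₂ : Cmd} {s s' : State} {t : ℕ} :
      ¬ b.Holds s → Exec c₂ s t s' → Exec (.branch b c₁ c₂) s (b.cost + 1 + t) s'
  | loop_done {b : BExp} {c : Cmd} {s : State} :
      ¬ b.Holds s → Exec (.loop b c) s (b.cost + 1) s
  | loop_step {b : BExp} {c : Cmd} {s s₁ s₂ : State} {t₁ t₂ : ℕ} :
      b.Holds s → Exec c s t₁ s₁ → Exec (.loop b c) s₁ t₂ s₂ →
      Exec (.loop b c) s (b.cost + 1 + t₁ + t₂) s₂

/-- The machine is deterministic: final state and number of steps are functions of the program and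
the initial state. -/
theorem Exec.deterministic {c : Cmd} {s s₁ s₂ : State} {t₁ t₂ : ℕ}
    (h₁ : Exec c s t₁ s₁) (h₂ : Exec c s t₂ s₂) : t₁ = t₂ ∧ s₁ = s₂ := by
  induction h₁ generalizing t₂ s₂ with
  | skip | setNat | setReal | writeNat | writeReal => cases h₂; exact ⟨rfl, rfl⟩
  | seq _ _ ih₁ ih₂ =>
    cases h₂ with
    | seq k₁ k₂ =>
      obtain ⟨rfl, rfl⟩ := ih₁ k₁
      obtain ⟨rfl, rfl⟩ := ih₂ k₂
      exact ⟨rfl, rfl⟩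
  | branch_true hb _ ih =>
    cases h₂ with
    | branch_true _ k =>
      obtain ⟨rfl, rfl⟩ := ih k
      exact ⟨rfl, rfl⟩
    | branch_false hb' _ => exact absurd hb hb'
  | branch_false hb _ ih =>
    cases h₂ with
    | branch_true hb' _ => exact absurd hb' hb
    | branch_false _ k =>
      obtain ⟨rfl, rfl⟩ := ih k
      exact ⟨rfl, rfl⟩
  | loop_done hb =>
    cases h₂ with
    | loop_done _ => exact ⟨rfl, rfl⟩
    | loop_step hb' _ _ => exact absurd hb' hb
  | loop_step hb _ _ ih₁ ih₂ =>
    cases h₂ with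
    | loop_done hb' => exact absurd hb hb'
    | loop_step _ k₁ k₂ =>
      obtain ⟨rfl, rfl⟩ := ih₁ k₁
      obtain ⟨rfl, rfl⟩ := ih₂ k₂
      exact ⟨rfl, rfl⟩

/-- The decision problem `yes` on inputs `α`, written into memory by `load`, admits an algorithm
running in `O(time)` steps: one program halts on every input within `C * time` steps and leaves the
answer (`1` for yes, `0` for no) in the first natural register. -/
def AdmitsAlgorithm {α : Type} (load : α → State) (yes : α → Prop) (time : α → ℝ) : Prop :=
  ∃ (P : Cmd) (C : ℝ), ∀ I : α, ∃ (t : ℕ) (s : State),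
    Exec P (load I) t s ∧ (t : ℝ) ≤ C * time I ∧
      (yes I → s.natReg 0 = 1) ∧ (¬ yes I → s.natReg 0 = 0)

end RealRAM

/-! ### Moving intervals -/

namespace MovingIntervals

/-- A nonempty family of `n` intervals `[left i, right i)`, together with the number `τ ≤ n` of
intervals to be moved. -/
structure Family where
  n : ℕ
  n_pos : 0 < n
  left : Fin n → ℝ
  right : Fin n → ℝ
  left_lt_right : ∀ i, left i < right i
  τ : ℕ
  τ_le : τ ≤ n

/-- A family together with a target interval `B = [bLeft, bRight)`. -/
structure TargetFamily extends Family where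
  bLeft : ℝ
  bRight : ℝ
  bLeft_lt_bRight : bLeft < bRight

namespace Family

/-- The length of the `i`-th interval. -/
def len (F : Family) (i : Fin F.n) : ℝ := F.right i - F.left i

/-- The total length of the intervals. -/
noncomputable def totalLen (F : Family) : ℝ := ∑ i, F.len i

/-- The number of distinct lengths. -/
noncomputable def κ (F : Family) : ℕ := (Finset.univ.image F.len).card

/-- The `i`-th interval, translated so that its left endpoint is `x i`. -/
def placed (F : Family) (x : Fin F.n → ℝ) (i : Fin F.n) : Set ℝ := Set.Ico (x i) (x i + F.len i)

/-- `x` lists the left endpoints after moving `τ` of the intervals and keeping the others; a move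
may have distance zero. -/
def IsMove (F : Family) (x : Fin F.n → ℝ) : Prop :=
  ∃ M : Finset (Fin F.n), M.card = F.τ ∧ ∀ i, i ∉ M → x i = F.left i

/-- The intervals are placed end to end, forming the contiguous interval `[z, z + totalLen)`. -/
def JoinedAt (F : Family) (x : Fin F.n → ℝ) (z : ℝ) : Prop :=
  Pairwise (fun i j => Disjoint (F.placed x i) (F.placed x j)) ∧
    ⋃ i, F.placed x i = Set.Ico z (z + F.totalLen)

/-- The input in memory: `n` and `τ` in natural registers `0` and `1`, the endpoints in real arrays
`0` and `1`, all other cells zero. -/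
noncomputable def load (F : Family) : RealRAM.State where
  natReg r := if r = 0 then F.n else if r = 1 then F.τ else 0
  realReg _ := 0
  natArr _ _ := 0
  realArr a i :=
    if h : i < F.n then
      if a = 0 then F.left ⟨i, h⟩ else if a = 1 then F.right ⟨i, h⟩ else 0
    else 0

end Family

/-- The input in memory, with the endpoints of `B` in real registers `0` and `1`. -/
noncomputable def TargetFamily.load (F : TargetFamily) : RealRAM.State :=
  { F.toFamily.load with
    realReg := fun r => if r = 0 then F.bLeft else if r = 1 then F.bRight else 0 }

/-- The target interval `B`. -/
def TargetFamily.B (F : TargetFamily) : Set ℝ := Set.Ico F.bLeft F.bRight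

def Pack (F : TargetFamily) : Prop :=
  ∃ x, F.IsMove x ∧ Pairwise (fun i j => Disjoint (F.placed x i) (F.placed x j)) ∧
    ∀ i, F.placed x i ⊆ F.B

def Cover (F : TargetFamily) : Prop :=
  ∃ x, F.IsMove x ∧ F.B ⊆ ⋃ i, F.placed x i

def Join (F : Family) : Prop :=
  ∃ x z, F.IsMove x ∧ F.JoinedAt x z

def JPack (F : TargetFamily) : Prop :=
  ∃ x z, F.IsMove x ∧ F.JoinedAt x z ∧ Set.Ico z (z + F.totalLen) ⊆ F.B

def JCover (F : TargetFamily) : Prop :=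
  ∃ x z, F.IsMove x ∧ F.JoinedAt x z ∧ F.B ⊆ Set.Ico z (z + F.totalLen)

def Tile (F : TargetFamily) : Prop :=
  ∃ x z, F.IsMove x ∧ F.JoinedAt x z ∧ Set.Ico z (z + F.totalLen) = F.B

/-- `f κ τ` (where `κ, τ ≤ n`) is bounded by a polynomial in `n` when either argument is a
constant. -/
def PolyWhenOneConstant (f : ℕ → ℕ → ℕ) : Prop :=
  ∀ c : ℕ, ∃ p : Polynomial ℕ, ∀ n κ τ : ℕ, κ ≤ n → τ ≤ n → (κ = c ∨ τ = c) → f κ τ ≤ p.eval n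

/-- The bound `n log n + n f(κ, τ)`. -/
noncomputable def Family.nearLinear (f : ℕ → ℕ → ℕ) (F : Family) : ℝ :=
  F.n * Real.log F.n + F.n * f F.κ F.τ

/-- The bound `n² f(κ, τ)`. -/
noncomputable def Family.quadratic (f : ℕ → ℕ → ℕ) (F : Family) : ℝ :=
  (F.n : ℝ) ^ 2 * f F.κ F.τ

end MovingIntervals

/-! One dynamic program solves all six problems. The intervals are processed by increasing left
endpoint `A i`. Only the lengths of the moved intervals matter, not their identities, so after `i`
intervals a state consists of the multiset `a` of lengths of the intervals chosen to be moved so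
far, the multiset `b` of moved lengths already placed, and a frontier `q`. An interval may be moved
to the left of its own position, so `b` need not be contained in `a`; the two are reconciled only at
the end, where `a = b + c` for the multiset `c` placed last.

For packing, the moved intervals lying between two consecutive kept ones can be pushed against the
left one without harm. Hence only the multiset `c` put into that gap matters, and interval `i` can
be kept if `q + c.sum ≤ A i`. For fixed `a` and `b` a smaller frontier allows every continuation of
a larger one, so it suffices to store minimal frontiers. There are at most `N = (κ + τ).choose τ`
multisets of at most `τ` lengths, hence at most `N ^ 3` triples `(a, b, c)` per interval.
`accept_iff_packN` is the correctness statement.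

Covering uses the same program on the reflected line, with `A = -left` and `Y = -right`: lengths
become negative, a small frontier means that much is covered, and `q + c.sum ≤ A i` says that no gap
is left before interval `i`. The one additional transition is to skip a kept interval that does not
advance the frontier (`Accept.coverN`, `CoverN.accept`).

For joining, disjoint intervals are joined at `z` exactly if they fit into `[z, z + totalLen)`
(`Family.joinedAt_iff`), so a joining problem is a packing problem with unknown `z`. If some
interval is kept, let `j` be the first such; then `j ≤ τ`, and since there are no gaps, `z` is `A j`
minus the lengths placed before it (`PackN.candidate`). This leaves at most `(τ + 1) * N` start
points. If everything is moved, any start works.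

On the machine, which neither multiplies nor divides, multisets are encoded as numbers in base `τ +
1`, and the table is addressed by the codes of `a` and `b`. Each layer of the table lies in fresh
memory, which is zero, so only visited cells cost time (`runs_layer`). Everything fits into `n log n
+ n * timeFactor κ τ` up to a constant, where `timeFactor κ τ = (κ + 1) * (τ + 1) * N ^ 4`; see
`runs_decider`.

Memory map. Natural registers: 2 number of lengths, 3 number of multisets, 4 current weight and
finally the layer size, 5 and 6 current and next layer, 7 the answer flag. Natural arrays: 0, 1
weights, 2 weight per interval, 3, 4, 5 codes and size per multiset, 6 table flags, 7 parents, 8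
tournament tree, 9 sorting order. Real registers: 0, 1 the target, 2 zero, 3, 4 start and limit of a
run, 5 total length. Real arrays: 2, 3 sorted endpoints, 4 distinct lengths, 5 sum per multiset, 6
frontiers. -/

namespace RealRAM

/-! ### Access to updated states -/

section StateLemmas

variable (s : State) (r r' a a' i i' v : ℕ) (x : ℝ)

@[simp] theorem State.natReg_setNat :
    (s.setNat r v).natReg r' = if r' = r then v else s.natReg r' := by
  simp [State.setNat, Function.update_apply]

@[simp] theorem State.realReg_setNat : (s.setNat r v).realReg = s.realReg := rfl

@[simp] theorem State.natArr_setNat : (s.setNat r v).natArr = s.natArr := rfl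

@[simp] theorem State.realArr_setNat : (s.setNat r v).realArr = s.realArr := rfl

@[simp] theorem State.realReg_setReal :
    (s.setReal r x).realReg r' = if r' = r then x else s.realReg r' := by
  simp [State.setReal, Function.update_apply]

@[simp] theorem State.natReg_setReal : (s.setReal r x).natReg = s.natReg := rfl

@[simp] theorem State.natArr_setReal : (s.setReal r x).natArr = s.natArr := rfl

@[simp] theorem State.realArr_setReal : (s.setReal r x).realArr = s.realArr := rfl

@[simp] theorem State.natArr_writeNat :
    (s.writeNat a i v).natArr a' =
      if a' = a then Function.update (s.natArr a) i v else s.natArr a' := by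
  by_cases h : a' = a
  · subst h; simp [State.writeNat]
  · simp [State.writeNat, h]

@[simp] theorem State.natReg_writeNat : (s.writeNat a i v).natReg = s.natReg := rfl

@[simp] theorem State.realReg_writeNat : (s.writeNat a i v).realReg = s.realReg := rfl

@[simp] theorem State.realArr_writeNat : (s.writeNat a i v).realArr = s.realArr := rfl

@[simp] theorem State.realArr_writeReal :
    (s.writeReal a i x).realArr a' =
      if a' = a then Function.update (s.realArr a) i x else s.realArr a' := by
  by_cases h : a' = a
  · subst h; simp [State.writeReal]
  · simp [State.writeReal, h]

@[simp] theorem State.natReg_writeReal : (s.writeReal a i x).natReg = s.natReg := rfl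

@[simp] theorem State.realReg_writeReal : (s.writeReal a i x).realReg = s.realReg := rfl

@[simp] theorem State.natArr_writeReal : (s.writeReal a i x).natArr = s.natArr := rfl

end StateLemmas

attribute [simp] NExp.eval RExp.eval BExp.Holds

/-! ### Frames: what a program leaves unchanged -/

/-- The natural registers a program may write. -/
def Cmd.natRegs : Cmd → List ℕ
  | .setNat r _ => [r]
  | .seq c₁ c₂ => c₁.natRegs ++ c₂.natRegs
  | .branch _ c₁ c₂ => c₁.natRegs ++ c₂.natRegs
  | .loop _ c => c.natRegs
  | _ => []

/-- The real registers a program may write. -/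
def Cmd.realRegs : Cmd → List ℕ
  | .setReal r _ => [r]
  | .seq c₁ c₂ => c₁.realRegs ++ c₂.realRegs
  | .branch _ c₁ c₂ => c₁.realRegs ++ c₂.realRegs
  | .loop _ c => c.realRegs
  | _ => []

/-- The natural arrays a program may write. -/
def Cmd.natArrs : Cmd → List ℕ
  | .writeNat a _ _ => [a]
  | .seq c₁ c₂ => c₁.natArrs ++ c₂.natArrs
  | .branch _ c₁ c₂ => c₁.natArrs ++ c₂.natArrs
  | .loop _ c => c.natArrs
  | _ => []

/-- The real arrays a program may write. -/
def Cmd.realArrs : Cmd → List ℕ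
  | .writeReal a _ _ => [a]
  | .seq c₁ c₂ => c₁.realArrs ++ c₂.realArrs
  | .branch _ c₁ c₂ => c₁.realArrs ++ c₂.realArrs
  | .loop _ c => c.realArrs
  | _ => []

/-- The states `s` and `s'` agree outside what `c` may write. -/
structure Frame (c : Cmd) (s s' : State) : Prop where
  natReg : ∀ r, r ∉ c.natRegs → s'.natReg r = s.natReg r
  realReg : ∀ r, r ∉ c.realRegs → s'.realReg r = s.realReg r
  natArr : ∀ a, a ∉ c.natArrs → s'.natArr a = s.natArr a
  realArr : ∀ a, a ∉ c.realArrs → s'.realArr a = s.realArr a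

theorem Frame.refl (c : Cmd) (s : State) : Frame c s s :=
  ⟨fun _ _ => rfl, fun _ _ => rfl, fun _ _ => rfl, fun _ _ => rfl⟩

theorem Frame.trans {c : Cmd} {s s₁ s₂ : State} (h₁ : Frame c s s₁) (h₂ : Frame c s₁ s₂) :
    Frame c s s₂ :=
  ⟨fun r h => (h₂.natReg r h).trans (h₁.natReg r h),
    fun r h => (h₂.realReg r h).trans (h₁.realReg r h),
    fun r h => (h₂.natArr r h).trans (h₁.natArr r h),
    fun r h => (h₂.realArr r h).trans (h₁.realArr r h)⟩

theorem Frame.weaken {c d : Cmd} {s s' : State} (h : Frame c s s')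
    (h₁ : c.natRegs ⊆ d.natRegs) (h₂ : c.realRegs ⊆ d.realRegs)
    (h₃ : c.natArrs ⊆ d.natArrs) (h₄ : c.realArrs ⊆ d.realArrs) : Frame d s s' :=
  ⟨fun r hr => h.natReg r fun k => hr (h₁ k), fun r hr => h.realReg r fun k => hr (h₂ k),
    fun r hr => h.natArr r fun k => hr (h₃ k), fun r hr => h.realArr r fun k => hr (h₄ k)⟩

theorem Frame.seq_left {c₁ c₂ : Cmd} {s s' : State} (h : Frame c₁ s s') :
    Frame (.seq c₁ c₂) s s' :=
  h.weaken (List.subset_append_left _ _) (List.subset_append_left _ _)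
    (List.subset_append_left _ _) (List.subset_append_left _ _)

theorem Frame.seq_right {c₁ c₂ : Cmd} {s s' : State} (h : Frame c₂ s s') :
    Frame (.seq c₁ c₂) s s' :=
  h.weaken (List.subset_append_right _ _) (List.subset_append_right _ _)
    (List.subset_append_right _ _) (List.subset_append_right _ _)

/-- The written cells are a syntactic property of the program, so that "this cell is unchanged"
becomes a non-membership in an explicit list, mostly settled by `decide`. This keeps loop invariants
down to the cells that change. -/
theorem Exec.frame {c : Cmd} {s s' : State} {t : ℕ} (h : Exec c s t s') : Frame c s s' := by
  induction h with
  | skip s => exact Frame.refl _ _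
  | setNat s r e =>
    refine ⟨fun r' h => ?_, fun _ _ => rfl, fun _ _ => rfl, fun _ _ => rfl⟩
    simp only [Cmd.natRegs, List.mem_singleton] at h
    simp [h]
  | setReal s r e =>
    refine ⟨fun _ _ => rfl, fun r' h => ?_, fun _ _ => rfl, fun _ _ => rfl⟩
    simp only [Cmd.realRegs, List.mem_singleton] at h
    simp [h]
  | writeNat s a i e =>
    refine ⟨fun _ _ => rfl, fun _ _ => rfl, fun a' h => ?_, fun _ _ => rfl⟩
    simp only [Cmd.natArrs, List.mem_singleton] at h
    simp [h]
  | writeReal s a i e =>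
    refine ⟨fun _ _ => rfl, fun _ _ => rfl, fun _ _ => rfl, fun a' h => ?_⟩
    simp only [Cmd.realArrs, List.mem_singleton] at h
    simp [h]
  | seq _ _ ih₁ ih₂ => exact ih₁.seq_left.trans ih₂.seq_right
  | branch_true _ _ ih =>
    exact ih.weaken (List.subset_append_left _ _) (List.subset_append_left _ _)
      (List.subset_append_left _ _) (List.subset_append_left _ _)
  | branch_false _ _ ih =>
    exact ih.weaken (List.subset_append_right _ _) (List.subset_append_right _ _)
      (List.subset_append_right _ _) (List.subset_append_right _ _)
  | loop_done _ => exact Frame.refl _ _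
  | loop_step _ _ _ ih₁ ih₂ =>
    exact Frame.trans ⟨ih₁.natReg, ih₁.realReg, ih₁.natArr, ih₁.realArr⟩ ih₂

/-! ### Timed total correctness -/

/-- Started in `s`, the program `c` halts within `T` steps in a state satisfying `Q`. -/
def Runs (c : Cmd) (s : State) (T : ℕ) (Q : State → Prop) : Prop :=
  ∃ t s', Exec c s t s' ∧ t ≤ T ∧ Q s'

/-- The new postcondition may use the frame of the program in addition to the old postcondition. -/
theorem Runs.mono {c : Cmd} {s : State} {T T' : ℕ} {Q Q' : State → Prop} (h : Runs c s T Q)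
    (hT : T ≤ T') (hQ : ∀ s', Frame c s s' → Q s' → Q' s') : Runs c s T' Q' := by
  obtain ⟨t, s', he, ht, hq⟩ := h
  exact ⟨t, s', he, ht.trans hT, hQ s' he.frame hq⟩

theorem Runs.seq {c₁ c₂ : Cmd} {s : State} {T₁ T₂ : ℕ} {Q₁ Q : State → Prop}
    (h₁ : Runs c₁ s T₁ Q₁) (h₂ : ∀ s₁, Frame c₁ s s₁ → Q₁ s₁ → Runs c₂ s₁ T₂ Q) :
    Runs (.seq c₁ c₂) s (T₁ + T₂) Q := by
  obtain ⟨t, s₁, he, ht, hq⟩ := h₁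
  obtain ⟨t', s₂, he', ht', hq'⟩ := h₂ s₁ he.frame hq
  exact ⟨_, s₂, .seq he he', add_le_add ht ht', hq'⟩

theorem Runs.branch {b : BExp} {c₁ c₂ : Cmd} {s : State} {T : ℕ} {Q : State → Prop}
    (h₁ : b.Holds s → Runs c₁ s T Q) (h₂ : ¬ b.Holds s → Runs c₂ s T Q) :
    Runs (.branch b c₁ c₂) s (b.cost + 1 + T) Q := by
  by_cases hb : b.Holds s
  · obtain ⟨t, s₁, he, ht, hq⟩ := h₁ hb
    exact ⟨_, s₁, .branch_true hb he, by omega, hq⟩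
  · obtain ⟨t, s₁, he, ht, hq⟩ := h₂ hb
    exact ⟨_, s₁, .branch_false hb he, by omega, hq⟩

/-- A loop whose remaining number of iterations is at most `k` while `I k` holds. -/
theorem Runs.while {b : BExp} {c : Cmd} {s₀ : State} (I : ℕ → State → Prop) (B : ℕ)
    {Q : State → Prop}
    (step : ∀ k s, Frame c s₀ s → I k s → (¬ b.Holds s ∧ Q s) ∨
      (b.Holds s ∧ ∃ k', k = k' + 1 ∧ Runs c s B (I k')))
    {k : ℕ} (h₀ : I k s₀) :
    Runs (.loop b c) s₀ (k * (B + b.cost + 1) + (b.cost + 1)) Q := by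
  suffices H : ∀ k s, Frame c s₀ s → I k s →
      Runs (.loop b c) s (k * (B + b.cost + 1) + (b.cost + 1)) Q from
    H k s₀ (Frame.refl _ _) h₀
  intro k
  induction k with
  | zero =>
    intro s hf hI
    rcases step _ s hf hI with ⟨hb, hq⟩ | ⟨_, k', hk, _⟩
    · exact ⟨_, s, .loop_done hb, by omega, hq⟩
    · omega
  | succ k ih =>
    intro s hf hI
    rcases step _ s hf hI with ⟨hb, hq⟩ | ⟨hb, k', hk, t, s₁, he, ht, hI'⟩
    · exact ⟨_, s, .loop_done hb, by omega, hq⟩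
    · obtain rfl : k = k' := by omega
      obtain ⟨t', s₂, he', ht', hq⟩ := ih s₁ (hf.trans he.frame) hI'
      refine ⟨_, s₂, .loop_step hb he he', ?_, hq⟩
      rw [Nat.add_one_mul]
      omega

/-- Sequential composition of a list of programs. -/
def block : List Cmd → Cmd
  | [] => .skip
  | c :: l => .seq c (block l)

/-- `for r = 0, …, m - 1 do body`, where `m` is the content of a register. -/
def forLoop (r m : ℕ) (body : Cmd) : Cmd :=
  .seq (.setNat r (.const 0)) (.loop (.natLe (.add (.reg r) (.const 1)) (.reg m))
    (.seq body (.setNat r (.add (.reg r) (.const 1)))))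

/-- The counter changes outside the body, so the invariant must be insensitive to it (`hI`). A round
costs 4 for the increment and 5 + 1 for the test besides the body; initialisation and the last test
cost 2 + 6. -/
theorem Runs.forLoop {r m : ℕ} {body : Cmd} {s₀ : State} {N : ℕ} (hm : s₀.natReg m = N)
    (hrm : r ≠ m) (hr : r ∉ body.natRegs) (hm' : m ∉ body.natRegs)
    (I : ℕ → State → Prop) (B : ℕ) (hI : ∀ k s v, I k s → I k (s.setNat r v))
    (h₀ : I 0 s₀)
    (step : ∀ k s, k < N → Frame (RealRAM.forLoop r m body) s₀ s → s.natReg r = k → I k s →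
      Runs body s B (I (k + 1))) :
    Runs (RealRAM.forLoop r m body) s₀ (N * (B + 10) + 8) (fun s => I N s ∧ s.natReg r = N) := by
  have hsub : ∀ s, Frame (.seq body (.setNat r (.add (.reg r) (.const 1)))) (s₀.setNat r 0) s →
      Frame (RealRAM.forLoop r m body) s₀ s := by
    intro s hf
    refine Frame.trans (s₁ := s₀.setNat r 0)
      ⟨fun r' h => ?_, fun _ _ => rfl, fun _ _ => rfl, fun _ _ => rfl⟩
      (hf.weaken ?_ ?_ ?_ ?_)
    · have : r' ≠ r := by
        rintro rfl
        exact h (by simp [RealRAM.forLoop, Cmd.natRegs])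
      simp [this]
    · exact List.subset_append_right _ _
    · exact List.subset_append_right _ _
    · exact List.subset_append_right _ _
    · exact List.subset_append_right _ _
  have hzero : Runs (.setNat r (.const 0)) s₀ 2 (fun s => s = s₀.setNat r 0) :=
    ⟨2, _, .setNat _ _ _, le_rfl, rfl⟩
  refine (hzero.seq (T₂ := N * (B + 10) + 6) ?_).mono (by omega) fun _ _ h => h
  rintro s₁ - rfl
  refine (Runs.while (fun k s => ∃ j, j + k = N ∧ s.natReg r = j ∧ I j s) (B + 4)
    ?_ (k := N) ⟨0, by omega, by simp, hI _ _ _ h₀⟩).mono ?_ fun _ _ h => h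
  · rintro k s hf ⟨j, hj, hsr, hIj⟩
    have hsm : s.natReg m = N := by
      rw [hf.natReg m (by simp [Cmd.natRegs, hm', hrm.symm]), ← hm]
      simp [hrm.symm]
    by_cases hjN : j < N
    · refine .inr ⟨by simp [hsr, hsm]; omega, k - 1, by omega, ?_⟩
      refine (step j s hjN (hsub s hf) hsr hIj).seq (T₂ := 4) fun s' hf' hI' => ?_
      refine ⟨4, _, .setNat _ _ _, le_rfl, j + 1, by omega, ?_, hI _ _ _ hI'⟩
      simp [hf'.natReg r hr, hsr]
    · obtain rfl : j = N := by omega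
      exact .inl ⟨by simp [hsr, hsm], hIj, hsr⟩
  · simp [BExp.cost, NExp.cost]

/-! ### Loop-free programs -/

/-- The program contains no loop. -/
def Cmd.flat : Cmd → Bool
  | .seq c₁ c₂ => c₁.flat && c₂.flat
  | .branch _ c₁ c₂ => c₁.flat && c₂.flat
  | .loop _ _ => false
  | _ => true

/-- The final state of a loop-free program. -/
noncomputable def Cmd.run : Cmd → State → State
  | .skip, s => s
  | .setNat r e, s => s.setNat r (e.eval s)
  | .setReal r e, s => s.setReal r (e.eval s)
  | .writeNat a i e, s => s.writeNat a (i.eval s) (e.eval s)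
  | .writeReal a i e, s => s.writeReal a (i.eval s) (e.eval s)
  | .seq c₁ c₂, s => c₂.run (c₁.run s)
  | .branch b c₁ c₂, s => open Classical in if b.Holds s then c₁.run s else c₂.run s
  | .loop _ _, s => s

/-- A bound for the number of steps of a loop-free program. -/
def Cmd.flatCost : Cmd → ℕ
  | .skip => 1
  | .setNat _ e => e.cost + 1
  | .setReal _ e => e.cost + 1
  | .writeNat _ i e => i.cost + e.cost + 1
  | .writeReal _ i e => i.cost + e.cost + 1
  | .seq c₁ c₂ => c₁.flatCost + c₂.flatCost
  | .branch b c₁ c₂ => b.cost + 1 + (c₁.flatCost + c₂.flatCost)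
  | .loop _ _ => 0

theorem Cmd.exec_run (c : Cmd) (hc : c.flat = true) (s : State) :
    ∃ t ≤ c.flatCost, Exec c s t (c.run s) := by
  induction c generalizing s with
  | skip => exact ⟨_, le_rfl, .skip _⟩
  | setNat r e => exact ⟨_, le_rfl, .setNat _ _ _⟩
  | setReal r e => exact ⟨_, le_rfl, .setReal _ _ _⟩
  | writeNat a i e => exact ⟨_, le_rfl, .writeNat _ _ _ _⟩
  | writeReal a i e => exact ⟨_, le_rfl, .writeReal _ _ _ _⟩
  | seq c₁ c₂ ih₁ ih₂ =>
    simp only [Cmd.flat, Bool.and_eq_true] at hc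
    obtain ⟨t₁, h₁, e₁⟩ := ih₁ hc.1 s
    obtain ⟨t₂, h₂, e₂⟩ := ih₂ hc.2 (c₁.run s)
    exact ⟨_, add_le_add h₁ h₂, .seq e₁ e₂⟩
  | branch b c₁ c₂ ih₁ ih₂ =>
    simp only [Cmd.flat, Bool.and_eq_true] at hc
    by_cases hb : b.Holds s
    · obtain ⟨t₁, h₁, e₁⟩ := ih₁ hc.1 s
      refine ⟨_, ?_, by simpa only [Cmd.run, hb, if_true] using Exec.branch_true hb e₁⟩
      simp only [Cmd.flatCost]; omega
    · obtain ⟨t₁, h₁, e₁⟩ := ih₂ hc.2 s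
      refine ⟨_, ?_, by simpa only [Cmd.run, hb, if_false] using Exec.branch_false hb e₁⟩
      simp only [Cmd.flatCost]; omega
  | loop => simp [Cmd.flat] at hc

/-- Turns a loop-free program into a computation of its final state: flatness and cost are usually
checked by evaluation and the postcondition by unfolding `Cmd.run`. -/
theorem Runs.flat {c : Cmd} {s : State} {Q : State → Prop} {T : ℕ} (hc : c.flat = true)
    (hT : c.flatCost ≤ T) (hQ : Q (c.run s)) : Runs c s T Q := by
  obtain ⟨t, ht, he⟩ := c.exec_run hc s
  exact ⟨t, _, he, ht.trans hT, hQ⟩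

end RealRAM

namespace RealRAM

/-! ### Sorting by a tournament tree

The leaves `n, …, 2 n - 1` of the tree hold the indices (plus one) of the intervals that are still to
be extracted, an inner node `v` holds the better one of the entries of `2 v` and `2 v + 1`, and `0`
stands for no entry. -/

open Classical in
/-- The winner of two entries. -/
noncomputable def winner (key : ℕ → ℝ) (l r : ℕ) : ℕ :=
  if 1 ≤ l ∧ ¬ (1 ≤ r ∧ ¬ key (l - 1) ≤ key (r - 1)) then l else r

theorem winner_eq_or (key : ℕ → ℝ) (l r : ℕ) : winner key l r = l ∨ winner key l r = r := by
  unfold winner; split_ifs <;> simp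

theorem winner_left {key : ℕ → ℝ} {l r : ℕ} (h : l ≠ 0) :
    winner key l r ≠ 0 ∧ key (winner key l r - 1) ≤ key (l - 1) := by
  unfold winner
  split_ifs with hc
  · exact ⟨h, le_rfl⟩
  · have h1 : 1 ≤ l := by omega
    simp only [h1, true_and, not_not, not_le] at hc
    exact ⟨by omega, hc.2.le⟩

theorem winner_right {key : ℕ → ℝ} {l r : ℕ} (h : r ≠ 0) :
    winner key l r ≠ 0 ∧ key (winner key l r - 1) ≤ key (r - 1) := by
  unfold winner
  split_ifs with hc
  · have h1 : 1 ≤ r := by omega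
    simp only [h1, true_and, not_not] at hc
    exact ⟨by omega, hc.2⟩
  · exact ⟨h, le_rfl⟩

/-- The inner nodes of the tournament tree `T` hold the winners of their children. -/
def IsTournament (key : ℕ → ℝ) (n : ℕ) (T : ℕ → ℕ) : Prop :=
  ∀ u, 1 ≤ u → u < n → T u = winner key (T (u + u)) (T (u + u + 1))

/-- A nonempty node has a nonempty parent with no larger key; iterate `v ↦ v / 2` until the root. -/
theorem IsTournament.root_le {key : ℕ → ℝ} {n : ℕ} {T : ℕ → ℕ} (h : IsTournament key n T) (v : ℕ)
    (hv : 1 ≤ v) (hn : v < n + n) (hT : T v ≠ 0) : T 1 ≠ 0 ∧ key (T 1 - 1) ≤ key (T v - 1) := by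
  induction v using Nat.strong_induction_on with
  | _ v ih =>
    rcases Nat.lt_or_ge 1 v with h1 | h1
    · have hu := h (v / 2) (by omega) (by omega)
      have key' : T (v / 2) ≠ 0 ∧ key (T (v / 2) - 1) ≤ key (T v - 1) := by
        rcases Nat.even_or_odd' v with ⟨w, rfl | rfl⟩
        · have e : 2 * w / 2 = w := by omega
          rw [e] at hu ⊢
          rw [show 2 * w = w + w by ring] at hT ⊢
          rw [hu]
          exact winner_left hT
        · have e : (2 * w + 1) / 2 = w := by omega
          rw [e] at hu ⊢
          rw [show 2 * w + 1 = w + w + 1 by ring] at hT ⊢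
          rw [hu]
          exact winner_right hT
      obtain ⟨h2, h3⟩ := ih (v / 2) (by omega) (by omega) (by omega) key'.1
      exact ⟨h2, h3.trans key'.2⟩
    · obtain rfl : v = 1 := by omega
      exact ⟨hT, le_rfl⟩

/-- Every inner entry is copied from a child, so it can be followed down to a leaf. The induction is
on `n + n - v`, which decreases because children have larger numbers. -/
theorem IsTournament.exists_leaf {key : ℕ → ℝ} {n : ℕ} {T : ℕ → ℕ} (h : IsTournament key n T)
    (k v : ℕ) (hk : k + v = n + n) (hv : 1 ≤ v) (hn : v < n + n) : ∃ i < n, T (n + i) = T v := by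
  induction k using Nat.strong_induction_on generalizing v with
  | _ k ih =>
    rcases Nat.lt_or_ge v n with h1 | h1
    · rw [h v hv h1]
      rcases winner_eq_or key (T (v + v)) (T (v + v + 1)) with e | e <;> rw [e]
      · exact ih (n + n - (v + v)) (by omega) _ (by omega) (by omega) (by omega)
      · exact ih (n + n - (v + v + 1)) (by omega) _ (by omega) (by omega) (by omega)
    · exact ⟨v - n, by omega, by congr 1; omega⟩

/-- Recompute the node in register `14`. -/
def combine : Cmd :=
  .branch (.and (.natLe (.const 1) (.read 8 (.add (.reg 14) (.reg 14))))
      (.not (.and (.natLe (.const 1) (.read 8 (.add (.add (.reg 14) (.reg 14)) (.const 1))))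
        (.not (.realLe (.read 0 (.sub (.read 8 (.add (.reg 14) (.reg 14))) (.const 1)))
          (.read 0 (.sub (.read 8 (.add (.add (.reg 14) (.reg 14)) (.const 1))) (.const 1))))))))
    (.writeNat 8 (.reg 14) (.read 8 (.add (.reg 14) (.reg 14))))
    (.writeNat 8 (.reg 14) (.read 8 (.add (.add (.reg 14) (.reg 14)) (.const 1))))

theorem run_combine (s : State) :
    combine.run s = s.writeNat 8 (s.natReg 14) (winner (s.realArr 0)
      (s.natArr 8 (s.natReg 14 + s.natReg 14)) (s.natArr 8 (s.natReg 14 + s.natReg 14 + 1))) := by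
  simp only [combine, Cmd.run, winner, BExp.Holds, NExp.eval, RExp.eval]
  split_ifs with h
  · exact if_pos h
  · exact if_neg h

/-- There is no division by two, so the parent of a node has to be looked up; the table is filled
here, where the children of a node are found by addition. -/
def buildStep : Cmd :=
  block [.writeNat 7 (.add (.reg 14) (.reg 14)) (.reg 14),
    .writeNat 7 (.add (.add (.reg 14) (.reg 14)) (.const 1)) (.reg 14),
    combine, .setNat 14 (.sub (.reg 14) (.const 1))]

/-- Set up the tournament tree and the table of parents. -/
def buildTree : Cmd :=
  block [forLoop 8 0 (.writeNat 8 (.add (.reg 0) (.reg 8)) (.add (.reg 8) (.const 1))),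
    .setNat 14 (.sub (.reg 0) (.const 1)),
    .loop (.natLe (.const 1) (.reg 14)) buildStep]

/-- Inner nodes are computed in decreasing order, so both children are final when their winner is
determined. -/
theorem runs_buildTree {s : State} {n : ℕ} (hn : s.natReg 0 = n) (h0 : 0 < n) :
    Runs buildTree s (200 * n) (fun s' => (∀ i < n, s'.natArr 8 (n + i) = i + 1) ∧
      IsTournament (s.realArr 0) n (s'.natArr 8) ∧
      ∀ v, 2 ≤ v → v < n + n → s'.natArr 7 v = v / 2) := by
  have key1 := Runs.forLoop (r := 8) (m := 0)
    (body := .writeNat 8 (.add (.reg 0) (.reg 8)) (.add (.reg 8) (.const 1))) (s₀ := s) hn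
    (by decide) (by decide) (by decide) (fun k s' => ∀ i < k, s'.natArr 8 (n + i) = i + 1) 20
    (fun k s v h => h) (by simp) (by
      intro k s' hk hf h8 hI
      have h0' : s'.natReg 0 = n := by rw [hf.natReg 0 (by decide), hn]
      refine .flat rfl (by decide) ?_
      intro i hi
      simp only [Cmd.run, NExp.eval, State.natArr_writeNat, if_true, h8, h0',
        Function.update_apply]
      split_ifs with h
      · omega
      · exact hI i (by omega))
  refine (key1.seq (T₂ := 4 + (n * 100 + 10)) ?_).mono (by omega) fun _ _ h => h
  rintro s₁ hf₁ ⟨hl, -⟩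
  have hn₁ : s₁.natReg 0 = n := by rw [hf₁.natReg 0 (by decide), hn]
  have hset : Runs (.setNat 14 (.sub (.reg 0) (.const 1))) s₁ 4
      (fun s' => s' = s₁.setNat 14 (n - 1)) := .flat rfl (by decide) (by simp [Cmd.run, hn₁])
  refine hset.seq ?_
  rintro s₂ - rfl
  refine Runs.mono (T := (n * (85 + 5) + 4) + 1) ?_ (by omega) fun _ _ h => h
  refine Runs.seq (Q₁ := fun s' => (∀ i < n, s'.natArr 8 (n + i) = i + 1) ∧
      IsTournament (s.realArr 0) n (s'.natArr 8) ∧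
      ∀ v, 2 ≤ v → v < n + n → s'.natArr 7 v = v / 2) ?_ (fun s' _ h => .flat rfl (by decide) h)
  refine (Runs.while (fun k s' => s'.natReg 14 = k ∧ k < n ∧ (∀ i < n, s'.natArr 8 (n + i) = i + 1) ∧
      (∀ u, k < u → u < n →
        s'.natArr 8 u = winner (s.realArr 0) (s'.natArr 8 (u + u)) (s'.natArr 8 (u + u + 1))) ∧
      ∀ v, k + k + 2 ≤ v → v < n + n → s'.natArr 7 v = v / 2) 85 ?_ (k := n - 1)
      (s₀ := s₁.setNat 14 (n - 1)) ⟨by simp, by omega, hl, by omega, by omega⟩).mono ?_ fun _ _ h => h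
  · rintro k s' hf ⟨h14, hkn, hlf, hT, hp⟩
    have hkey : s'.realArr 0 = s.realArr 0 := by
      rw [hf.realArr 0 (by decide)]
      exact hf₁.realArr 0 (by decide)
    rcases Nat.eq_zero_or_pos k with rfl | hk
    · exact .inl ⟨by simp [h14], hlf, fun u h1 h2 => hT u (by omega) h2,
        fun v h1 h2 => hp v (by omega) h2⟩
    · refine .inr ⟨by simp [h14]; omega, k - 1, by omega, .flat rfl (by decide) ?_⟩
      simp only [buildStep, block, Cmd.run, run_combine, NExp.eval, State.natReg_writeNat,
        State.natReg_setNat, State.natArr_setNat, State.natArr_writeNat, State.realArr_writeNat,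
        h14, if_true, hkey, show (8 : ℕ) ≠ 7 by decide, show (7 : ℕ) ≠ 8 by decide, if_false]
      refine ⟨trivial, by omega, fun i hi => ?_, fun u h1 h2 => ?_, fun v h1 h2 => ?_⟩
      · rw [Function.update_of_ne (by omega)]
        exact hlf i hi
      · rw [Function.update_of_ne (a' := k) (a := u + u) (by omega),
          Function.update_of_ne (a' := k) (a := u + u + 1) (by omega)]
        rcases Nat.lt_or_ge k u with h3 | h3
        · rw [Function.update_of_ne (by omega)]
          exact hT u h3 h2
        · obtain rfl : u = k := by omega
          simp
      · simp only [Function.update_apply]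
        split_ifs with h3 h4
        · omega
        · omega
        · exact hp v (by omega) h2
  · have : (BExp.natLe (.const 1) (.reg 14)).cost = 3 := rfl
    rw [this]
    omega

def climb : Cmd :=
  .loop (.natLe (.const 2) (.reg 14)) (.seq (.setNat 14 (.read 7 (.reg 14))) combine)

/-- Changing a leaf can spoil only its proper ancestors `v / 2 ^ (j + 1)`, so the tournament
condition is assumed away from these. Each step repairs the parent and shortens the list of
exceptions; at the root none is left. -/
theorem runs_climb {s : State} {n L : ℕ} (hL : Nat.log 2 (n + n) ≤ L)
    (hp : ∀ v, 2 ≤ v → v < n + n → s.natArr 7 v = v / 2)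
    (h1 : 1 ≤ s.natReg 14) (h2 : s.natReg 14 < n + n)
    (hT : ∀ u, 1 ≤ u → u < n → (∀ j, u ≠ s.natReg 14 / 2 ^ (j + 1)) →
      s.natArr 8 u = winner (s.realArr 0) (s.natArr 8 (u + u)) (s.natArr 8 (u + u + 1))) :
    Runs climb s (70 * L + 4) (fun s' => (∀ i, s'.natArr 8 (n + i) = s.natArr 8 (n + i)) ∧
      IsTournament (s.realArr 0) n (s'.natArr 8)) := by
  refine (Runs.while (fun k s' => 1 ≤ s'.natReg 14 ∧ s'.natReg 14 < n + n ∧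
      Nat.log 2 (s'.natReg 14) ≤ k ∧ (∀ i, s'.natArr 8 (n + i) = s.natArr 8 (n + i)) ∧
      (∀ u, 1 ≤ u → u < n → (∀ j, u ≠ s'.natReg 14 / 2 ^ (j + 1)) →
        s'.natArr 8 u = winner (s.realArr 0) (s'.natArr 8 (u + u)) (s'.natArr 8 (u + u + 1)))) 65
      ?_ (k := L) ⟨h1, h2, (Nat.log_mono_right h2.le).trans hL, fun _ => rfl, hT⟩).mono
      (by simp [BExp.cost, NExp.cost]; omega) fun _ _ h => h
  rintro k s' hf ⟨g1, g2, g3, g4, g5⟩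
  have hkey : s'.realArr 0 = s.realArr 0 := hf.realArr 0 (by decide)
  have hpar : s'.natArr 7 = s.natArr 7 := hf.natArr 7 (by decide)
  set v := s'.natReg 14 with hv
  rcases Nat.lt_or_ge v 2 with h | h
  · refine .inl ⟨by simp [← hv]; omega, g4, fun u hu hun => g5 u hu hun fun j hj => ?_⟩
    have : v / 2 ^ (j + 1) = 0 := Nat.div_eq_of_lt (h.trans_le (by
      calc 2 = 2 ^ 1 := rfl
        _ ≤ 2 ^ (j + 1) := Nat.pow_le_pow_right (by omega) (by omega)))
    omega
  · have hlog : Nat.log 2 v = Nat.log 2 (v / 2) + 1 := by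
      rw [Nat.log_of_one_lt_of_le (by omega) h]
    have hdiv : ∀ j, v / 2 / 2 ^ j = v / 2 ^ (j + 1) := fun j => by
      rw [Nat.div_div_eq_div_mul, pow_succ']
    refine .inr ⟨by simp [← hv]; omega, k - 1, by omega, .flat rfl (by decide) ?_⟩
    simp only [Cmd.run, run_combine, NExp.eval, State.natReg_writeNat,
        State.natReg_setNat, State.natArr_setNat, State.natArr_writeNat, State.realArr_setNat,
        if_true, hkey, ← hv, hpar, hp v h g2]
    refine ⟨by omega, by omega, by omega, fun i => ?_, fun u hu1 hu2 hu3 => ?_⟩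
    · rw [Function.update_of_ne (by omega)]
      exact g4 i
    · have h3 := hu3 0
      rw [zero_add, pow_one] at h3
      rw [Function.update_of_ne (a' := v / 2) (a := u + u) (by omega),
        Function.update_of_ne (a' := v / 2) (a := u + u + 1) (by omega)]
      by_cases hu : u = v / 2
      · subst hu; simp
      · rw [Function.update_of_ne hu]
        refine g5 u hu1 hu2 fun j => ?_
        rcases j with _ | j
        · simpa using hu
        · rw [← hdiv]; exact hu3 j

/-- A real number, negated if `neg` is set. -/
def signed (neg : Bool) (x : ℝ) : ℝ := if neg then 0 - x else x

/-- The expression for `signed`; real register `2` is never written. -/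
def signedExp (neg : Bool) (e : RExp) : RExp := if neg then .sub (.reg 2) e else e

theorem eval_signedExp (neg : Bool) (e : RExp) (s : State) (h : s.realReg 2 = 0) :
    (signedExp neg e).eval s = signed neg (e.eval s) := by
  cases neg <;> simp [signedExp, signed, h]

/-- Remove the root of the tree and append it to the sorted list. -/
def extract (neg : Bool) : Cmd :=
  block [.setNat 15 (.sub (.read 8 (.const 1)) (.const 1)),
    .writeNat 9 (.reg 8) (.reg 15),
    .writeReal 2 (.reg 8) (signedExp neg (.read 0 (.reg 15))),
    .writeReal 3 (.reg 8) (signedExp neg (.read 1 (.reg 15))),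
    .setNat 14 (.add (.reg 0) (.reg 15)),
    .writeNat 8 (.reg 14) (.const 0)]

/-- Sort the intervals by their left endpoints into the real arrays `2` and `3`. -/
def sort (neg : Bool) : Cmd :=
  .seq buildTree (forLoop 8 0 (.seq (extract neg) climb))

/-- The real arrays `2` and `3` list the (signed) endpoints in the order given by `ord`. -/
structure SortedBy (neg : Bool) (n : ℕ) (l r : ℕ → ℝ) (ord : ℕ → ℕ) (A Y : ℕ → ℝ) : Prop where
  lt : ∀ o < n, ord o < n
  inj : ∀ o < n, ∀ o' < n, ord o = ord o' → o = o'
  mono : ∀ o o', o ≤ o' → o' < n → l (ord o) ≤ l (ord o')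
  left : ∀ o < n, A o = signed neg (l (ord o))
  right : ∀ o < n, Y o = signed neg (r (ord o))

/-- Tournament sort: each of the `n` rounds outputs the root, empties its leaf and repairs one path
of logarithmic length. The invariant says that leaf `i` holds `i + 1` until `i` is output and `0`
afterwards, and that each output is minimal among the indices not output before it. -/
theorem runs_sort {neg : Bool} {s : State} {n L : ℕ} (hn : s.natReg 0 = n) (h0 : 0 < n)
    (hL : Nat.log 2 (n + n) ≤ L) (hz : s.realReg 2 = 0) :
    Runs (sort neg) s (n * (70 * L + 300)) (fun s' =>
      SortedBy neg n (s.realArr 0) (s.realArr 1) (s'.natArr 9) (s'.realArr 2) (s'.realArr 3)) := by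
  refine ((runs_buildTree hn h0).seq (T₂ := n * (40 + (70 * L + 4) + 10) + 8) ?_).mono
    (by nlinarith) fun _ _ h => h
  rintro s₁ hf₁ ⟨hleaf, htree, hpar⟩
  have hn₁ : s₁.natReg 0 = n := by rw [hf₁.natReg 0 (by decide), hn]
  have hk₀ : s₁.realArr 0 = s.realArr 0 := hf₁.realArr 0 (by decide)
  have hk₁ : s₁.realArr 1 = s.realArr 1 := hf₁.realArr 1 (by decide)
  have hz₁ : s₁.realReg 2 = 0 := by rw [hf₁.realReg 2 (by decide), hz]
  have main := Runs.forLoop (r := 8) (m := 0) (body := .seq (extract neg) climb) (s₀ := s₁) hn₁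
    (by decide) (by cases neg <;> decide) (by cases neg <;> decide)
    (fun o s' => (∀ p < o, s'.natArr 9 p < n) ∧
      (∀ p < o, ∀ i < n, (∀ p' < p, s'.natArr 9 p' ≠ i) →
        s.realArr 0 (s'.natArr 9 p) ≤ s.realArr 0 i) ∧
      (∀ p < o, ∀ p' < p, s'.natArr 9 p' ≠ s'.natArr 9 p) ∧
      (∀ p < o, s'.realArr 2 p = signed neg (s.realArr 0 (s'.natArr 9 p))) ∧
      (∀ p < o, s'.realArr 3 p = signed neg (s.realArr 1 (s'.natArr 9 p))) ∧
      (∀ i < n, (∀ p < o, s'.natArr 9 p ≠ i) → s'.natArr 8 (n + i) = i + 1) ∧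
      (∀ i < n, ∀ p < o, s'.natArr 9 p = i → s'.natArr 8 (n + i) = 0) ∧
      IsTournament (s.realArr 0) n (s'.natArr 8)) (40 + (70 * L + 4))
    (fun k s v h => h)
    ⟨by omega, by omega, by omega, by omega, by omega, fun i hi _ => hleaf i hi, by omega, htree⟩
    ?_
  · refine main.mono le_rfl ?_
    rintro s' - ⟨⟨g1, g2, g3, g4, g5, -⟩, -⟩
    refine ⟨g1, fun o ho o' ho' he => ?_, fun o o' h ho' => ?_, g4, g5⟩
    · rcases lt_trichotomy o o' with h | h | h
      · exact absurd he (g3 o' ho' o h)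
      · exact h
      · exact absurd he.symm (g3 o ho o' h)
    · exact g2 o (by omega) _ (g1 o' ho') fun p' hp' => g3 o' ho' p' (by omega)
  · rintro o s' ho hf h8 ⟨g1, g2, g3, g4, g5, g6, g7, g8⟩
    have hn' : s'.natReg 0 = n := by rw [hf.natReg 0 (by cases neg <;> decide), hn₁]
    have hk₀' : s'.realArr 0 = s.realArr 0 := by rw [hf.realArr 0 (by cases neg <;> decide), hk₀]
    have hk₁' : s'.realArr 1 = s.realArr 1 := by rw [hf.realArr 1 (by cases neg <;> decide), hk₁]
    have hz' : s'.realReg 2 = 0 := by rw [hf.realReg 2 (by cases neg <;> decide), hz₁]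
    have hpar' : s'.natArr 7 = s₁.natArr 7 := hf.natArr 7 (by cases neg <;> decide)
    -- some leaf is still occupied
    obtain ⟨i₀, hi₀, hi₀'⟩ : ∃ i < n, ∀ p < o, s'.natArr 9 p ≠ i := by
      by_contra hcon
      push Not at hcon
      have hsub : Finset.range n ⊆ (Finset.range o).image (s'.natArr 9) := fun i hi => by
        obtain ⟨p, hp, hpi⟩ := hcon i (Finset.mem_range.1 hi)
        exact Finset.mem_image.2 ⟨p, Finset.mem_range.2 hp, hpi⟩
      have := (Finset.card_le_card hsub).trans Finset.card_image_le
      simp at this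
      omega
    have hroot := g8.root_le (n + i₀) (by omega) (by omega) (by rw [g6 i₀ hi₀ hi₀']; omega)
    -- The root repeats the entry of some leaf `e`. As the root is nonempty, `e` has not been
    -- output, so the entry is `e + 1`.
    obtain ⟨e, he, hTe⟩ := g8.exists_leaf (n + n - 1) 1 (by omega) le_rfl (by omega)
    have he' : ∀ p < o, s'.natArr 9 p ≠ e := fun p hp hpe => by
      rw [g7 e he p hp hpe] at hTe
      exact hroot.1 hTe.symm
    rw [g6 e he he'] at hTe
    have hmin : ∀ i < n, (∀ p < o, s'.natArr 9 p ≠ i) → s.realArr 0 e ≤ s.realArr 0 i := by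
      intro i hi hi'
      have := (g8.root_le (n + i) (by omega) (by omega) (by rw [g6 i hi hi']; omega)).2
      rwa [g6 i hi hi', ← hTe, Nat.add_sub_cancel, Nat.add_sub_cancel] at this
    have hext : Runs (extract neg) s' 40 (fun t => t.natReg 14 = n + e ∧
        t.natArr 9 = Function.update (s'.natArr 9) o e ∧
        t.realArr 2 = Function.update (s'.realArr 2) o (signed neg (s.realArr 0 e)) ∧
        t.realArr 3 = Function.update (s'.realArr 3) o (signed neg (s.realArr 1 e)) ∧
        t.natArr 8 = Function.update (s'.natArr 8) (n + e) 0) := by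
      refine .flat (by cases neg <;> rfl) (by cases neg <;> decide) ?_
      simp [extract, block, Cmd.run, eval_signedExp, hz', h8, hn', hk₀', hk₁', ← hTe]
    refine hext.seq ?_
    rintro s₂ hf₂ ⟨k1, k2, k3, k4, k5⟩
    have hk₀'' : s₂.realArr 0 = s.realArr 0 := by rw [hf₂.realArr 0 (by cases neg <;> decide), hk₀']
    refine (runs_climb (n := n) hL (fun v hv hv' => ?_) (by omega) (by omega) ?_).mono le_rfl ?_
    · rw [hf₂.natArr 7 (by cases neg <;> decide), hpar']
      exact hpar v hv hv'
    · intro u hu hun hanc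
      have h3 := hanc 0
      rw [k1, zero_add, pow_one] at h3
      rw [k5, hk₀'', Function.update_of_ne (by omega), Function.update_of_ne (by omega),
        Function.update_of_ne (by omega)]
      exact g8 u hu hun
    · rintro s₃ hf₃ ⟨m1, m2⟩
      have a9 : s₃.natArr 9 = s₂.natArr 9 := hf₃.natArr 9 (by decide)
      have r2 : s₃.realArr 2 = s₂.realArr 2 := hf₃.realArr 2 (by decide)
      have r3 : s₃.realArr 3 = s₂.realArr 3 := hf₃.realArr 3 (by decide)
      rw [hk₀''] at m2
      have hlt : ∀ p < o, s₃.natArr 9 p = s'.natArr 9 p := fun p hp => by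
        rw [a9, k2, Function.update_of_ne (by omega)]
      have heq : s₃.natArr 9 o = e := by rw [a9, k2, Function.update_self]
      refine ⟨fun p hp => ?_, fun p hp i hi hi' => ?_, fun p hp p' hp' => ?_, fun p hp => ?_,
        fun p hp => ?_, fun i hi hi' => ?_, fun i hi p hp hpi => ?_, m2⟩
      · rcases Nat.lt_succ_iff_lt_or_eq.1 hp with h | rfl
        · rw [hlt p h]; exact g1 p h
        · rwa [heq]
      · rcases Nat.lt_succ_iff_lt_or_eq.1 hp with h | rfl
        · rw [hlt p h]
          exact g2 p h i hi fun p' hp' => by rw [← hlt p' (by omega)]; exact hi' p' hp'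
        · rw [heq]
          exact hmin i hi fun p' hp' => by rw [← hlt p' hp']; exact hi' p' hp'
      · rcases Nat.lt_succ_iff_lt_or_eq.1 hp with h | rfl
        · rw [hlt p h, hlt p' (by omega)]; exact g3 p h p' hp'
        · rw [heq, hlt p' hp']; exact he' p' hp'
      · rcases Nat.lt_succ_iff_lt_or_eq.1 hp with h | rfl
        · rw [hlt p h, r2, k3, Function.update_of_ne (by omega)]; exact g4 p h
        · rw [heq, r2, k3, Function.update_self]
      · rcases Nat.lt_succ_iff_lt_or_eq.1 hp with h | rfl
        · rw [hlt p h, r3, k4, Function.update_of_ne (by omega)]; exact g5 p h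
        · rw [heq, r3, k4, Function.update_self]
      · have hie : i ≠ e := fun h => hi' o (by omega) (heq.trans h.symm)
        rw [m1, k5, Function.update_of_ne (by omega)]
        exact g6 i hi fun p hp => by rw [← hlt p hp]; exact hi' p (by omega)
      · rw [m1, k5]
        rcases Nat.lt_succ_iff_lt_or_eq.1 hp with h | rfl
        · have hie : i ≠ e := fun h' => he' p h (by rw [← hlt p h, hpi, h'])
          rw [Function.update_of_ne (by omega)]
          exact g7 i hi p h (by rw [← hlt p h, hpi])
        · rw [← hpi, heq, Function.update_self]

end RealRAM

namespace RealRAM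

/-! ### Distinct lengths and their weights -/

/-- Multiply register `4` by the content of register `1` plus one. -/
def mulWeight : Cmd :=
  .seq (.setNat 19 (.reg 4)) (forLoop 11 1 (.setNat 4 (.add (.reg 4) (.reg 19))))

/-- Multiplication by `τ + 1` is done by `τ` additions of the saved value; the resulting factor `τ +
1` in the running time is part of `timeFactor`. -/
theorem runs_mulWeight {s : State} {τ : ℕ} (hτ : s.natReg 1 = τ) :
    Runs mulWeight s (20 * (τ + 1)) (fun s' => s'.natReg 4 = (τ + 1) * s.natReg 4) := by
  have h1 : Runs (.setNat 19 (.reg 4)) s 2 (fun s' => s' = s.setNat 19 (s.natReg 4)) :=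
    .flat rfl (by decide) rfl
  refine (h1.seq (T₂ := τ * (4 + 10) + 8) ?_).mono (by omega) fun _ _ h => h
  rintro s₁ - rfl
  refine (Runs.forLoop (N := τ) (by simpa using hτ) (by decide) (by decide) (by decide)
    (fun k s' => s'.natReg 4 = (k + 1) * s.natReg 4) 4 (fun k s v h => by simpa using h)
    (by simp) ?_).mono le_rfl fun _ _ h => h.1
  intro k s' hk hf _ hI
  have h19 : s'.natReg 19 = s.natReg 4 := by rw [hf.natReg 19 (by decide)]; simp
  exact .flat rfl (by decide) (by simp [Cmd.run, h19, hI]; ring)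

/-- Search the length in real register `7` among the distinct lengths found so far. -/
def findLen : Cmd :=
  .seq (.setNat 18 (.const 0))
    (.loop (.and (.natLe (.add (.reg 18) (.const 1)) (.reg 2))
      (.not (.and (.realLe (.read 4 (.reg 18)) (.reg 7)) (.realLe (.reg 7) (.read 4 (.reg 18))))))
      (.setNat 18 (.add (.reg 18) (.const 1))))

/-- Linear search; the final index `K` means that the length is new. Equality of reals is tested by
two comparisons. -/
theorem runs_findLen {s : State} {K : ℕ} (hK : s.natReg 2 = K) :
    Runs findLen s (25 * (K + 1)) (fun s' => s'.natReg 18 ≤ K ∧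
      (∀ k < s'.natReg 18, s.realArr 4 k ≠ s.realReg 7) ∧
      (s'.natReg 18 < K → s.realArr 4 (s'.natReg 18) = s.realReg 7)) := by
  have h1 : Runs (.setNat 18 (.const 0)) s 2 (fun s' => s' = s.setNat 18 0) :=
    .flat rfl (by decide) rfl
  refine (h1.seq (T₂ := K * (4 + 16 + 1) + (16 + 1)) ?_).mono (by omega) fun _ _ h => h
  rintro s₁ - rfl
  refine (Runs.while (fun j s' => s'.natReg 18 + j = K ∧
    ∀ k < s'.natReg 18, s.realArr 4 k ≠ s.realReg 7) 4 ?_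
    (s₀ := s.setNat 18 0) (k := K) ⟨by simp, by simp⟩).mono ?_ fun _ _ h => h
  · rintro j s' hf ⟨h18, hne⟩
    have a4 : s'.realArr 4 = s.realArr 4 := hf.realArr 4 (by decide)
    have r7 : s'.realReg 7 = s.realReg 7 := hf.realReg 7 (by decide)
    have r2 : s'.natReg 2 = K := by rw [hf.natReg 2 (by decide)]; simpa using hK
    by_cases hlt : s'.natReg 18 < K
    · by_cases he : s.realArr 4 (s'.natReg 18) = s.realReg 7
      · exact .inl ⟨by simp [a4, r7, he], by omega, hne, fun _ => he⟩
      · refine .inr ⟨?_, j - 1, by omega, .flat rfl (by decide) ⟨?_, ?_⟩⟩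
        · simp only [BExp.Holds, NExp.eval, RExp.eval, a4, r7, r2]
          exact ⟨by omega, fun h => he (le_antisymm h.1 h.2)⟩
        · simp [Cmd.run]; omega
        · intro k hk
          simp only [Cmd.run, State.natReg_setNat, NExp.eval, if_true] at hk
          rcases Nat.lt_succ_iff_lt_or_eq.1 hk with h | rfl
          · exact hne k h
          · exact he
    · exact .inl ⟨by simp [r2]; omega, by omega, hne, fun h => absurd h hlt⟩
  · simp [BExp.cost, NExp.cost, RExp.cost]

/-- Register the length in real register `7` if it is new. -/
def newLen : Cmd :=
  .branch (.natLe (.reg 2) (.reg 18))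
    (.seq (block [.writeReal 4 (.reg 2) (.reg 7), .writeNat 0 (.reg 2) (.reg 4),
      .setNat 2 (.add (.reg 2) (.const 1))]) mulWeight) .skip

def lenStep : Cmd :=
  .seq (.seq (.setReal 7 (.sub (.read 3 (.reg 8)) (.read 2 (.reg 8))))
      (.setReal 5 (.add (.reg 5) (.reg 7))))
    (.seq findLen (.seq newLen (.writeNat 2 (.reg 8) (.read 0 (.reg 18)))))

/-- Find the distinct lengths and give them the weights `1, τ + 1, (τ + 1) ^ 2, …`. -/
def findLens : Cmd :=
  .seq (.setNat 4 (.const 1)) (.seq (forLoop 8 0 lenStep)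
    (forLoop 18 2 (.seq (.writeNat 1 (.reg 18) (.reg 4)) mulWeight)))

/-- `lenT 0, …, lenT (K - 1)` are the distinct ones among the first `n` values of `len`, and `tw i` is
the weight of `len i`. -/
structure LenTable (n τ : ℕ) (len : ℕ → ℝ) (K : ℕ) (lenT : ℕ → ℝ) (pw tw : ℕ → ℕ) : Prop where
  inj : ∀ k < K, ∀ k' < K, lenT k = lenT k' → k = k'
  src : ∀ k < K, ∃ i < n, lenT k = len i
  weight : ∀ i < n, ∃ k < K, lenT k = len i ∧ tw i = (τ + 1) ^ k
  pow : ∀ k < K, pw k = (τ + 1) ^ k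

/-- Bounds the search time by the number of distinct lengths at every stage, when only the first `n`
of `N` intervals have been inspected. -/
theorem LenTable.le_card {n τ : ℕ} {len : ℕ → ℝ} {K : ℕ} {lenT : ℕ → ℝ} {pw tw : ℕ → ℕ}
    (h : LenTable n τ len K lenT pw tw) {N : ℕ} (hN : n ≤ N) :
    K ≤ ((Finset.range N).image len).card := by
  have : ((Finset.range K).image lenT).card = K := by
    rw [Finset.card_image_of_injOn, Finset.card_range]
    intro k hk k' hk' he
    exact h.inj k (by simpa using hk) k' (by simpa using hk') he
  rw [← this]
  refine Finset.card_le_card fun x hx => ?_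
  obtain ⟨k, hk, rfl⟩ := Finset.mem_image.1 hx
  obtain ⟨i, hi, he⟩ := h.src k (Finset.mem_range.1 hk)
  exact Finset.mem_image.2 ⟨i, Finset.mem_range.2 (by omega), he.symm⟩

theorem runs_lenStep {s : State} {i τ : ℕ} {len : ℕ → ℝ} {κ : ℕ}
    (hτ : s.natReg 1 = τ) (h8 : s.natReg 8 = i) (hlen : len i = s.realArr 3 i - s.realArr 2 i)
    (ht : LenTable i τ len (s.natReg 2) (s.realArr 4) (s.natArr 0) (s.natArr 2))
    (h4 : s.natReg 4 = (τ + 1) ^ s.natReg 2) (hκ : s.natReg 2 ≤ κ) :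
    Runs lenStep s (100 * (κ + τ + 1)) (fun s' =>
      LenTable (i + 1) τ len (s'.natReg 2) (s'.realArr 4) (s'.natArr 0) (s'.natArr 2) ∧
      s'.natReg 4 = (τ + 1) ^ s'.natReg 2 ∧ s'.realReg 5 = s.realReg 5 + len i) := by
  have h1 : Runs (.seq (.setReal 7 (.sub (.read 3 (.reg 8)) (.read 2 (.reg 8))))
      (.setReal 5 (.add (.reg 5) (.reg 7)))) s 12 (fun s' =>
        s'.realReg 7 = len i ∧ s'.realReg 5 = s.realReg 5 + len i) :=
    .flat rfl (by decide) (by simp [Cmd.run, hlen, h8])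
  refine (h1.seq (T₂ := 25 * (κ + 1) + ((20 * (τ + 1) + 20) + 8)) ?_).mono
    (by omega) fun _ _ h => h
  rintro s₁ hf₁ ⟨hr7, hr5⟩
  refine Runs.seq ((runs_findLen (hf₁.natReg 2 (by decide))).mono (by omega) fun _ _ h => h) ?_
  rintro s₂ hf₂ ⟨f1, f2, f3⟩
  have K₂ : s₂.natReg 2 = s.natReg 2 := by
    rw [hf₂.natReg 2 (by decide), hf₁.natReg 2 (by decide)]
  have a4₁ : s₁.realArr 4 = s.realArr 4 := hf₁.realArr 4 (by decide)
  have a4₂ : s₂.realArr 4 = s.realArr 4 := by rw [hf₂.realArr 4 (by decide), a4₁]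
  have a0₂ : s₂.natArr 0 = s.natArr 0 := by
    rw [hf₂.natArr 0 (by decide), hf₁.natArr 0 (by decide)]
  have a2₂ : s₂.natArr 2 = s.natArr 2 := by
    rw [hf₂.natArr 2 (by decide), hf₁.natArr 2 (by decide)]
  have r7₂ : s₂.realReg 7 = len i := by rw [hf₂.realReg 7 (by decide), hr7]
  have r5₂ : s₂.realReg 5 = s.realReg 5 + len i := by rw [hf₂.realReg 5 (by decide), hr5]
  have h4₂ : s₂.natReg 4 = (τ + 1) ^ s.natReg 2 := by
    rw [hf₂.natReg 4 (by decide), hf₁.natReg 4 (by decide), h4]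
  have hτ₂ : s₂.natReg 1 = τ := by
    rw [hf₂.natReg 1 (by decide), hf₁.natReg 1 (by decide), hτ]
  have h8₂ : s₂.natReg 8 = i := by
    rw [hf₂.natReg 8 (by decide), hf₁.natReg 8 (by decide), h8]
  set K := s.natReg 2
  set k := s₂.natReg 18 with hk
  rw [a4₁, hr7] at f2 f3
  -- The weight of interval `i` is written only in the last command; the intermediate assertion
  -- already describes the array after that write.
  refine Runs.seq (T₁ := 20 * (τ + 1) + 20) (T₂ := 8)
    (Q₁ := fun s' => k < s'.natReg 2 ∧ LenTable (i + 1) τ len (s'.natReg 2) (s'.realArr 4)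
      (s'.natArr 0) (Function.update (s.natArr 2) i ((τ + 1) ^ k)) ∧
      s'.natReg 4 = (τ + 1) ^ s'.natReg 2) ?_ ?_
  · refine (Runs.branch (T := 20 * (τ + 1) + 14) (fun hb => ?_) fun hb => ?_).mono
      (by simp [BExp.cost, NExp.cost]; omega) fun _ _ h => h
    · have hkK : k = K := by simp only [BExp.Holds, NExp.eval, K₂] at hb; omega
      have h2 : Runs (block [.writeReal 4 (.reg 2) (.reg 7), .writeNat 0 (.reg 2) (.reg 4),
          .setNat 2 (.add (.reg 2) (.const 1))]) s₂ 14 (fun s' => s'.natReg 2 = K + 1 ∧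
            s'.realArr 4 = Function.update (s.realArr 4) K (len i) ∧
            s'.natArr 0 = Function.update (s.natArr 0) K ((τ + 1) ^ K)) :=
        .flat rfl (by decide) (by simp [block, Cmd.run, K₂, r7₂, h4₂, a4₂, a0₂])
      refine (h2.seq (T₂ := 20 * (τ + 1)) ?_).mono (by omega) fun _ _ h => h
      rintro s₃ hf₃ ⟨e1, e2, e3⟩
      refine (runs_mulWeight (by rw [hf₃.natReg 1 (by decide), hτ₂])).mono le_rfl ?_
      intro s₄ hf₄ hmul
      have K₄ : s₄.natReg 2 = K + 1 := by rw [hf₄.natReg 2 (by decide), e1]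
      have a4₄ : s₄.realArr 4 = Function.update (s.realArr 4) K (len i) := by
        rw [hf₄.realArr 4 (by decide), e2]
      have a0₄ : s₄.natArr 0 = Function.update (s.natArr 0) K ((τ + 1) ^ K) := by
        rw [hf₄.natArr 0 (by decide), e3]
      rw [hf₃.natReg 4 (by decide), h4₂] at hmul
      refine ⟨by omega, ?_, by rw [hmul, K₄, pow_succ']⟩
      rw [K₄, a4₄, a0₄, hkK]
      rw [hkK] at f2
      refine ⟨fun a ha b hb he => ?_, fun a ha => ?_, fun j hj => ?_, fun a ha => ?_⟩
      · rcases Nat.lt_succ_iff_lt_or_eq.1 ha with ha | rfl <;>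
          rcases Nat.lt_succ_iff_lt_or_eq.1 hb with hb | rfl
        · rw [Function.update_of_ne (by omega), Function.update_of_ne (by omega)] at he
          exact ht.inj a ha b hb he
        · rw [Function.update_of_ne (by omega), Function.update_self] at he
          exact absurd he (f2 a ha)
        · rw [Function.update_self, Function.update_of_ne (by omega)] at he
          exact absurd he.symm (f2 b hb)
        · rfl
      · rcases Nat.lt_succ_iff_lt_or_eq.1 ha with ha | rfl
        · rw [Function.update_of_ne (by omega)]
          obtain ⟨j, hj, he⟩ := ht.src a ha
          exact ⟨j, by omega, he⟩
        · exact ⟨i, by omega, Function.update_self ..⟩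
      · rcases Nat.lt_succ_iff_lt_or_eq.1 hj with hj | rfl
        · obtain ⟨a, ha, he, hw⟩ := ht.weight j hj
          refine ⟨a, by omega, ?_, ?_⟩
          · rwa [Function.update_of_ne (by omega)]
          · rwa [Function.update_of_ne (by omega)]
        · exact ⟨K, by omega, Function.update_self .., Function.update_self ..⟩
      · rcases Nat.lt_succ_iff_lt_or_eq.1 ha with ha | rfl
        · rw [Function.update_of_ne (by omega)]
          exact ht.pow a ha
        · exact Function.update_self ..
    · have hkK : k < K := by simp only [BExp.Holds, NExp.eval, K₂] at hb; omega
      refine .flat rfl (by simp [Cmd.flatCost]) ?_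
      simp only [Cmd.run, K₂, a4₂, a0₂]
      refine ⟨hkK, ⟨ht.inj, fun a ha => ?_, fun j hj => ?_, ht.pow⟩, h4₂⟩
      · obtain ⟨j, hj, he⟩ := ht.src a ha
        exact ⟨j, by omega, he⟩
      · rcases Nat.lt_succ_iff_lt_or_eq.1 hj with hj | rfl
        · obtain ⟨a, ha, he, hw⟩ := ht.weight j hj
          exact ⟨a, ha, he, by rwa [Function.update_of_ne (by omega)]⟩
        · exact ⟨k, hkK, f3 hkK, Function.update_self ..⟩
  · rintro s₃ hf₃ ⟨g1, g2, g3⟩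
    refine .flat rfl (by decide) ?_
    have r18 : s₃.natReg 18 = k := hf₃.natReg 18 (by decide)
    have r8 : s₃.natReg 8 = i := by rw [hf₃.natReg 8 (by decide), h8₂]
    have a2 : s₃.natArr 2 = s.natArr 2 := by rw [hf₃.natArr 2 (by decide), a2₂]
    have r5 : s₃.realReg 5 = s.realReg 5 + len i := by rw [hf₃.realReg 5 (by decide), r5₂]
    simpa [Cmd.run, r18, r8, a2, r5, g2.pow k g1, g3] using g2

/-- The second loop keeps multiplying register 4, which yields the weights `(τ + 1) ^ (K + k)` of
the second component of a state. Its final value `(τ + 1) ^ (K + K)` exceeds all offsets and serves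
as the size of a layer of the table. -/
theorem runs_findLens {s : State} {n τ : ℕ} {len : ℕ → ℝ} {κ : ℕ} (hn : s.natReg 0 = n)
    (hτ : s.natReg 1 = τ) (h2 : s.natReg 2 = 0) (h5 : s.realReg 5 = 0)
    (hlen : ∀ i < n, len i = s.realArr 3 i - s.realArr 2 i)
    (hκ : κ = ((Finset.range n).image len).card) (h0 : 0 < n) :
    Runs findLens s (200 * (n * ((κ + 1) * (τ + 1)))) (fun s' => s'.natReg 2 ≤ κ ∧
      LenTable n τ len (s'.natReg 2) (s'.realArr 4) (s'.natArr 0) (s'.natArr 2) ∧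
      (∀ k < s'.natReg 2, s'.natArr 1 k = (τ + 1) ^ (s'.natReg 2 + k)) ∧
      s'.natReg 4 = (τ + 1) ^ (s'.natReg 2 + s'.natReg 2) ∧
      s'.realReg 5 = ∑ i ∈ Finset.range n, len i) := by
  have hκn : κ ≤ n := by
    rw [hκ]; exact Finset.card_image_le.trans (by simp)
  have h1 : Runs (.setNat 4 (.const 1)) s 2 (fun s' => s' = s.setNat 4 1) :=
    .flat rfl (by decide) rfl
  refine (h1.seq (T₂ := (n * (100 * (κ + τ + 1) + 10) + 8) +
    (κ * ((20 * (τ + 1) + 4) + 10) + 8)) ?_).mono ?_ fun _ _ h => h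
  · rintro s₁ - rfl
    refine Runs.seq (Runs.forLoop (N := n) (by simpa using hn) (by decide) (by decide) (by decide)
      (fun i s' => LenTable i τ len (s'.natReg 2) (s'.realArr 4) (s'.natArr 0) (s'.natArr 2) ∧
        s'.natReg 4 = (τ + 1) ^ s'.natReg 2 ∧
        s'.realReg 5 = ∑ j ∈ Finset.range i, len j) _ (fun k s v h => by simpa using h)
      ?_ ?_) ?_
    · refine ⟨⟨?_, ?_, ?_, ?_⟩, ?_, ?_⟩ <;> simp [h2, h5]
    · rintro i s' hi hf h8 ⟨g1, g2, g3⟩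
      refine (runs_lenStep (len := len) (κ := κ) (τ := τ) (i := i) ?_ h8 ?_ g1 g2 ?_).mono le_rfl ?_
      · rw [hf.natReg 1 (by decide)]; simpa using hτ
      · rw [hf.realArr 3 (by decide), hf.realArr 2 (by decide)]; exact hlen i hi
      · rw [hκ]; exact g1.le_card hi.le
      · rintro s'' - ⟨k1, k2, k3⟩
        exact ⟨k1, k2, by rw [k3, g3, Finset.sum_range_succ]⟩
    · rintro s₂ hf₂ ⟨⟨g1, g2, g3⟩, -⟩
      have hKκ : s₂.natReg 2 ≤ κ := by rw [hκ]; exact g1.le_card le_rfl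
      have hτ₂ : s₂.natReg 1 = τ := by rw [hf₂.natReg 1 (by decide)]; simpa using hτ
      refine (Runs.forLoop (N := s₂.natReg 2) (s₀ := s₂) rfl (by decide) (by decide) (by decide)
        (fun k s' => (∀ j < k, s'.natArr 1 j = (τ + 1) ^ (s₂.natReg 2 + j)) ∧
          s'.natReg 4 = (τ + 1) ^ (s₂.natReg 2 + k)) (20 * (τ + 1) + 4)
        (fun k s v h => by simpa using h) ⟨by simp, by simpa using g2⟩ ?_).mono ?_ ?_
      · rintro k s' hk hf h18 ⟨f1, f2⟩
        have hw : Runs (.writeNat 1 (.reg 18) (.reg 4)) s' 4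
            (fun t => t = s'.writeNat 1 k ((τ + 1) ^ (s₂.natReg 2 + k))) :=
          .flat rfl (by decide) (by simp [Cmd.run, h18, f2])
        refine (hw.seq (T₂ := 20 * (τ + 1)) ?_).mono (by omega) fun _ _ h => h
        rintro s₃ - rfl
        refine (runs_mulWeight (τ := τ) ?_).mono le_rfl ?_
        · rw [State.natReg_writeNat, hf.natReg 1 (by decide), hτ₂]
        · intro s₄ hf₄ hm
          rw [hf₄.natArr 1 (by decide)]
          refine ⟨fun j hj => ?_, ?_⟩
          · simp only [State.natArr_writeNat, if_true]
            rcases Nat.lt_succ_iff_lt_or_eq.1 hj with hj | rfl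
            · rw [Function.update_of_ne (by omega)]; exact f1 j hj
            · exact Function.update_self ..
          · rw [hm, State.natReg_writeNat, f2, ← add_assoc, pow_succ']
      · gcongr
      · rintro s₃ hf₃ ⟨⟨f1, f2⟩, -⟩
        rw [hf₃.natReg 2 (by decide), hf₃.realArr 4 (by decide), hf₃.natArr 0 (by decide),
          hf₃.natArr 2 (by decide), hf₃.realReg 5 (by decide)]
        exact ⟨hKκ, g1, f1, f2, g3⟩
  · have e1 : κ * (20 * (τ + 1) + 4 + 10) ≤ n * (20 * (τ + 1) + 4 + 10) := by gcongr
    have e2 : n * (κ + τ + 1) ≤ n * ((κ + 1) * (τ + 1)) := by gcongr; nlinarith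
    have e3 : n * (τ + 1) ≤ n * ((κ + 1) * (τ + 1)) := by gcongr; nlinarith
    have e4 : n ≤ n * ((κ + 1) * (τ + 1)) := Nat.le_mul_of_pos_right _ (by positivity)
    have e5 : n * (100 * (κ + τ + 1) + 10) = 100 * (n * (κ + τ + 1)) + 10 * n := by ring
    have e6 : n * (20 * (τ + 1) + 4 + 10) = 20 * (n * (τ + 1)) + 14 * n := by ring
    omega

end RealRAM

namespace RealRAM

/-! ### Codes of multisets of lengths -/

theorem sum_digits_lt {R : ℕ} (d : ℕ → ℕ) (hd : ∀ k, d k < R) (K : ℕ) :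
    ∑ k ∈ Finset.range K, d k * R ^ k < R ^ K := by
  induction K with
  | zero => simp
  | succ K ih =>
    rw [Finset.sum_range_succ, pow_succ']
    have := Nat.mul_le_mul_right (R ^ K) (Nat.succ_le_of_lt (hd K))
    rw [Nat.succ_mul] at this
    omega

/-- Division by `R ^ K` isolates the leading digit because the lower digits sum to less than `R ^
K`. -/
theorem digits_inj {R : ℕ} (d d' : ℕ → ℕ) (hd : ∀ k, d k < R) (hd' : ∀ k, d' k < R) (K : ℕ)
    (h : ∑ k ∈ Finset.range K, d k * R ^ k = ∑ k ∈ Finset.range K, d' k * R ^ k) :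
    ∀ k < K, d k = d' k := by
  induction K with
  | zero => simp
  | succ K ih =>
    rw [Finset.sum_range_succ, Finset.sum_range_succ] at h
    have hR : 0 < R ^ K := pow_pos ((Nat.zero_le _).trans_lt (hd 0)) K
    have hdiv := congrArg (· / R ^ K) h
    simp only [Nat.add_mul_div_right _ _ hR, Nat.div_eq_of_lt (sum_digits_lt d hd K),
      Nat.div_eq_of_lt (sum_digits_lt d' hd' K), zero_add] at hdiv
    rw [hdiv] at h
    intro k hk
    rcases Nat.lt_succ_iff_lt_or_eq.1 hk with hk | rfl
    · exact ih (by omega) k hk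
    · exact hdiv

/-- The code of a multiset: every element `ℓ` contributes `R ^ ix ℓ`. -/
def codeOf (R : ℕ) (ix : ℝ → ℕ) (m : Multiset ℝ) : ℕ := (m.map fun ℓ => R ^ ix ℓ).sum

@[simp] theorem codeOf_zero (R : ℕ) (ix : ℝ → ℕ) : codeOf R ix 0 = 0 := by simp [codeOf]

theorem codeOf_add (R : ℕ) (ix : ℝ → ℕ) (m m' : Multiset ℝ) :
    codeOf R ix (m + m') = codeOf R ix m + codeOf R ix m' := by simp [codeOf]

theorem codeOf_cons (R : ℕ) (ix : ℝ → ℕ) (ℓ : ℝ) (m : Multiset ℝ) :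
    codeOf R ix (ℓ ::ₘ m) = codeOf R ix m + R ^ ix ℓ := by simp [codeOf, add_comm]

/-- The elements of `m` are among `lenT 0, …, lenT (K - 1)`. -/
def Within (K : ℕ) (lenT : ℕ → ℝ) (m : Multiset ℝ) : Prop := ∀ ℓ ∈ m, ∃ k < K, lenT k = ℓ

section Codes

variable {τ K : ℕ} {lenT : ℕ → ℝ} {ix : ℝ → ℕ}

theorem Within.ix_lt (hix : ∀ k < K, ix (lenT k) = k)
    {m : Multiset ℝ} (h : Within K lenT m) {ℓ : ℝ} (hℓ : ℓ ∈ m) :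
    ix ℓ < K ∧ lenT (ix ℓ) = ℓ := by
  obtain ⟨k, hk, rfl⟩ := h ℓ hℓ
  rw [hix k hk]
  exact ⟨hk, rfl⟩

/-- The base-`R` digits of a code are the multiplicities of the lengths; for this no bound on the
multiplicities is needed yet. -/
theorem Within.codeOf_eq (hix : ∀ k < K, ix (lenT k) = k)
    {m : Multiset ℝ} (h : Within K lenT m) (R : ℕ) :
    codeOf R ix m = ∑ k ∈ Finset.range K, (m.map ix).count k * R ^ k := by
  induction m using Multiset.induction_on with
  | empty => simp
  | cons ℓ m ih =>
    have hlt := (h.ix_lt hix (Multiset.mem_cons_self ℓ m)).1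
    rw [codeOf_cons, ih fun x hx => h x (Multiset.mem_cons_of_mem hx)]
    simp only [Multiset.map_cons, Multiset.count_cons, add_mul, Finset.sum_add_distrib]
    congr 1
    simp [ite_mul, hlt]

theorem Within.codeOf_lt (hix : ∀ k < K, ix (lenT k) = k)
    {m : Multiset ℝ} (h : Within K lenT m) (hc : Multiset.card m ≤ τ) :
    codeOf (τ + 1) ix m < (τ + 1) ^ K := by
  rw [h.codeOf_eq hix]
  refine sum_digits_lt _ (fun k => ?_) K
  have := Multiset.count_le_card k (m.map ix)
  rw [Multiset.card_map] at this
  omega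

theorem Within.map_map (hix : ∀ k < K, ix (lenT k) = k)
    {m : Multiset ℝ} (h : Within K lenT m) : (m.map ix).map lenT = m := by
  rw [Multiset.map_map]
  conv_rhs => rw [← Multiset.map_id m]
  exact Multiset.map_congr rfl fun ℓ hℓ => (h.ix_lt hix hℓ).2

/-- Multiplicities are at most `τ`, hence proper digits in base `τ + 1`, and they determine the
multiset. -/
theorem Within.codeOf_inj (hix : ∀ k < K, ix (lenT k) = k)
    {m m' : Multiset ℝ} (h : Within K lenT m) (h' : Within K lenT m')
    (hc : Multiset.card m ≤ τ) (hc' : Multiset.card m' ≤ τ)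
    (he : codeOf (τ + 1) ix m = codeOf (τ + 1) ix m') : m = m' := by
  rw [h.codeOf_eq hix, h'.codeOf_eq hix] at he
  have hcount : ∀ (m : Multiset ℝ), Multiset.card m ≤ τ → ∀ k, (m.map ix).count k < τ + 1 := by
    intro m hm k
    have := Multiset.count_le_card k (m.map ix)
    rw [Multiset.card_map] at this
    omega
  have key := digits_inj _ _ (hcount m hc) (hcount m' hc') K he
  rw [← h.map_map hix, ← h'.map_map hix]
  congr 1
  ext k
  by_cases hk : k < K
  · exact key k hk
  · have hz : ∀ m, Within K lenT m → (m.map ix).count k = 0 := by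
      intro m hm
      refine Multiset.count_eq_zero.2 fun hmem => ?_
      obtain ⟨ℓ, hℓ, rfl⟩ := Multiset.mem_map.1 hmem
      exact hk (hm.ix_lt hix hℓ).1
    rw [hz m h, hz m' h']

/-- There are at most `(K + τ).choose τ` multisets of at most `τ` elements of `K` sorts. -/
theorem card_multisets_le (hix : ∀ k < K, ix (lenT k) = k) {S : ℕ} {V : ℕ → Multiset ℝ}
    (hinj : ∀ p < S, ∀ p' < S, V p = V p' → p = p')
    (hw : ∀ p < S, Within K lenT (V p)) (hc : ∀ p < S, Multiset.card (V p) ≤ τ) :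
    S ≤ (K + τ).choose τ := by
  -- Padding with the extra symbol `Fin.last K` gives every multiset exactly `τ` elements. This
  -- embeds the list into `Sym (Fin (K + 1)) τ`, which has `(K + τ).choose τ` elements.
  let pad : Multiset ℝ → Multiset (Fin (K + 1)) := fun m =>
    m.map (fun ℓ => Fin.ofNat (K + 1) (ix ℓ)) + Multiset.replicate (τ - Multiset.card m) (Fin.last K)
  have hpad : ∀ m, Within K lenT m →
      ((pad m).filter (fun j => j.val < K)).map (fun j => lenT j.val) = m := by
    intro m hm
    have h1 : (m.map (fun ℓ => Fin.ofNat (K + 1) (ix ℓ))).filter (fun j => j.val < K) =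
        m.map (fun ℓ => Fin.ofNat (K + 1) (ix ℓ)) := by
      refine Multiset.filter_eq_self.2 fun j hj => ?_
      obtain ⟨ℓ, hℓ, rfl⟩ := Multiset.mem_map.1 hj
      have := (hm.ix_lt hix hℓ).1
      simp only [Fin.val_ofNat]
      rwa [Nat.mod_eq_of_lt (by omega)]
    have h2 : (Multiset.replicate (τ - Multiset.card m) (Fin.last K)).filter
        (fun j => j.val < K) = 0 := by
      refine Multiset.filter_eq_nil.2 fun j hj => ?_
      rw [Multiset.eq_of_mem_replicate hj]
      simp
    rw [Multiset.filter_add, h1, h2, add_zero, Multiset.map_map]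
    conv_rhs => rw [← Multiset.map_id m]
    refine Multiset.map_congr rfl fun ℓ hℓ => ?_
    obtain ⟨h3, h4⟩ := hm.ix_lt hix hℓ
    simp only [Function.comp, Fin.val_ofNat, id]
    rw [Nat.mod_eq_of_lt (by omega), h4]
  let g : Fin S → Sym (Fin (K + 1)) τ := fun p => ⟨pad (V p), by
    have := hc p p.2
    simp [pad]; omega⟩
  have hg : Function.Injective g := by
    intro p p' he
    have he' : pad (V p) = pad (V p') := congrArg Subtype.val he
    refine Fin.ext (hinj p p.2 p' p'.2 ?_)
    rw [← hpad _ (hw p p.2), ← hpad _ (hw p' p'.2), he']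
  have := Fintype.card_le_of_injective g hg
  rw [Fintype.card_fin, Sym.card_sym_eq_choose, Fintype.card_fin] at this
  convert this using 2
  omega

end Codes

/-! ### Listing the multisets of lengths -/

/-- Append the multisets obtained by adding the length number `k` (register `18`). -/
def extendStep : Cmd :=
  block [.branch (.natLe (.add (.read 5 (.reg 9)) (.const 1)) (.reg 1))
    (block [.writeNat 3 (.reg 3) (.add (.read 3 (.reg 9)) (.read 0 (.reg 18))),
      .writeNat 4 (.reg 3) (.add (.read 4 (.reg 9)) (.read 1 (.reg 18))),
      .writeNat 5 (.reg 3) (.add (.read 5 (.reg 9)) (.const 1)),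
      .writeReal 5 (.reg 3) (.add (.read 5 (.reg 9)) (.read 4 (.reg 18))),
      .setNat 3 (.add (.reg 3) (.const 1))]) .skip,
    .setNat 9 (.add (.reg 9) (.const 1))]

def extendList : Cmd :=
  .seq (.setNat 9 (.const 0)) (.loop (.natLe (.add (.reg 9) (.const 1)) (.reg 3)) extendStep)

/-- List all multisets of at most `τ` lengths. -/
def listMultisets : Cmd := .seq (.setNat 3 (.const 1)) (forLoop 18 2 extendList)

/-- The first `S` table entries describe distinct multisets `V p` of at most `τ` of the lengths
`lenT 0, …, lenT (k - 1)`. -/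
structure Entries (τ K : ℕ) (lenT : ℕ → ℝ) (ix : ℝ → ℕ) (k : ℕ) (V : ℕ → Multiset ℝ) (S : ℕ)
    (code code' size : ℕ → ℕ) (tot : ℕ → ℝ) : Prop where
  inj : ∀ p < S, ∀ p' < S, V p = V p' → p = p'
  within : ∀ p < S, Within k lenT (V p)
  card_le : ∀ p < S, Multiset.card (V p) ≤ τ
  code : ∀ p < S, code p = codeOf (τ + 1) ix (V p)
  code' : ∀ p < S, code' p = (τ + 1) ^ K * codeOf (τ + 1) ix (V p)
  size : ∀ p < S, size p = Multiset.card (V p)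
  tot : ∀ p < S, tot p = (V p).sum

/-- Every multiset of at most `τ` of the lengths `lenT 0, …, lenT (k - 1)` is listed. -/
def Complete (τ : ℕ) (lenT : ℕ → ℝ) (k : ℕ) (V : ℕ → Multiset ℝ) (S : ℕ) : Prop :=
  ∀ m, Multiset.card m ≤ τ → Within k lenT m → ∃ p < S, V p = m

theorem Within.mono {k k' : ℕ} {lenT : ℕ → ℝ} {m : Multiset ℝ} (h : Within k lenT m)
    (hk : k ≤ k') : Within k' lenT m := fun ℓ hℓ => by
  obtain ⟨j, hj, he⟩ := h ℓ hℓ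
  exact ⟨j, by omega, he⟩

/-- Both codes, the size and the sum of the new multiset arise from the old ones by one addition
each, which is what the tabulated weights are for. -/
theorem Entries.push {τ K : ℕ} {lenT : ℕ → ℝ} {ix : ℝ → ℕ} {k : ℕ} {V : ℕ → Multiset ℝ} {S : ℕ}
    {code code' size : ℕ → ℕ} {tot : ℕ → ℝ}
    (h : Entries τ K lenT ix (k + 1) V S code code' size tot) {p : ℕ} (hp : p < S)
    (hix : ix (lenT k) = k) (hc : Multiset.card (V p) < τ)
    (hnew : ∀ p' < S, V p' ≠ lenT k ::ₘ V p) :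
    Entries τ K lenT ix (k + 1) (Function.update V S (lenT k ::ₘ V p)) (S + 1)
      (Function.update code S (code p + (τ + 1) ^ k))
      (Function.update code' S (code' p + (τ + 1) ^ (K + k)))
      (Function.update size S (size p + 1)) (Function.update tot S (tot p + lenT k)) := by
  have aux : ∀ (P : ℕ → Prop), (∀ q < S, P q) → P S → ∀ q < S + 1, P q := by
    intro P h1 h2 q hq
    rcases Nat.lt_succ_iff_lt_or_eq.1 hq with hq | rfl
    · exact h1 q hq
    · exact h2
  constructor
  · refine aux _ (fun q hq => aux _ (fun q' hq' => ?_) ?_) (aux _ (fun q' hq' => ?_) ?_)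
    · rw [Function.update_of_ne (by omega), Function.update_of_ne (by omega)]
      exact h.inj q hq q' hq'
    · rw [Function.update_of_ne (by omega), Function.update_self]
      exact fun he => absurd he (hnew q hq)
    · rw [Function.update_self, Function.update_of_ne (by omega)]
      exact fun he => absurd he.symm (hnew q' hq')
    · exact fun _ => rfl
  · refine aux _ (fun q hq => ?_) ?_
    · rw [Function.update_of_ne (by omega)]; exact h.within q hq
    · rw [Function.update_self]
      intro ℓ hℓ
      rcases Multiset.mem_cons.1 hℓ with rfl | hℓ
      · exact ⟨k, by omega, rfl⟩
      · exact h.within p hp ℓ hℓ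
  · refine aux _ (fun q hq => ?_) ?_
    · rw [Function.update_of_ne (by omega)]; exact h.card_le q hq
    · rw [Function.update_self, Multiset.card_cons]; omega
  · refine aux _ (fun q hq => ?_) ?_
    · rw [Function.update_of_ne (by omega), Function.update_of_ne (by omega)]; exact h.code q hq
    · rw [Function.update_self, Function.update_self, codeOf_cons, hix, h.code p hp]
  · refine aux _ (fun q hq => ?_) ?_
    · rw [Function.update_of_ne (by omega), Function.update_of_ne (by omega)]; exact h.code' q hq
    · rw [Function.update_self, Function.update_self, codeOf_cons, hix, h.code' p hp, mul_add,
        ← pow_add]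
  · refine aux _ (fun q hq => ?_) ?_
    · rw [Function.update_of_ne (by omega), Function.update_of_ne (by omega)]; exact h.size q hq
    · rw [Function.update_self, Function.update_self, Multiset.card_cons, h.size p hp]
  · refine aux _ (fun q hq => ?_) ?_
    · rw [Function.update_of_ne (by omega), Function.update_of_ne (by omega)]; exact h.tot q hq
    · rw [Function.update_self, Function.update_self, Multiset.sum_cons, h.tot p hp, add_comm]

/-- Closure under adding `lenT k` gives completeness for one more length. -/
theorem Complete.succ {τ : ℕ} {lenT : ℕ → ℝ} {k : ℕ} {V : ℕ → Multiset ℝ} {S : ℕ}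
    (h : Complete τ lenT k V S)
    (hcl : ∀ p < S, Multiset.card (V p) < τ → ∃ p' < S, V p' = lenT k ::ₘ V p) :
    Complete τ lenT (k + 1) V S := by
  intro m
  induction m using Multiset.strongInductionOn with
  | _ m ih =>
    intro hc hw
    by_cases hm : lenT k ∈ m
    · obtain ⟨t, rfl⟩ := Multiset.exists_cons_of_mem hm
      rw [Multiset.card_cons] at hc
      obtain ⟨p, hp, rfl⟩ := ih t (Multiset.lt_cons_self _ _) (by omega)
        fun ℓ hℓ => hw ℓ (Multiset.mem_cons_of_mem hℓ)
      exact hcl p hp (by omega)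
    · refine h m hc fun ℓ hℓ => ?_
      obtain ⟨j, hj, rfl⟩ := hw ℓ hℓ
      rcases Nat.lt_succ_iff_lt_or_eq.1 hj with hj | rfl
      · exact ⟨j, hj, rfl⟩
      · exact absurd hℓ hm

/-- The table of multisets in the memory of `s`. -/
def Listed (τ K : ℕ) (lenT : ℕ → ℝ) (ix : ℝ → ℕ) (k : ℕ) (V : ℕ → Multiset ℝ) (s : State) : Prop :=
  Entries τ K lenT ix k V (s.natReg 3) (s.natArr 3) (s.natArr 4) (s.natArr 5) (s.realArr 5)

/-- The scan runs over a list that grows while it is read: appended entries are visited in turn, so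
all multiplicities of `lenT k` arise. Every entry either avoids `lenT k` or extends an entry scanned
earlier, which excludes repetitions; when the scan meets the end, the list is closed under adding
`lenT k`. -/
theorem runs_extendList {s : State} {τ K k N : ℕ} {lenT : ℕ → ℝ} {ix : ℝ → ℕ}
    {V : ℕ → Multiset ℝ} (hτ : s.natReg 1 = τ) (h18 : s.natReg 18 = k) (hk : k < K)
    (hix : ∀ k < K, ix (lenT k) = k) (hlT : s.realArr 4 = lenT)
    (hpw : s.natArr 0 k = (τ + 1) ^ k) (hpw' : s.natArr 1 k = (τ + 1) ^ (K + k))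
    (hN : (K + τ).choose τ ≤ N)
    (hE : Listed τ K lenT ix k V s) (hC : Complete τ lenT k V (s.natReg 3)) :
    Runs extendList s (60 * N + 8) (fun s' => ∃ V', Listed τ K lenT ix (k + 1) V' s' ∧
      Complete τ lenT (k + 1) V' (s'.natReg 3) ∧ s.natReg 3 ≤ s'.natReg 3) := by
  have h1 : Runs (.setNat 9 (.const 0)) s 2 (fun s' => s' = s.setNat 9 0) :=
    .flat rfl (by decide) rfl
  refine (h1.seq (T₂ := N * (54 + 5 + 1) + (5 + 1)) ?_).mono (by omega) fun _ _ h => h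
  rintro s₁ - rfl
  refine Runs.while (fun j s' => ∃ V', Listed τ K lenT ix (k + 1) V' s' ∧
      Complete τ lenT k V' (s'.natReg 3) ∧ s'.natReg 9 + j = N ∧ s'.natReg 9 ≤ s'.natReg 3 ∧
      s.natReg 3 ≤ s'.natReg 3 ∧
      (∀ p < s'.natReg 9, Multiset.card (V' p) < τ → ∃ p' < s'.natReg 3, V' p' = lenT k ::ₘ V' p) ∧
      (∀ p' < s'.natReg 3, Within k lenT (V' p') ∨ ∃ p < s'.natReg 9, V' p' = lenT k ::ₘ V' p)) 54 ?_
      (s₀ := s.setNat 9 0) (k := N) ?_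
  · rintro j s' hf ⟨V', g1, g2, g3, g4, g5, g6, g7⟩
    have r1 : s'.natReg 1 = τ := by rw [hf.natReg 1 (by decide)]; simpa using hτ
    have r18 : s'.natReg 18 = k := by rw [hf.natReg 18 (by decide)]; simpa using h18
    have a4 : s'.realArr 4 = lenT := by rw [hf.realArr 4 (by decide)]; exact hlT
    have a0 : s'.natArr 0 k = (τ + 1) ^ k := by rw [hf.natArr 0 (by decide)]; exact hpw
    have a1 : s'.natArr 1 k = (τ + 1) ^ (K + k) := by rw [hf.natArr 1 (by decide)]; exact hpw'
    -- Termination: the list stays repetition-free, so the number of multisets bounds its length and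
    -- the number of rounds.
    have hSN : s'.natReg 3 ≤ N :=
      (card_multisets_le hix g1.inj (fun p hp => (g1.within p hp).mono hk) g1.card_le).trans hN
    set P := s'.natReg 9 with hP
    set S := s'.natReg 3 with hS
    by_cases hlt : P < S
    · refine .inr ⟨by simp [← hP, ← hS]; omega, j - 1, by omega, .flat rfl (by decide) ?_⟩
      by_cases hc : Multiset.card (V' P) < τ
      · have hnew : ∀ p' < S, V' p' ≠ lenT k ::ₘ V' P := by
          intro p' hp' he
          rcases g7 p' hp' with hw | ⟨p, hp, he'⟩
          · obtain ⟨i, hi, hi'⟩ := hw (lenT k) (by rw [he]; exact Multiset.mem_cons_self _ _)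
            have := hix i (by omega)
            rw [hi', hix k hk] at this
            omega
          · rw [he', Multiset.cons_inj_right] at he
            have := g1.inj p (by omega) P hlt he
            omega
        have hpush := Entries.push g1 hlt (hix k hk) hc hnew
        refine ⟨Function.update V' S (lenT k ::ₘ V' P), ?_⟩
        have hcond : s'.natArr 5 P + 1 ≤ τ := by rw [g1.size P hlt]; omega
        have hrun : extendStep.run s' = (((((s'.writeNat 3 S (s'.natArr 3 P + (τ + 1) ^ k)).writeNat 4 S
            (s'.natArr 4 P + (τ + 1) ^ (K + k))).writeNat 5 S (s'.natArr 5 P + 1)).writeReal 5 S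
            (s'.realArr 5 P + lenT k)).setNat 3 (S + 1)).setNat 9 (P + 1) := by
          simp [extendStep, block, Cmd.run, r1, r18, a4, a0, a1, ← hP, ← hS, hcond]
        rw [hrun]
        simp only [State.natReg_setNat, if_true, Listed, State.natReg_writeReal,
          State.natReg_writeNat, State.natArr_setNat, State.natArr_writeReal,
          State.natArr_writeNat, State.realArr_setNat, State.realArr_writeReal,
          State.realArr_writeNat, show (3 : ℕ) ≠ 9 by decide, show (3 : ℕ) ≠ 4 by decide,
          show (3 : ℕ) ≠ 5 by decide, show (4 : ℕ) ≠ 5 by decide, show (5 : ℕ) ≠ 4 by decide,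
          show (4 : ℕ) ≠ 3 by decide, show (5 : ℕ) ≠ 3 by decide, if_false]
        refine ⟨hpush, fun m hm hm' => ?_, by omega, by omega, by omega, fun p hp hp' => ?_,
          fun p' hp' => ?_⟩
        · obtain ⟨p, hp, he⟩ := g2 m hm hm'
          exact ⟨p, by omega, by rwa [Function.update_of_ne (by omega)]⟩
        · rw [Function.update_of_ne (by omega)] at hp' ⊢
          rcases Nat.lt_succ_iff_lt_or_eq.1 hp with hp | rfl
          · obtain ⟨p', h1, h2⟩ := g6 p hp hp'
            exact ⟨p', by omega, by rwa [Function.update_of_ne (by omega)]⟩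
          · exact ⟨S, by omega, Function.update_self ..⟩
        · rcases Nat.lt_succ_iff_lt_or_eq.1 hp' with hp' | rfl
          · rw [Function.update_of_ne (by omega)]
            rcases g7 p' hp' with hw | ⟨p, hp, he'⟩
            · exact .inl hw
            · exact .inr ⟨p, by omega, by rwa [Function.update_of_ne (by omega)]⟩
          · refine .inr ⟨P, by omega, ?_⟩
            rw [Function.update_self, Function.update_of_ne (by omega)]
      · have hcond : ¬ s'.natArr 5 P + 1 ≤ τ := by rw [g1.size P hlt]; omega
        have hrun : extendStep.run s' = s'.setNat 9 (P + 1) := by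
          simp only [extendStep, block, Cmd.run, BExp.Holds, NExp.eval, r1, ← hP]
          rw [if_neg hcond]
        rw [hrun]
        refine ⟨V', by simpa [Listed] using g1, ?_⟩
        simp only [State.natReg_setNat, if_true, show (3 : ℕ) ≠ 9 by decide, if_false, ← hS]
        refine ⟨g2, by omega, by omega, g5, fun p hp hp' => ?_, fun p' hp' => ?_⟩
        · rcases Nat.lt_succ_iff_lt_or_eq.1 hp with hp | rfl
          · exact g6 p hp hp'
          · exact absurd hp' hc
        · rcases g7 p' hp' with hw | ⟨p, hp, he'⟩
          · exact .inl hw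
          · exact .inr ⟨p, by omega, he'⟩
    · refine .inl ⟨by simp [← hP, ← hS]; omega, V', g1, Complete.succ g2 ?_, g5⟩
      obtain hPS : P = S := by omega
      rw [hPS] at g6
      exact g6
  · refine ⟨V, ?_, ?_, by simp, by simp, by simp, by simp, ?_⟩
    · have : Entries τ K lenT ix (k + 1) V (s.natReg 3) (s.natArr 3) (s.natArr 4) (s.natArr 5)
          (s.realArr 5) :=
        ⟨hE.inj, fun p hp => (hE.within p hp).mono (by omega), hE.card_le, hE.code, hE.code',
          hE.size, hE.tot⟩
      simpa [Listed] using this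
    · simpa using hC
    · intro p' hp'
      exact .inl (hE.within p' (by simpa using hp'))

theorem runs_listMultisets {s : State} {τ K N : ℕ} {ix : ℝ → ℕ} (hτ : s.natReg 1 = τ)
    (hK : s.natReg 2 = K) (hix : ∀ k < K, ix (s.realArr 4 k) = k)
    (hpw : ∀ k < K, s.natArr 0 k = (τ + 1) ^ k)
    (hpw' : ∀ k < K, s.natArr 1 k = (τ + 1) ^ (K + k))
    (h3 : s.natArr 3 0 = 0) (h4 : s.natArr 4 0 = 0) (h5 : s.natArr 5 0 = 0)
    (h5' : s.realArr 5 0 = 0) (hN : (K + τ).choose τ ≤ N) :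
    Runs listMultisets s (100 * ((K + 1) * N)) (fun s' => ∃ V,
      Listed τ K (s.realArr 4) ix K V s' ∧ Complete τ (s.realArr 4) K V (s'.natReg 3) ∧
      s'.natReg 3 ≤ N) := by
  have hN1 : 1 ≤ N := (Nat.choose_pos (by omega)).trans_le hN
  have h1 : Runs (.setNat 3 (.const 1)) s 2 (fun s' => s' = s.setNat 3 1) :=
    .flat rfl (by decide) rfl
  refine (h1.seq (T₂ := K * (60 * N + 8 + 10) + 8) ?_).mono (by nlinarith) fun _ _ h => h
  rintro s₁ - rfl
  refine (Runs.forLoop (N := K) (s₀ := s.setNat 3 1) (by simpa using hK) (by decide) (by decide)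
    (by decide) (fun k s' => ∃ V, Listed τ K (s.realArr 4) ix k V s' ∧
      Complete τ (s.realArr 4) k V (s'.natReg 3)) _ (fun k s v h => by simpa [Listed] using h)
    ?_ ?_).mono le_rfl ?_
  · refine ⟨fun _ => 0, ?_, ?_⟩
    · simp only [Listed]
      constructor <;> simp [h3, h4, h5, h5', Within]
    · intro m hm hw
      refine ⟨0, by simp, ?_⟩
      symm
      refine Multiset.eq_zero_of_forall_notMem fun ℓ hℓ => ?_
      obtain ⟨j, hj, -⟩ := hw ℓ hℓ
      omega
  · rintro k s' hk hf h18 ⟨V, g1, g2⟩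
    refine (runs_extendList (N := N) ?_ h18 hk hix ?_ ?_ ?_ hN g1 g2).mono le_rfl ?_
    · rw [hf.natReg 1 (by decide)]; simpa using hτ
    · exact hf.realArr 4 (by decide)
    · rw [hf.natArr 0 (by decide)]; exact hpw k hk
    · rw [hf.natArr 1 (by decide)]; exact hpw' k hk
    · rintro s'' - ⟨V', k1, k2, -⟩
      exact ⟨V', k1, k2⟩
  · rintro s' - ⟨⟨V, g1, g2⟩, -⟩
    exact ⟨V, g1, g2, (card_multisets_le hix g1.inj g1.within g1.card_le).trans hN⟩

end RealRAM

namespace MovingIntervals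

/-! ### The dynamic program, abstractly

Intervals `i = 0, 1, …` with endpoints `A i`, `Y i` are processed in this order. A state consists of
the multiset `a` of the lengths of the moved intervals, the multiset `b` of the lengths of the moved
intervals that have found their place, and the frontier `q`. -/

/-- The elements of `m` are lengths of intervals. -/
def Adm (n : ℕ) (A Y : ℕ → ℝ) (m : Multiset ℝ) : Prop := ∀ ℓ ∈ m, ∃ j < n, Y j - A j = ℓ

/-- The states that can be reached from frontier `z`. Before an interval is kept, skipped or moved, a
multiset `c` of moved intervals is placed at the frontier. -/
inductive Reach (n τ : ℕ) (mode : Bool) (A Y : ℕ → ℝ) (z : ℝ) :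
    ℕ → Multiset ℝ → Multiset ℝ → ℝ → Prop
  | start : Reach n τ mode A Y z 0 0 0 z
  | keep {i : ℕ} {a b c : Multiset ℝ} {q : ℝ} : Reach n τ mode A Y z i a b q → Adm n A Y c →
      Multiset.card b + Multiset.card c ≤ τ → q + c.sum ≤ A i →
      Reach n τ mode A Y z (i + 1) a (b + c) (Y i)
  | skip {i : ℕ} {a b c : Multiset ℝ} {q : ℝ} : Reach n τ mode A Y z i a b q → Adm n A Y c →
      Multiset.card b + Multiset.card c ≤ τ → mode = true →
      Reach n τ mode A Y z (i + 1) a (b + c) (q + c.sum)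
  | move {i : ℕ} {a b c : Multiset ℝ} {q : ℝ} : Reach n τ mode A Y z i a b q → Adm n A Y c →
      Multiset.card b + Multiset.card c ≤ τ → Multiset.card a + 1 ≤ τ →
      Reach n τ mode A Y z (i + 1) ((Y i - A i) ::ₘ a) (b + c) (q + c.sum)

/-- After the last interval the remaining moved intervals can be placed without exceeding `w`. -/
def Accept (n τ : ℕ) (mode : Bool) (A Y : ℕ → ℝ) (z w : ℝ) : Prop :=
  ∃ a b c q, Reach n τ mode A Y z n a b q ∧ Adm n A Y c ∧
    Multiset.card b + Multiset.card c ≤ τ ∧ a = b + c ∧ q + c.sum ≤ w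

theorem Adm.add {n : ℕ} {A Y : ℕ → ℝ} {m m' : Multiset ℝ} (h : Adm n A Y m) (h' : Adm n A Y m') :
    Adm n A Y (m + m') := fun ℓ hℓ => by
  rcases Multiset.mem_add.1 hℓ with hℓ | hℓ
  · exact h ℓ hℓ
  · exact h' ℓ hℓ

/-- Ensures that the components of every reachable state are among the listed multisets and are
determined by their codes. -/
theorem Reach.adm {n τ : ℕ} {mode : Bool} {A Y : ℕ → ℝ} {z : ℝ} {i : ℕ} {a b : Multiset ℝ} {q : ℝ}
    (h : Reach n τ mode A Y z i a b q) (hi : i ≤ n) :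
    (Adm n A Y a ∧ Multiset.card a ≤ τ) ∧ Adm n A Y b ∧ Multiset.card b ≤ τ := by
  induction h with
  | start => simp [Adm]
  | keep _ hc hle _ ih =>
    obtain ⟨h1, h2, h3⟩ := ih (by omega)
    exact ⟨h1, h2.add hc, by rwa [Multiset.card_add]⟩
  | skip _ hc hle _ ih =>
    obtain ⟨h1, h2, h3⟩ := ih (by omega)
    exact ⟨h1, h2.add hc, by rwa [Multiset.card_add]⟩
  | @move i a b c q _ hc hle hle' ih =>
    obtain ⟨h1, h2, h3⟩ := ih (by omega)
    refine ⟨⟨fun ℓ hℓ => ?_, by rwa [Multiset.card_cons]⟩, h2.add hc, by rwa [Multiset.card_add]⟩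
    rcases Multiset.mem_cons.1 hℓ with rfl | hℓ
    · exact ⟨i, by omega, rfl⟩
    · exact h1.1 ℓ hℓ

end MovingIntervals

namespace RealRAM

open MovingIntervals

/-! ### Tables of minima -/

/-- Record the value `v` at address `t`, unless a smaller one has been recorded. -/
def push (t : NExp) (v : RExp) : Cmd :=
  .branch (.and (.natLe (.const 1) (.read 6 t)) (.realLe (.read 6 t) v)) .skip
    (.seq (.writeReal 6 t v) (.writeNat 6 t (.const 1)))

/-- From address `lay` on, the table contains the minima of the recorded pairs `P`; below, it agrees
with the one of `s₀`. -/
structure Tab (lay : ℕ) (s₀ : State) (P : Set (ℕ × ℝ)) (s : State) : Prop where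
  old_def : ∀ x < lay, s.natArr 6 x = s₀.natArr 6 x
  old_val : ∀ x < lay, s.realArr 6 x = s₀.realArr 6 x
  sound : ∀ x, lay ≤ x → s.natArr 6 x ≠ 0 → (x, s.realArr 6 x) ∈ P
  complete : ∀ x v, (x, v) ∈ P → lay ≤ x ∧ s.natArr 6 x ≠ 0 ∧ s.realArr 6 x ≤ v

theorem Tab.of_eq {lay : ℕ} {s₀ s s' : State} {P P' : Set (ℕ × ℝ)} (h : Tab lay s₀ P s)
    (h₁ : s'.natArr 6 = s.natArr 6) (h₂ : s'.realArr 6 = s.realArr 6) (h₃ : P = P') :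
    Tab lay s₀ P' s' := by
  subst h₃
  exact ⟨by rw [h₁]; exact h.old_def, by rw [h₂]; exact h.old_val,
    by rw [h₁, h₂]; exact h.sound, by rw [h₁, h₂]; exact h.complete⟩

/-- The address is evaluated a second time after the real value has been written, so it must not
depend on that write (`htv`). -/
theorem Tab.push {lay : ℕ} {s₀ s : State} {P : Set (ℕ × ℝ)} (h : Tab lay s₀ P s) (t : NExp)
    (v : RExp) (ht : lay ≤ t.eval s) (htv : ∀ x, t.eval (s.writeReal 6 x (v.eval s)) = t.eval s) :
    Tab lay s₀ (P ∪ {(t.eval s, v.eval s)}) ((push t v).run s) := by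
  simp only [RealRAM.push, Cmd.run]
  split_ifs with hc
  · simp only [BExp.Holds, NExp.eval, RExp.eval] at hc
    refine ⟨h.old_def, h.old_val, fun x hx hd => .inl (h.sound x hx hd), ?_⟩
    rintro x w (hx | hx)
    · exact h.complete x w hx
    · rw [Set.mem_singleton_iff, Prod.mk.injEq] at hx
      obtain ⟨rfl, rfl⟩ := hx
      exact ⟨ht, by omega, hc.2⟩
  · simp only [BExp.Holds, NExp.eval, RExp.eval] at hc
    have e1 : (((s.writeReal 6 (t.eval s) (v.eval s)).writeNat 6
        (t.eval (s.writeReal 6 (t.eval s) (v.eval s)))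
        ((NExp.const 1).eval (s.writeReal 6 (t.eval s) (v.eval s)))).natArr 6) =
          Function.update (s.natArr 6) (t.eval s) 1 := by
      simp [htv]
    have e2 : (((s.writeReal 6 (t.eval s) (v.eval s)).writeNat 6
        (t.eval (s.writeReal 6 (t.eval s) (v.eval s)))
        ((NExp.const 1).eval (s.writeReal 6 (t.eval s) (v.eval s)))).realArr 6) =
          Function.update (s.realArr 6) (t.eval s) (v.eval s) := by
      simp
    constructor
    · intro x hx
      rw [e1, Function.update_of_ne (by omega)]
      exact h.old_def x hx
    · intro x hx
      rw [e2, Function.update_of_ne (by omega)]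
      exact h.old_val x hx
    · intro x hx hd
      rw [e2]
      by_cases hxt : x = t.eval s
      · subst hxt
        rw [Function.update_self]
        exact .inr rfl
      · rw [e1, Function.update_of_ne hxt] at hd
        rw [Function.update_of_ne hxt]
        exact .inl (h.sound x hx hd)
    · intro x w hw
      rw [e1, e2]
      by_cases hxt : x = t.eval s
      · subst hxt
        rw [Function.update_self, Function.update_self]
        refine ⟨ht, one_ne_zero, ?_⟩
        rcases hw with hw | hw
        · obtain ⟨-, h1, h2⟩ := h.complete _ w hw
          by_contra hlt
          exact hc ⟨by omega, h2.trans (not_le.1 hlt).le⟩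
        · rw [Set.mem_singleton_iff, Prod.mk.injEq] at hw
          exact hw.2.ge
      · rw [Function.update_of_ne hxt, Function.update_of_ne hxt]
        rcases hw with hw | hw
        · exact h.complete x w hw
        · rw [Set.mem_singleton_iff, Prod.mk.injEq] at hw
          exact absurd hw.1 hxt

/-! ### Loops over the states -/

def innerLoop (body : Cmd) : Cmd :=
  forLoop 11 3 (.branch (.natLe (.add (.read 5 (.reg 10)) (.read 5 (.reg 11))) (.reg 1)) body .skip)

def middleBody (body : Cmd) : Cmd :=
  .seq (.setNat 12 (.add (.add (.reg 5) (.read 3 (.reg 9))) (.read 4 (.reg 10))))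
    (.branch (.natLe (.const 1) (.read 6 (.reg 12))) (innerLoop body) .skip)

/-- Run `body` for all states `(a, b)` in the current layer and all multisets `c` that can be
added to `b`. -/
def tripleLoop (body : Cmd) : Cmd := forLoop 9 3 (forLoop 10 3 (middleBody body))

/-- The address of the state `(a, b)` in the current layer. -/
def srcAddr (s : State) (a b : ℕ) : ℕ := s.natReg 5 + s.natArr 3 a + s.natArr 4 b

theorem Frame.forLoop_body {r m : ℕ} {body : Cmd} {s s' : State} (h : Frame body s s') :
    Frame (forLoop r m body) s s' :=
  Frame.seq_right (c₁ := .setNat r (.const 0))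
    (h := ((h.seq_left (c₂ := .setNat r (.add (.reg r) (.const 1)))).weaken
      (fun _ h => h) (fun _ h => h) (fun _ h => h) (fun _ h => h)))

theorem Frame.branch_left {b : BExp} {c₁ c₂ : Cmd} {s s' : State} (h : Frame c₁ s s') :
    Frame (.branch b c₁ c₂) s s' :=
  h.weaken (List.subset_append_left _ _) (List.subset_append_left _ _)
    (List.subset_append_left _ _) (List.subset_append_left _ _)

/-- The content of the table is described by the set of all pairs recorded, so a loop simply
contributes the union over its rounds. Rounds start from an arbitrary set `P'`, which lets nested
loops compose. -/
theorem runs_forTab {r m : ℕ} {body : Cmd} {s₀ s₁ : State} {N B lay : ℕ} {X : ℕ → Set (ℕ × ℝ)}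
    {P : Set (ℕ × ℝ)} (hm : s₁.natReg m = N) (hrm : r ≠ m) (hr : r ∉ body.natRegs)
    (hm' : m ∉ body.natRegs) (h₀ : Tab lay s₀ P s₁)
    (hstep : ∀ k < N, ∀ s P', Frame (forLoop r m body) s₁ s → s.natReg r = k → Tab lay s₀ P' s →
      Runs body s B (Tab lay s₀ (P' ∪ X k))) :
    Runs (forLoop r m body) s₁ (N * (B + 10) + 8) (Tab lay s₀ (P ∪ {x | ∃ k < N, x ∈ X k})) := by
  refine (Runs.forLoop hm hrm hr hm' (fun k s => Tab lay s₀ (P ∪ {x | ∃ j < k, x ∈ X j}) s) B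
    (fun k s v h => h.of_eq rfl rfl rfl) (h₀.of_eq rfl rfl (by simp)) ?_).mono le_rfl
    fun _ _ h => h.1
  intro k s hk hf hrk hI
  refine (hstep k hk s _ hf hrk hI).mono le_rfl fun s' _ h => h.of_eq rfl rfl ?_
  rw [Set.union_assoc]
  congr 1
  ext x
  simp only [Set.mem_union, Set.mem_ofPred_eq, Nat.exists_lt_succ_right]

theorem runs_innerLoop {body : Cmd} {s₀ s₁ : State} {S B lay : ℕ} {X : ℕ → Set (ℕ × ℝ)}
    {P : Set (ℕ × ℝ)} (hflat : body.flat = true) (hcost : body.flatCost ≤ B)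
    (hn : ∀ r, r ≠ 13 → r ∉ body.natRegs) (hna : ∀ r, r ≠ 6 → r ∉ body.natArrs)
    (hS : s₁.natReg 3 = S) (h₀ : Tab lay s₀ P s₁)
    (hstep : ∀ c < S, s₁.natArr 5 (s₁.natReg 10) + s₁.natArr 5 c ≤ s₁.natReg 1 →
      ∀ s P', Frame (innerLoop body) s₁ s → s.natReg 11 = c → Tab lay s₀ P' s →
      Tab lay s₀ (P' ∪ X c) (body.run s)) :
    Runs (innerLoop body) s₁ (S * (B + 9 + 10) + 8) (Tab lay s₀ (P ∪ {x | ∃ c < S,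
      s₁.natArr 5 (s₁.natReg 10) + s₁.natArr 5 c ≤ s₁.natReg 1 ∧ x ∈ X c})) := by
  refine runs_forTab (X := fun c => {x | s₁.natArr 5 (s₁.natReg 10) + s₁.natArr 5 c ≤ s₁.natReg 1 ∧
    x ∈ X c}) hS (by decide) (by simp [Cmd.natRegs, hn]) (by simp [Cmd.natRegs, hn]) h₀ ?_
  intro c hc s P' hf h11 hT
  have q10 : s.natReg 10 = s₁.natReg 10 := hf.natReg 10 (by simp [forLoop, Cmd.natRegs, hn])
  have q1 : s.natReg 1 = s₁.natReg 1 := hf.natReg 1 (by simp [forLoop, Cmd.natRegs, hn])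
  have q5 : s.natArr 5 = s₁.natArr 5 := hf.natArr 5 (by simp [forLoop, Cmd.natArrs, hna])
  refine (Runs.branch (T := B + 1) (fun hz => ?_) fun hz => ?_).mono
    (by simp [BExp.cost, NExp.cost]; omega) fun _ _ h => h
  · simp only [BExp.Holds, NExp.eval, q1, q5, q10, h11] at hz
    refine .flat hflat (by omega) ((hstep c hc hz s _ hf h11 hT).of_eq rfl rfl ?_)
    simp only [hz, true_and, Set.ofPred_mem_eq]
  · simp only [BExp.Holds, NExp.eval, q1, q5, q10, h11] at hz
    refine .flat rfl (by simp [Cmd.flatCost]) (hT.of_eq rfl rfl ?_)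
    simp only [hz, false_and, Set.ofPred_false, Set.union_empty]

theorem runs_middleBody {body : Cmd} {s₀ s₁ : State} {S B lay : ℕ} {X : ℕ → Set (ℕ × ℝ)}
    {P : Set (ℕ × ℝ)} (hflat : body.flat = true) (hcost : body.flatCost ≤ B)
    (hn : ∀ r, r ≠ 13 → r ∉ body.natRegs) (hna : ∀ r, r ≠ 6 → r ∉ body.natArrs)
    (hS : s₁.natReg 3 = S) (h₀ : Tab lay s₀ P s₁)
    (hstep : ∀ c < S, s₁.natArr 6 (srcAddr s₁ (s₁.natReg 9) (s₁.natReg 10)) ≠ 0 →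
      s₁.natArr 5 (s₁.natReg 10) + s₁.natArr 5 c ≤ s₁.natReg 1 →
      ∀ s P', Frame (middleBody body) s₁ s → s.natReg 9 = s₁.natReg 9 →
      s.natReg 10 = s₁.natReg 10 → s.natReg 11 = c →
      s.natReg 12 = srcAddr s₁ (s₁.natReg 9) (s₁.natReg 10) → Tab lay s₀ P' s →
      Tab lay s₀ (P' ∪ X c) (body.run s)) :
    Runs (middleBody body) s₁ (S * (B + 9 + 10) + 8 + 14) (Tab lay s₀ (P ∪ {x |
      s₁.natArr 6 (srcAddr s₁ (s₁.natReg 9) (s₁.natReg 10)) ≠ 0 ∧ ∃ c < S,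
      s₁.natArr 5 (s₁.natReg 10) + s₁.natArr 5 c ≤ s₁.natReg 1 ∧ x ∈ X c})) := by
  have hset : Runs (.setNat 12 (.add (.add (.reg 5) (.read 3 (.reg 9))) (.read 4 (.reg 10)))) s₁ 8
      (fun s => s = s₁.setNat 12 (srcAddr s₁ (s₁.natReg 9) (s₁.natReg 10))) :=
    .flat rfl (by decide) rfl
  refine (hset.seq (T₂ := (4 + 1) + (S * ((B + 9) + 10) + 8)) ?_).mono (by omega) fun _ _ h => h
  rintro s₂ hf₂ rfl
  refine Runs.branch (fun hc => ?_) (fun hc => ?_)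
  · have hne : s₁.natArr 6 (srcAddr s₁ (s₁.natReg 9) (s₁.natReg 10)) ≠ 0 := by
      simp only [BExp.Holds, NExp.eval, State.natReg_setNat, State.natArr_setNat, if_true] at hc
      omega
    refine (runs_innerLoop (X := X)
      (s₁ := s₁.setNat 12 (srcAddr s₁ (s₁.natReg 9) (s₁.natReg 10))) hflat hcost hn hna (by simpa using hS)
      (h₀.of_eq rfl rfl rfl) ?_).mono le_rfl fun s _ h => h.of_eq rfl rfl ?_
    · intro c hcS hz s P' hf h11 hT
      refine hstep c hcS hne (by simpa using hz) s P' ?_ ?_ ?_ h11 ?_ hT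
      · exact hf₂.seq_left.trans hf.branch_left.seq_right
      · rw [hf.natReg 9 (by simp [innerLoop, forLoop, Cmd.natRegs, hn])]; simp
      · rw [hf.natReg 10 (by simp [innerLoop, forLoop, Cmd.natRegs, hn])]; simp
      · rw [hf.natReg 12 (by simp [innerLoop, forLoop, Cmd.natRegs, hn])]; simp
    · congr 1
      ext x
      simp [hne]
  · have hne : s₁.natArr 6 (srcAddr s₁ (s₁.natReg 9) (s₁.natReg 10)) = 0 := by
      simp only [BExp.Holds, NExp.eval, State.natReg_setNat, State.natArr_setNat, if_true] at hc
      omega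
    refine .flat rfl (by simp only [Cmd.flatCost]; omega) (h₀.of_eq rfl rfl ?_)
    simp [hne]

/-- States are read below address `lay` and written from `lay` on, so the current layer is constant
during the three loops and the set of recorded pairs can be expressed by the initial state `s₀`. -/
theorem runs_tripleLoop {body : Cmd} {s₀ : State} {S B lay : ℕ} {X : ℕ → ℕ → ℕ → Set (ℕ × ℝ)}
    (hflat : body.flat = true) (hcost : body.flatCost ≤ B) (hn : ∀ r ∈ body.natRegs, r = 13)
    (hna : ∀ r ∈ body.natArrs, r = 6)
    (hS : s₀.natReg 3 = S) (hS1 : 1 ≤ S) (hsrc : ∀ a < S, ∀ b < S, srcAddr s₀ a b < lay)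
    (hfresh : ∀ x, lay ≤ x → s₀.natArr 6 x = 0)
    (hstep : ∀ a < S, ∀ b < S, ∀ c < S, s₀.natArr 6 (srcAddr s₀ a b) ≠ 0 →
      s₀.natArr 5 b + s₀.natArr 5 c ≤ s₀.natReg 1 → ∀ s P, Frame (tripleLoop body) s₀ s →
      s.natReg 9 = a → s.natReg 10 = b → s.natReg 11 = c → s.natReg 12 = srcAddr s₀ a b →
      s.realArr 6 (srcAddr s₀ a b) = s₀.realArr 6 (srcAddr s₀ a b) → Tab lay s₀ P s →
      Tab lay s₀ (P ∪ X a b c) (body.run s)) :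
    Runs (tripleLoop body) s₀ ((B + 80) * S ^ 3) (Tab lay s₀ {x | ∃ a < S, ∃ b < S,
      s₀.natArr 6 (srcAddr s₀ a b) ≠ 0 ∧ ∃ c < S,
        s₀.natArr 5 b + s₀.natArr 5 c ≤ s₀.natReg 1 ∧ x ∈ X a b c}) := by
  have hn' : ∀ r, r ≠ 13 → r ∉ body.natRegs := fun r h1 h2 => h1 (hn r h2)
  have hna' : ∀ r, r ≠ 6 → r ∉ body.natArrs := fun r h1 h2 => h1 (hna r h2)
  have hnr : ∀ r ∈ [1, 3, 5, 9], r ∉ (forLoop 10 3 (middleBody body)).natRegs := by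
    simp [forLoop, middleBody, innerLoop, Cmd.natRegs, hn']
  have hnm : ∀ r ∈ [3, 10], r ∉ (middleBody body).natRegs := by
    simp [forLoop, middleBody, innerLoop, Cmd.natRegs, hn']
  have hnt : ∀ r ∈ [1, 3, 5], r ∉ (tripleLoop body).natRegs := by
    simp [tripleLoop, forLoop, middleBody, innerLoop, Cmd.natRegs, hn']
  have hnt' : ∀ r ∈ [3, 4, 5], r ∉ (tripleLoop body).natArrs := by
    simp [tripleLoop, forLoop, middleBody, innerLoop, Cmd.natArrs, hna']
  have h₀ : Tab lay s₀ ∅ s₀ :=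
    ⟨fun _ _ => rfl, fun _ _ => rfl, fun x hx h => absurd (hfresh x hx) h, by simp⟩
  refine (runs_forTab (X := fun a => {x | ∃ b < S, s₀.natArr 6 (srcAddr s₀ a b) ≠ 0 ∧ ∃ c < S,
    s₀.natArr 5 b + s₀.natArr 5 c ≤ s₀.natReg 1 ∧ x ∈ X a b c})
    (B := S * ((S * ((B + 9) + 10) + 8 + 14) + 10) + 8) hS (by decide)
    (hnr 9 (by decide)) (hnr 3 (by decide)) h₀ ?_).mono ?_ fun s _ h => h.of_eq rfl rfl (by simp)
  · intro a ha s₁ P₁ hf₁ h9 hT₁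
    have hS₁ : s₁.natReg 3 = S := by rw [hf₁.natReg 3 (hnt 3 (by decide)), hS]
    refine runs_forTab (X := fun b => {x | s₀.natArr 6 (srcAddr s₀ a b) ≠ 0 ∧ ∃ c < S,
      s₀.natArr 5 b + s₀.natArr 5 c ≤ s₀.natReg 1 ∧ x ∈ X a b c}) hS₁ (by decide)
      (hnm 10 (by decide)) (hnm 3 (by decide)) hT₁ ?_
    intro b hb s₂ P₂ hf₂ h10 hT₂
    have fr₂ : Frame (tripleLoop body) s₀ s₂ := hf₁.trans hf₂.forLoop_body
    have h9₂ : s₂.natReg 9 = a := by rw [hf₂.natReg 9 (hnr 9 (by decide)), h9]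
    have hS₂ : s₂.natReg 3 = S := by rw [fr₂.natReg 3 (hnt 3 (by decide)), hS]
    have r1 : s₂.natReg 1 = s₀.natReg 1 := fr₂.natReg 1 (hnt 1 (by decide))
    have a5 : s₂.natArr 5 = s₀.natArr 5 := fr₂.natArr 5 (hnt' 5 (by decide))
    have hsr : srcAddr s₂ a b = srcAddr s₀ a b := by
      simp only [srcAddr, fr₂.natReg 5 (hnt 5 (by decide)), fr₂.natArr 3 (hnt' 3 (by decide)),
        fr₂.natArr 4 (hnt' 4 (by decide))]
    have hd : s₂.natArr 6 (srcAddr s₀ a b) = s₀.natArr 6 (srcAddr s₀ a b) :=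
      hT₂.old_def _ (hsrc a ha b hb)
    have key := runs_middleBody (X := X a b) hflat hcost hn' hna' hS₂ hT₂ (by
      rw [h9₂, h10, hsr, hd, a5, r1]
      intro c hc hne hz s P' hf h9' h10' h11 h12 hT
      exact hstep a ha b hb c hc hne hz s P' (fr₂.trans hf.forLoop_body.forLoop_body) h9' h10' h11
        h12 (hT.old_val _ (hsrc a ha b hb)) hT)
    rw [h9₂, h10, hsr, hd, a5, r1] at key
    exact key
  · have e1 : 1 ≤ S ^ 2 := Nat.one_le_pow _ _ hS1
    have e2 : S ≤ S ^ 3 := Nat.le_self_pow (by norm_num) S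
    have e3 : S ^ 2 ≤ S ^ 3 := Nat.pow_le_pow_right hS1 (by norm_num)
    have e4 : S * (S * (S * (B + 9 + 10) + 8 + 14 + 10) + 8 + 10) + 8 =
      (B + 19) * S ^ 3 + 32 * S ^ 2 + 18 * S + 8 := by ring
    rw [e4, show (B + 80) * S ^ 3 = (B + 19) * S ^ 3 + 61 * S ^ 3 by ring]
    omega

end RealRAM

namespace RealRAM

open MovingIntervals

/-! ### The dynamic program on the machine -/

/-- Continue a state by keeping, skipping or moving the interval in register `8`. -/
def layerBody (mode : Bool) : Cmd :=
  .seq (.seq (.setReal 6 (.add (.read 6 (.reg 12)) (.read 5 (.reg 11))))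
    (.setNat 13 (.add (.add (.reg 6) (.read 3 (.reg 9)))
      (.add (.read 4 (.reg 10)) (.read 4 (.reg 11))))))
    (.seq (.branch (.realLe (.reg 6) (.read 2 (.reg 8))) (push (.reg 13) (.read 3 (.reg 8))) .skip)
      (.seq (if mode then push (.reg 13) (.reg 6) else .skip)
        (.branch (.natLe (.add (.read 5 (.reg 9)) (.const 1)) (.reg 1))
          (push (.add (.reg 13) (.read 2 (.reg 8))) (.reg 6)) .skip)))

def layer (mode : Bool) : Cmd :=
  .seq (.setNat 6 (.add (.reg 5) (.reg 4)))
    (.seq (tripleLoop (layerBody mode)) (.setNat 5 (.reg 6)))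

def finishBody : Cmd :=
  .branch (.and (.realLe (.add (.read 6 (.reg 12)) (.read 5 (.reg 11))) (.reg 4))
      (.and (.natLe (.read 3 (.reg 9)) (.add (.read 3 (.reg 10)) (.read 3 (.reg 11))))
        (.natLe (.add (.read 3 (.reg 10)) (.read 3 (.reg 11))) (.read 3 (.reg 9)))))
    (push (.reg 6) (.reg 4)) .skip

/-- Set the flag in register `7` if there is an accepting state. -/
def finish : Cmd :=
  .seq (.setNat 6 (.add (.reg 5) (.reg 4))) (.seq (tripleLoop finishBody)
    (.seq (.branch (.natLe (.const 1) (.read 6 (.reg 6))) (.setNat 7 (.const 1)) .skip)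
      (.setNat 5 (.add (.reg 6) (.const 1)))))

/-- The dynamic program, from frontier `z` in real register `3` to `w` in real register `4`. -/
def dynProg (mode : Bool) : Cmd :=
  .seq (.seq (.writeNat 6 (.reg 5) (.const 1)) (.writeReal 6 (.reg 5) (.reg 3)))
    (.seq (forLoop 8 0 (layer mode)) finish)

/-- The tables needed by the dynamic program are in the memory of `s`. -/
structure Ready (n τ K S : ℕ) (A Y lenT : ℕ → ℝ) (ix : ℝ → ℕ) (V : ℕ → Multiset ℝ) (s : State) :
    Prop where
  n_eq : s.natReg 0 = n
  τ_eq : s.natReg 1 = τ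
  S_eq : s.natReg 3 = S
  big_eq : s.natReg 4 = (τ + 1) ^ (K + K)
  left : s.realArr 2 = A
  right : s.realArr 3 = Y
  ix_len : ∀ k < K, ix (lenT k) = k
  entries : Entries τ K lenT ix K V S (s.natArr 3) (s.natArr 4) (s.natArr 5) (s.realArr 5)
  complete : Complete τ lenT K V S
  within : ∀ m, Within K lenT m ↔ Adm n A Y m
  weight : ∀ i < n, s.natArr 2 i = (τ + 1) ^ ix (Y i - A i)

section Ready

variable {n τ K S : ℕ} {A Y lenT : ℕ → ℝ} {ix : ℝ → ℕ} {V : ℕ → Multiset ℝ} {s s' : State}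

theorem Ready.of_frame {c : Cmd} (h : Ready n τ K S A Y lenT ix V s) (hf : Frame c s s')
    (h₁ : ∀ r ∈ [0, 1, 3, 4], r ∉ c.natRegs) (h₂ : ∀ r ∈ [2, 3, 4, 5], r ∉ c.natArrs)
    (h₃ : ∀ r ∈ [2, 3, 5], r ∉ c.realArrs) : Ready n τ K S A Y lenT ix V s' := by
  have a3 := hf.natArr 3 (h₂ 3 (by decide))
  have a4 := hf.natArr 4 (h₂ 4 (by decide))
  have a5 := hf.natArr 5 (h₂ 5 (by decide))
  have b5 := hf.realArr 5 (h₃ 5 (by decide))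
  exact ⟨by rw [hf.natReg 0 (h₁ 0 (by decide)), h.n_eq],
    by rw [hf.natReg 1 (h₁ 1 (by decide)), h.τ_eq],
    by rw [hf.natReg 3 (h₁ 3 (by decide)), h.S_eq],
    by rw [hf.natReg 4 (h₁ 4 (by decide)), h.big_eq],
    by rw [hf.realArr 2 (h₃ 2 (by decide)), h.left],
    by rw [hf.realArr 3 (h₃ 3 (by decide)), h.right],
    h.ix_len, by rw [a3, a4, a5, b5]; exact h.entries, h.complete, h.within,
    by rw [hf.natArr 2 (h₂ 2 (by decide))]; exact h.weight⟩

theorem Ready.pos (h : Ready n τ K S A Y lenT ix V s) : 1 ≤ S := by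
  obtain ⟨p, hp, -⟩ := h.complete 0 (by simp) (by simp [Within])
  omega

theorem Ready.adm (h : Ready n τ K S A Y lenT ix V s) {p : ℕ} (hp : p < S) : Adm n A Y (V p) :=
  (h.within _).1 (h.entries.within p hp)

theorem Ready.exists_index (h : Ready n τ K S A Y lenT ix V s) {m : Multiset ℝ}
    (hm : Adm n A Y m) (hc : Multiset.card m ≤ τ) : ∃ p < S, V p = m :=
  h.complete m hc ((h.within _).2 hm)

/-- The offset of the state `(a, b)` within a layer. -/
def offset (τ K : ℕ) (ix : ℝ → ℕ) (a b : Multiset ℝ) : ℕ :=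
  codeOf (τ + 1) ix a + (τ + 1) ^ K * codeOf (τ + 1) ix b

theorem Ready.offset_lt (h : Ready n τ K S A Y lenT ix V s) {a b : Multiset ℝ}
    (ha : Adm n A Y a ∧ Multiset.card a ≤ τ) (hb : Adm n A Y b ∧ Multiset.card b ≤ τ) :
    offset τ K ix a b < (τ + 1) ^ (K + K) := by
  have h1 := Within.codeOf_lt h.ix_len ((h.within _).2 ha.1) ha.2
  have h2 := Within.codeOf_lt h.ix_len ((h.within _).2 hb.1) hb.2
  have h3 := Nat.mul_le_mul_left ((τ + 1) ^ K) (Nat.succ_le_of_lt h2)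
  rw [Nat.mul_succ, ← pow_add] at h3
  unfold offset
  omega

/-- Quotient and remainder modulo `(τ + 1) ^ K` recover the two codes, since the code of `a` is
smaller than this modulus. -/
theorem Ready.offset_inj (h : Ready n τ K S A Y lenT ix V s) {a b a' b' : Multiset ℝ}
    (ha : Adm n A Y a ∧ Multiset.card a ≤ τ) (hb : Adm n A Y b ∧ Multiset.card b ≤ τ)
    (ha' : Adm n A Y a' ∧ Multiset.card a' ≤ τ) (hb' : Adm n A Y b' ∧ Multiset.card b' ≤ τ)
    (he : offset τ K ix a b = offset τ K ix a' b') : a = a' ∧ b = b' := by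
  have h1 := Within.codeOf_lt h.ix_len ((h.within _).2 ha.1) ha.2
  have h1' := Within.codeOf_lt h.ix_len ((h.within _).2 ha'.1) ha'.2
  unfold offset at he
  have hpos : 0 < (τ + 1) ^ K := by positivity
  have hdiv := congrArg (· / (τ + 1) ^ K) he
  simp only [Nat.add_mul_div_left _ _ hpos, Nat.div_eq_of_lt h1, Nat.div_eq_of_lt h1',
    zero_add] at hdiv
  rw [hdiv] at he
  exact ⟨Within.codeOf_inj h.ix_len ((h.within _).2 ha.1) ((h.within _).2 ha'.1) ha.2 ha'.2
      (by omega),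
    Within.codeOf_inj h.ix_len ((h.within _).2 hb.1) ((h.within _).2 hb'.1) hb.2 hb'.2 hdiv⟩

theorem Ready.srcAddr_eq (h : Ready n τ K S A Y lenT ix V s) {a b : ℕ} (ha : a < S) (hb : b < S) :
    srcAddr s a b = s.natReg 5 + offset τ K ix (V a) (V b) := by
  rw [srcAddr, h.entries.code a ha, h.entries.code' b hb, offset]
  ring

/-- The layer starting at address `lay` contains the least frontiers of the states reachable after
`i` intervals, and there is nothing behind it. -/
structure LayerOK (n τ K : ℕ) (mode : Bool) (A Y : ℕ → ℝ) (ix : ℝ → ℕ) (z : ℝ) (i lay : ℕ)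
    (s : State) : Prop where
  sound : ∀ x, lay ≤ x → s.natArr 6 x ≠ 0 → ∃ a b, x = lay + offset τ K ix a b ∧
    Reach n τ mode A Y z i a b (s.realArr 6 x)
  complete : ∀ a b q, Reach n τ mode A Y z i a b q → s.natArr 6 (lay + offset τ K ix a b) ≠ 0 ∧
    s.realArr 6 (lay + offset τ K ix a b) ≤ q

/-- Soundness only provides some reachable state at this address; injectivity of `offset` identifies
it as `(V a, V b)`. -/
theorem LayerOK.src {mode : Bool} {z : ℝ} {i : ℕ}
    (hR : Ready n τ K S A Y lenT ix V s) (h : LayerOK n τ K mode A Y ix z i (s.natReg 5) s)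
    (hi : i ≤ n) {a b : ℕ} (ha : a < S) (hb : b < S) (hd : s.natArr 6 (srcAddr s a b) ≠ 0) :
    Reach n τ mode A Y z i (V a) (V b) (s.realArr 6 (srcAddr s a b)) := by
  have he := hR.srcAddr_eq ha hb
  obtain ⟨a', b', h1, h2⟩ := h.sound _ (by omega) hd
  obtain ⟨g1, g2⟩ := h2.adm hi
  obtain ⟨rfl, rfl⟩ := hR.offset_inj ⟨hR.adm ha, hR.entries.card_le a ha⟩
    ⟨hR.adm hb, hR.entries.card_le b hb⟩ g1 g2 (by omega)
  exact h2

/-- The memory behind the current layer is untouched, so the next layer needs no clearing. Thus the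
layer size `(τ + 1) ^ (K + K)` affects addresses but not the running time, which depends on the
number of listed multisets only. -/
theorem LayerOK.fresh {mode : Bool} {z : ℝ} {i lay : ℕ}
    (hR : Ready n τ K S A Y lenT ix V s) (h : LayerOK n τ K mode A Y ix z i lay s)
    (hi : i ≤ n) (x : ℕ) (hx : lay + (τ + 1) ^ (K + K) ≤ x) : s.natArr 6 x = 0 := by
  by_contra hd
  obtain ⟨a', b', h1, h2⟩ := h.sound x (by omega) hd
  obtain ⟨g1, g2⟩ := h2.adm hi
  have := hR.offset_lt g1 g2
  omega

/-- Minimal frontiers suffice: lowering `q` preserves the condition for keeping an interval and does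
not raise the frontier after any transition. -/
theorem runs_layer {mode : Bool} {z : ℝ} {i : ℕ} (hR : Ready n τ K S A Y lenT ix V s)
    (h8 : s.natReg 8 = i) (hi : i < n) (h : LayerOK n τ K mode A Y ix z i (s.natReg 5) s) :
    Runs (layer mode) s (300 * S ^ 3) (fun s' =>
      LayerOK n τ K mode A Y ix z (i + 1) (s'.natReg 5) s') := by
  set big := (τ + 1) ^ (K + K) with hbig
  set lay := s.natReg 5 + big with hlay
  have h1 : Runs (.setNat 6 (.add (.reg 5) (.reg 4))) s 4 (fun s' => s' = s.setNat 6 lay) :=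
    .flat rfl (by decide) (by simp [Cmd.run, hR.big_eq, hlay, hbig])
  have hS3 : 1 ≤ S ^ 3 := Nat.one_le_pow _ _ hR.pos
  refine (h1.seq (T₂ := (200 + 80) * S ^ 3 + 2) ?_).mono (by omega) fun _ _ h => h
  rintro s₁ hf₁ rfl
  have hR₁ : Ready n τ K S A Y lenT ix V (s.setNat 6 lay) :=
    hR.of_frame hf₁ (by decide) (by decide) (by decide)
  have h8₁ : (s.setNat 6 lay).natReg 8 = i := by simpa using h8
  have h6₁ : (s.setNat 6 lay).natReg 6 = lay := by simp
  have h5₁ : (s.setNat 6 lay).natReg 5 = s.natReg 5 := by simp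
  have hL₁ : LayerOK n τ K mode A Y ix z i ((s.setNat 6 lay).natReg 5) (s.setNat 6 lay) := by
    rw [h5₁]; exact ⟨h.sound, h.complete⟩
  rw [← h5₁] at hlay
  generalize s.setNat 6 lay = s₁ at *
  clear h1 hf₁ h5₁
  have hsz : ∀ {p}, p < S → Adm n A Y (V p) ∧ Multiset.card (V p) ≤ τ :=
    fun hp => ⟨hR₁.adm hp, hR₁.entries.card_le _ hp⟩
  let tgt : ℕ → ℕ → ℕ → ℕ := fun a b c => lay + s₁.natArr 3 a + (s₁.natArr 4 b + s₁.natArr 4 c)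
  let val : ℕ → ℕ → ℕ → ℝ := fun a b c => s₁.realArr 6 (srcAddr s₁ a b) + s₁.realArr 5 c
  -- The three sets are the records for keeping, skipping and moving. Moving adds the length of
  -- interval `i` to `a`, which shifts the address by its weight.
  let X : ℕ → ℕ → ℕ → Set (ℕ × ℝ) := fun a b c =>
    ({x | val a b c ≤ A i ∧ x = (tgt a b c, Y i)} ∪ {x | mode = true ∧ x = (tgt a b c, val a b c)}) ∪
      {x | s₁.natArr 5 a + 1 ≤ τ ∧ x = (tgt a b c + s₁.natArr 2 i, val a b c)}
  have hcost : (layerBody mode).flatCost ≤ 200 := by cases mode <;> decide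
  refine (runs_tripleLoop (X := X) (lay := lay) (s₀ := s₁) (by cases mode <;> rfl) hcost
    (by cases mode <;> decide) (by cases mode <;> decide) hR₁.S_eq hR₁.pos ?_ ?_ ?_).seq ?_
  · intro a ha b hb
    rw [hR₁.srcAddr_eq ha hb]
    have := hR₁.offset_lt (hsz ha) (hsz hb)
    omega
  · intro x hx
    exact hL₁.fresh hR₁ hi.le x (by omega)
  · intro a ha b hb c hc hd hz t P hf t9 t10 t11 t12 tv hT
    have r6 : t.natReg 6 = lay := by rw [hf.natReg 6 (by cases mode <;> decide), h6₁]
    have r8 : t.natReg 8 = i := by rw [hf.natReg 8 (by cases mode <;> decide), h8₁]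
    have r1 : t.natReg 1 = τ := by rw [hf.natReg 1 (by cases mode <;> decide), hR₁.τ_eq]
    have a2 : t.natArr 2 = s₁.natArr 2 := hf.natArr 2 (by cases mode <;> decide)
    have a3 : t.natArr 3 = s₁.natArr 3 := hf.natArr 3 (by cases mode <;> decide)
    have a4 : t.natArr 4 = s₁.natArr 4 := hf.natArr 4 (by cases mode <;> decide)
    have a5 : t.natArr 5 = s₁.natArr 5 := hf.natArr 5 (by cases mode <;> decide)
    have b2 : t.realArr 2 = A := by rw [hf.realArr 2 (by cases mode <;> decide), hR₁.left]
    have b3 : t.realArr 3 = Y := by rw [hf.realArr 3 (by cases mode <;> decide), hR₁.right]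
    have b5 : t.realArr 5 = s₁.realArr 5 := hf.realArr 5 (by cases mode <;> decide)
    -- the target address and the new frontier are computed
    obtain ⟨u, hu⟩ : ∃ u, u = (t.setReal 6 (val a b c)).setNat 13 (tgt a b c) := ⟨_, rfl⟩
    have hrun : (Cmd.seq (.setReal 6 (.add (.read 6 (.reg 12)) (.read 5 (.reg 11))))
        (.setNat 13 (.add (.add (.reg 6) (.read 3 (.reg 9)))
        (.add (.read 4 (.reg 10)) (.read 4 (.reg 11)))))).run t = u := by
      simp [hu, Cmd.run, t9, t10, t11, t12, tv, r6, a3, a4, b5, val, tgt]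
    have hTu : Tab lay s₁ P u := hT.of_eq (by simp [hu]) (by simp [hu]) rfl
    have u13 : u.natReg 13 = tgt a b c := by simp [hu]
    have u6 : u.realReg 6 = val a b c := by simp [hu]
    have u8 : u.natReg 8 = i := by simp [hu, r8]
    have u9 : u.natReg 9 = a := by simp [hu, t9]
    have u1 : u.natReg 1 = τ := by simp [hu, r1]
    have ua2 : u.natArr 2 = s₁.natArr 2 := by simp [hu, a2]
    have ua5 : u.natArr 5 = s₁.natArr 5 := by simp [hu, a5]
    have ub2 : u.realArr 2 = A := by simp [hu, b2]
    have ub3 : u.realArr 3 = Y := by simp [hu, b3]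
    have htl : lay ≤ tgt a b c := by simp only [tgt]; omega
    rw [layerBody, Cmd.run, hrun]
    clear hrun hT hu
    rw [Cmd.run]
    -- keep
    obtain ⟨v, hv⟩ : ∃ v, v = (Cmd.branch (.realLe (.reg 6) (.read 2 (.reg 8)))
      (push (.reg 13) (.read 3 (.reg 8))) .skip).run u := ⟨_, rfl⟩
    have hfv : Frame (push (.reg 13) (.read 3 (.reg 8))) u v := by
      rw [hv, Cmd.run]
      split_ifs
      · obtain ⟨_, _, he⟩ := (push (.reg 13) (.read 3 (.reg 8))).exec_run rfl u
        exact he.frame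
      · exact Frame.refl _ _
    have hTv : Tab lay s₁ (P ∪ {x | val a b c ≤ A i ∧ x = (tgt a b c, Y i)}) v := by
      rw [hv, Cmd.run]
      simp only [BExp.Holds, NExp.eval, RExp.eval, u6, u8, ub2]
      split_ifs with hc
      · refine (hTu.push (.reg 13) (.read 3 (.reg 8)) (by simpa [u13] using htl) (by simp)).of_eq
          rfl rfl ?_
        simp only [NExp.eval, RExp.eval, u13, u8, ub3, hc, true_and]
        rfl
      · refine hTu.of_eq rfl rfl ?_
        simp [hc]
    rw [← hv]
    have v13 : v.natReg 13 = tgt a b c := by rw [hfv.natReg 13 (by decide), u13]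
    have v6 : v.realReg 6 = val a b c := by rw [hfv.realReg 6 (by decide), u6]
    have v8 : v.natReg 8 = i := by rw [hfv.natReg 8 (by decide), u8]
    have v9 : v.natReg 9 = a := by rw [hfv.natReg 9 (by decide), u9]
    have v1 : v.natReg 1 = τ := by rw [hfv.natReg 1 (by decide), u1]
    have va2 : v.natArr 2 = s₁.natArr 2 := by rw [hfv.natArr 2 (by decide), ua2]
    have va5 : v.natArr 5 = s₁.natArr 5 := by rw [hfv.natArr 5 (by decide), ua5]
    clear hv
    rw [Cmd.run]
    -- skip
    obtain ⟨w, hw⟩ : ∃ w, w = (if mode = true then push (.reg 13) (.reg 6) else Cmd.skip).run v :=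
      ⟨_, rfl⟩
    have hfw : Frame (push (.reg 13) (.reg 6)) v w := by
      rw [hw]
      split_ifs
      · obtain ⟨_, _, he⟩ := (push (.reg 13) (.reg 6)).exec_run rfl v
        exact he.frame
      · exact Frame.refl _ _
    have hTw : Tab lay s₁ (P ∪ ({x | val a b c ≤ A i ∧ x = (tgt a b c, Y i)} ∪
        {x | mode = true ∧ x = (tgt a b c, val a b c)})) w := by
      rw [hw, ← Set.union_assoc]
      split_ifs with hm
      · refine (hTv.push (.reg 13) (.reg 6) (by simpa [v13] using htl) (by simp)).of_eq
          rfl rfl ?_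
        simp only [NExp.eval, RExp.eval, v13, v6, hm, true_and]
        rfl
      · refine hTv.of_eq rfl rfl ?_
        simp [hm]
    rw [← hw]
    have w13 : w.natReg 13 = tgt a b c := by rw [hfw.natReg 13 (by decide), v13]
    have w6 : w.realReg 6 = val a b c := by rw [hfw.realReg 6 (by decide), v6]
    have w8 : w.natReg 8 = i := by rw [hfw.natReg 8 (by decide), v8]
    have w9 : w.natReg 9 = a := by rw [hfw.natReg 9 (by decide), v9]
    have w1 : w.natReg 1 = τ := by rw [hfw.natReg 1 (by decide), v1]
    have wa2 : w.natArr 2 = s₁.natArr 2 := by rw [hfw.natArr 2 (by decide), va2]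
    have wa5 : w.natArr 5 = s₁.natArr 5 := by rw [hfw.natArr 5 (by decide), va5]
    clear hw
    rw [Cmd.run]
    simp only [BExp.Holds, NExp.eval, w9, w1, wa5]
    simp only [X]
    rw [← Set.union_assoc]
    split_ifs with hc
    · refine (hTw.push (.add (.reg 13) (.read 2 (.reg 8))) (.reg 6) ?_ (by simp)).of_eq rfl rfl ?_
      · simp only [NExp.eval, w13]; omega
      · simp only [NExp.eval, RExp.eval, w13, w6, w8, wa2, hc, true_and]
        rfl
    · refine hTw.of_eq rfl rfl ?_
      simp [hc]
  · intro s₂ hf₂ hT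
    have r6 : s₂.natReg 6 = lay := by rw [hf₂.natReg 6 (by cases mode <;> decide), h6₁]
    refine .flat rfl (by decide) ?_
    have htgt : ∀ a b c, a < S → b < S → c < S →
        tgt a b c = lay + offset τ K ix (V a) (V b + V c) := by
      intro a b c ha hb hc
      simp only [tgt, offset, hR₁.entries.code a ha, hR₁.entries.code' b hb,
        hR₁.entries.code' c hc, codeOf_add]
      ring
    have htgt' : ∀ a b c, a < S → b < S → c < S → tgt a b c + s₁.natArr 2 i =
        lay + offset τ K ix ((Y i - A i) ::ₘ V a) (V b + V c) := by
      intro a b c ha hb hc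
      rw [htgt a b c ha hb hc, hR₁.weight i hi]
      simp only [offset, codeOf_cons]
      ring
    have hval : ∀ a b c, c < S → val a b c = s₁.realArr 6 (srcAddr s₁ a b) + (V c).sum := by
      intro a b c hc
      simp only [val, hR₁.entries.tot c hc]
    simp only [Cmd.run, State.natReg_setNat, NExp.eval, if_true, r6]
    constructor
    · intro x hx hd
      simp only [State.natArr_setNat, State.realArr_setNat] at hd ⊢
      obtain ⟨a, ha, b, hb, hdef, c, hc, hz, hX⟩ := hT.sound x hx hd
      rw [hR₁.entries.size b hb, hR₁.entries.size c hc, hR₁.τ_eq] at hz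
      have hreach := hL₁.src hR₁ hi.le ha hb hdef
      rcases hX with (⟨hq, he⟩ | ⟨hm, he⟩) | ⟨hq, he⟩
      · rw [Prod.mk.injEq, htgt a b c ha hb hc] at he
        rw [hval a b c hc] at hq
        rw [he.2]
        exact ⟨_, _, he.1, .keep hreach (hR₁.adm hc) hz hq⟩
      · rw [Prod.mk.injEq, htgt a b c ha hb hc, hval a b c hc] at he
        rw [he.2]
        exact ⟨_, _, he.1, .skip hreach (hR₁.adm hc) hz hm⟩
      · rw [Prod.mk.injEq, htgt' a b c ha hb hc, hval a b c hc] at he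
        rw [he.2]
        rw [hR₁.entries.size a ha] at hq
        exact ⟨_, _, he.1, .move hreach (hR₁.adm hc) hz hq⟩
    -- Every reachable state occurs in the loops with a stored frontier at most `q`, so its
    -- successors are recorded with frontiers that are at most as large as required.
    · have hprev : ∀ a b c q, Reach n τ mode A Y z i a b q → Adm n A Y c →
          Multiset.card b + Multiset.card c ≤ τ → ∃ a' b' c', a' < S ∧ b' < S ∧ c' < S ∧
          V a' = a ∧ V b' = b ∧ V c' = c ∧ val a' b' c' ≤ q + c.sum ∧
          ∀ x ∈ X a' b' c', s₂.natArr 6 x.1 ≠ 0 ∧ s₂.realArr 6 x.1 ≤ x.2 := by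
        intro a b c q hr hc hz
        obtain ⟨g1, g2⟩ := hr.adm hi.le
        obtain ⟨a', ha', rfl⟩ := hR₁.exists_index g1.1 g1.2
        obtain ⟨b', hb', rfl⟩ := hR₁.exists_index g2.1 g2.2
        obtain ⟨c', hc', rfl⟩ := hR₁.exists_index hc (by omega)
        obtain ⟨k1, k2⟩ := hL₁.complete _ _ _ hr
        rw [← hR₁.srcAddr_eq ha' hb'] at k1 k2
        refine ⟨a', b', c', ha', hb', hc', rfl, rfl, rfl, ?_, fun x hx => ?_⟩
        · rw [hval _ _ _ hc']; linarith
        · refine (hT.complete x.1 x.2 ⟨a', ha', b', hb', k1, c', hc', ?_, hx⟩).2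
          rwa [hR₁.entries.size b' hb', hR₁.entries.size c' hc', hR₁.τ_eq]
      intro a b q hr
      simp only [State.natArr_setNat, State.realArr_setNat]
      cases hr with
      | @keep _ _ b c q hr hc hz hq =>
        obtain ⟨a', b', c', ha', hb', hc', rfl, rfl, rfl, hle, hX⟩ := hprev _ _ _ _ hr hc hz
        rw [← htgt a' b' c' ha' hb' hc']
        exact hX (_, _) (.inl (.inl ⟨hle.trans hq, rfl⟩))
      | @skip _ _ b c q hr hc hz hm =>
        obtain ⟨a', b', c', ha', hb', hc', rfl, rfl, rfl, hle, hX⟩ := hprev _ _ _ _ hr hc hz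
        rw [← htgt a' b' c' ha' hb' hc']
        obtain ⟨k1, k2⟩ := hX (_, _) (.inl (.inr ⟨hm, rfl⟩))
        exact ⟨k1, k2.trans hle⟩
      | @move _ a b c q hr hc hz hq =>
        obtain ⟨a', b', c', ha', hb', hc', rfl, rfl, rfl, hle, hX⟩ := hprev _ _ _ _ hr hc hz
        rw [← htgt' a' b' c' ha' hb' hc']
        obtain ⟨k1, k2⟩ := hX (_, _) (.inr ⟨by rwa [hR₁.entries.size a' ha'], rfl⟩)
        exact ⟨k1, k2.trans hle⟩

end Ready

end RealRAM

/-! ### Acceptance and the complete dynamic program -/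

namespace RealRAM

open MovingIntervals

section Ready

variable {n τ K S : ℕ} {A Y lenT : ℕ → ℝ} {ix : ℝ → ℕ} {V : ℕ → Multiset ℝ} {s s' : State}

/-- The condition `a = b + c` is tested on codes; this is exact because `b + c` has at most `τ`
elements, so adding the codes causes no carry. The cell at `lay` serves as a flag that some triple
accepts, and register 5 moves behind it so that another run again finds fresh memory. -/
theorem runs_finish {mode : Bool} {z : ℝ} (hR : Ready n τ K S A Y lenT ix V s)
    (h : LayerOK n τ K mode A Y ix z n (s.natReg 5) s) :
    Runs finish s (200 * S ^ 3) (fun s' => (∀ x, s'.natReg 5 ≤ x → s'.natArr 6 x = 0) ∧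
      (Accept n τ mode A Y z (s.realReg 4) → s'.natReg 7 = 1) ∧
      (¬ Accept n τ mode A Y z (s.realReg 4) → s'.natReg 7 = s.natReg 7)) := by
  set big := (τ + 1) ^ (K + K) with hbig
  set lay := s.natReg 5 + big with hlay
  have h1 : Runs (.setNat 6 (.add (.reg 5) (.reg 4))) s 4 (fun s' => s' = s.setNat 6 lay) :=
    .flat rfl (by decide) (by simp [Cmd.run, hR.big_eq, hlay, hbig])
  have hS3 : 1 ≤ S ^ 3 := Nat.one_le_pow _ _ hR.pos
  refine (h1.seq (T₂ := (80 + 80) * S ^ 3 + 16) ?_).mono (by omega) fun _ _ h => h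
  rintro s₁ hf₁ rfl
  have hR₁ : Ready n τ K S A Y lenT ix V (s.setNat 6 lay) :=
    hR.of_frame hf₁ (by decide) (by decide) (by decide)
  have h6₁ : (s.setNat 6 lay).natReg 6 = lay := by simp
  have h7₁ : (s.setNat 6 lay).natReg 7 = s.natReg 7 := by simp
  have h4₁ : (s.setNat 6 lay).realReg 4 = s.realReg 4 := by simp
  have h5₁ : (s.setNat 6 lay).natReg 5 = s.natReg 5 := by simp
  have hL₁ : LayerOK n τ K mode A Y ix z n ((s.setNat 6 lay).natReg 5) (s.setNat 6 lay) := by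
    rw [h5₁]; exact ⟨h.sound, h.complete⟩
  rw [← h5₁] at hlay
  rw [← h4₁, ← h7₁]
  generalize s.setNat 6 lay = s₁ at *
  clear h1 hf₁ h5₁ h7₁ h4₁
  set w := s₁.realReg 4 with hw
  have hsz : ∀ {p}, p < S → Adm n A Y (V p) ∧ Multiset.card (V p) ≤ τ :=
    fun hp => ⟨hR₁.adm hp, hR₁.entries.card_le _ hp⟩
  let X : ℕ → ℕ → ℕ → Set (ℕ × ℝ) := fun a b c =>
    {x | (s₁.realArr 6 (srcAddr s₁ a b) + s₁.realArr 5 c ≤ w ∧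
      s₁.natArr 3 a = s₁.natArr 3 b + s₁.natArr 3 c) ∧ x = (lay, w)}
  refine (runs_tripleLoop (X := X) (lay := lay) (s₀ := s₁) (body := finishBody) rfl (B := 80)
    (by decide) (by decide) (by decide) hR₁.S_eq hR₁.pos ?_ ?_ ?_).seq ?_
  · intro a ha b hb
    rw [hR₁.srcAddr_eq ha hb]
    have := hR₁.offset_lt (hsz ha) (hsz hb)
    omega
  · intro x hx
    exact hL₁.fresh hR₁ le_rfl x (by omega)
  · intro a ha b hb c hc hd hz t P hf t9 t10 t11 t12 tv hT
    have r6 : t.natReg 6 = lay := by rw [hf.natReg 6 (by decide), h6₁]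
    have r4 : t.realReg 4 = w := hf.realReg 4 (by decide)
    have a3 : t.natArr 3 = s₁.natArr 3 := hf.natArr 3 (by decide)
    have b5 : t.realArr 5 = s₁.realArr 5 := hf.realArr 5 (by decide)
    rw [finishBody, Cmd.run]
    simp only [BExp.Holds, NExp.eval, RExp.eval, t9, t10, t11, t12, tv, r4, a3, b5, X]
    split_ifs with hcond
    · have hcond' : s₁.realArr 6 (srcAddr s₁ a b) + s₁.realArr 5 c ≤ w ∧
        s₁.natArr 3 a = s₁.natArr 3 b + s₁.natArr 3 c := ⟨hcond.1, by omega⟩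
      refine (hT.push (.reg 6) (.reg 4) (by simp [r6]) (by simp)).of_eq rfl rfl ?_
      simp only [NExp.eval, RExp.eval, r6, r4, hcond', and_self, true_and]
      rfl
    · have hcond' : ¬ (s₁.realArr 6 (srcAddr s₁ a b) + s₁.realArr 5 c ≤ w ∧
        s₁.natArr 3 a = s₁.natArr 3 b + s₁.natArr 3 c) :=
        fun h => hcond ⟨h.1, by omega, by omega⟩
      refine hT.of_eq rfl rfl ?_
      simp only [hcond', false_and, Set.ofPred_false, Set.union_empty]
  · intro s₂ hf₂ hT
    have r6 : s₂.natReg 6 = lay := by rw [hf₂.natReg 6 (by decide), h6₁]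
    have r7 : s₂.natReg 7 = s₁.natReg 7 := hf₂.natReg 7 (by decide)
    have hiff : s₂.natArr 6 lay ≠ 0 ↔ Accept n τ mode A Y z w := by
      constructor
      · intro hd
        obtain ⟨a, ha, b, hb, hdef, c, hc, hz, ⟨hq, hcode⟩, -⟩ := hT.sound lay le_rfl hd
        rw [hR₁.entries.size b hb, hR₁.entries.size c hc, hR₁.τ_eq] at hz
        rw [hR₁.entries.code a ha, hR₁.entries.code b hb, hR₁.entries.code c hc,
          ← codeOf_add] at hcode
        rw [hR₁.entries.tot c hc] at hq
        have hadd : Adm n A Y (V b + V c) := (hR₁.adm hb).add (hR₁.adm hc)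
        exact ⟨_, _, _, _, hL₁.src hR₁ le_rfl ha hb hdef, hR₁.adm hc, hz,
          Within.codeOf_inj hR₁.ix_len (hR₁.entries.within a ha) ((hR₁.within _).2 hadd)
            (hsz ha).2 (by rwa [Multiset.card_add]) hcode, hq⟩
      · rintro ⟨a, b, c, q, hr, hc, hz, rfl, hq⟩
        obtain ⟨g1, g2⟩ := hr.adm le_rfl
        obtain ⟨a', ha', he⟩ := hR₁.exists_index g1.1 g1.2
        obtain ⟨b', hb', rfl⟩ := hR₁.exists_index g2.1 g2.2
        obtain ⟨c', hc', rfl⟩ := hR₁.exists_index hc (by omega)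
        obtain ⟨k1, k2⟩ := hL₁.complete _ _ _ hr
        rw [← he, ← hR₁.srcAddr_eq ha' hb'] at k1 k2
        refine (hT.complete lay w ⟨a', ha', b', hb', k1, c', hc', ?_, ⟨?_, ?_⟩, rfl⟩).2.1
        · rwa [hR₁.entries.size b' hb', hR₁.entries.size c' hc', hR₁.τ_eq]
        · rw [hR₁.entries.tot c' hc']; linarith
        · rw [hR₁.entries.code a' ha', hR₁.entries.code b' hb', hR₁.entries.code c' hc',
            ← codeOf_add, he]
    have hfr : ∀ x, lay + 1 ≤ x → s₂.natArr 6 x = 0 := by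
      intro x hx
      by_contra hd
      obtain ⟨a, ha, b, hb, hdef, c, hc, hz, -, he⟩ := hT.sound x (by omega) hd
      rw [Prod.mk.injEq] at he
      omega
    refine .flat rfl (by decide) ?_
    simp only [Cmd.run, BExp.Holds, NExp.eval, r6]
    split_ifs with hc
    · have hacc := hiff.1 (by omega)
      refine ⟨?_, fun _ => by simp, fun h => absurd hacc h⟩
      simpa [r6] using hfr
    · have hacc : ¬ Accept n τ mode A Y z w := fun h => hc (by have := hiff.2 h; omega)
      refine ⟨?_, fun h => absurd h hacc, fun _ => by simpa using r7⟩
      simpa [r6] using hfr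

/-- The answer flag is only ever set, never reset, and the freshness of memory is restored; repeated
runs therefore compute a disjunction. -/
theorem runs_dynProg {mode : Bool} (hR : Ready n τ K S A Y lenT ix V s) (hn : 0 < n)
    (hfresh : ∀ x, s.natReg 5 ≤ x → s.natArr 6 x = 0) :
    Runs (dynProg mode) s (600 * (n * S ^ 3)) (fun s' =>
      (∀ x, s'.natReg 5 ≤ x → s'.natArr 6 x = 0) ∧
      (Accept n τ mode A Y (s.realReg 3) (s.realReg 4) → s'.natReg 7 = 1) ∧
      (¬ Accept n τ mode A Y (s.realReg 3) (s.realReg 4) → s'.natReg 7 = s.natReg 7)) := by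
  have h1 : Runs (.seq (.writeNat 6 (.reg 5) (.const 1)) (.writeReal 6 (.reg 5) (.reg 3))) s 6
      (fun s' => s' = (s.writeNat 6 (s.natReg 5) 1).writeReal 6 (s.natReg 5) (s.realReg 3)) :=
    .flat rfl (by decide) rfl
  have hS3 : 1 ≤ S ^ 3 := Nat.one_le_pow _ _ hR.pos
  have e1 : S ^ 3 ≤ n * S ^ 3 := Nat.le_mul_of_pos_left _ hn
  have e2 : n ≤ n * S ^ 3 := Nat.le_mul_of_pos_right _ hS3
  have e3 : n * (300 * S ^ 3 + 10) = 300 * (n * S ^ 3) + 10 * n := by ring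
  refine (h1.seq (T₂ := (n * (300 * S ^ 3 + 10) + 8) + 200 * S ^ 3) ?_).mono (by omega)
    fun _ _ h => h
  rintro s₁ hf₁ rfl
  set s₁ := (s.writeNat 6 (s.natReg 5) 1).writeReal 6 (s.natReg 5) (s.realReg 3) with hs₁
  have hR₁ : Ready n τ K S A Y lenT ix V s₁ :=
    hR.of_frame hf₁ (by decide) (by decide) (by decide)
  have h4 : s₁.realReg 4 = s.realReg 4 := by simp [hs₁]
  have h7 : s₁.natReg 7 = s.natReg 7 := by simp [hs₁]
  have hL₁ : LayerOK n τ K mode A Y ix (s.realReg 3) 0 (s₁.natReg 5) s₁ := by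
    have r5 : s₁.natReg 5 = s.natReg 5 := by simp [hs₁]
    have a6 : s₁.natArr 6 = Function.update (s.natArr 6) (s.natReg 5) 1 := by simp [hs₁]
    have b6 : s₁.realArr 6 = Function.update (s.realArr 6) (s.natReg 5) (s.realReg 3) := by
      simp [hs₁]
    rw [r5]
    constructor
    · intro x hx hd
      by_cases he : x = s.natReg 5
      · subst he
        rw [b6, Function.update_self]
        exact ⟨0, 0, by simp [offset], .start⟩
      · rw [a6, Function.update_of_ne he] at hd
        exact absurd (hfresh x hx) hd
    · intro a b q hr
      cases hr
      simp [offset, a6, b6]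
  clear_value s₁
  rw [← h4, ← h7]
  refine (Runs.forLoop (N := n) (s₀ := s₁) hR₁.n_eq (by decide) (by cases mode <;> decide)
    (by cases mode <;> decide)
    (fun i s' => LayerOK n τ K mode A Y ix (s.realReg 3) i (s'.natReg 5) s') (300 * S ^ 3)
    (fun k t v h => by
      have h5 : (t.setNat 8 v).natReg 5 = t.natReg 5 := by simp
      rw [h5]; exact ⟨h.sound, h.complete⟩) hL₁ ?_).seq ?_
  · intro i s₂ hi hf₂ h8 hI
    exact runs_layer (hR₁.of_frame hf₂ (by cases mode <;> decide) (by cases mode <;> decide)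
      (by cases mode <;> decide)) h8 hi hI
  · rintro s₂ hf₂ ⟨hI, -⟩
    have hR₂ := hR₁.of_frame hf₂ (by cases mode <;> decide) (by cases mode <;> decide)
      (by cases mode <;> decide)
    have := runs_finish hR₂ hI
    rwa [hf₂.realReg 4 (by cases mode <;> decide), hf₂.natReg 7 (by cases mode <;> decide)] at this

end Ready

end RealRAM

namespace MovingIntervals

/-! ### Packing -/

/-- Disjoint intervals inside `[u, v)` have total length at most `v - u`. -/
theorem sum_len_le {ι : Type*} [DecidableEq ι] (S : Finset ι) (x l : ι → ℝ) {u v : ℝ} (huv : u ≤ v)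
    (hpos : ∀ i ∈ S, 0 < l i)
    (hdis : ∀ i ∈ S, ∀ j ∈ S, i ≠ j → x i + l i ≤ x j ∨ x j + l j ≤ x i)
    (hin : ∀ i ∈ S, u ≤ x i ∧ x i + l i ≤ v) : ∑ i ∈ S, l i ≤ v - u := by
  -- Remove the interval that starts last: by disjointness all others end before its start, which
  -- becomes their right bound.
  induction S using Finset.induction_on_max_value x generalizing v with
  | empty => simpa using huv
  | insert a s ha hmax ih =>
    rw [Finset.sum_insert ha]
    have h1 := hin a (Finset.mem_insert_self _ _)
    have h2 : ∑ i ∈ s, l i ≤ x a - u := by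
      refine ih h1.1 (fun i hi => hpos i (Finset.mem_insert_of_mem hi))
        (fun i hi j hj => hdis i (Finset.mem_insert_of_mem hi) j (Finset.mem_insert_of_mem hj))
        fun i hi => ⟨(hin i (Finset.mem_insert_of_mem hi)).1, ?_⟩
      rcases hdis i (Finset.mem_insert_of_mem hi) a (Finset.mem_insert_self _ _)
        (by rintro rfl; exact ha hi) with h | h
      · exact h
      · have := hmax i hi
        have := hpos a (Finset.mem_insert_self _ _)
        linarith
    linarith

/-- Intervals covering `[u, v)` have total length at least `v - u`. -/
theorem le_sum_len (S : Finset ℕ) (x l : ℕ → ℝ) {u v : ℝ} (hpos : ∀ i ∈ S, 0 < l i)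
    (hcov : ∀ t, u ≤ t → t < v → ∃ i ∈ S, x i ≤ t ∧ t < x i + l i) : v ≤ u + ∑ i ∈ S, l i := by
  have h1 : Set.Ico u v ⊆ ⋃ i ∈ S, Set.Ico (x i) (x i + l i) := by
    intro t ht
    obtain ⟨i, hi, h⟩ := hcov t ht.1 ht.2
    exact Set.mem_biUnion hi h
  have h2 := (MeasureTheory.measure_mono (μ := MeasureTheory.volume) h1).trans
    (MeasureTheory.measure_biUnion_finset_le S _)
  simp only [Real.volume_Ico, add_sub_cancel_left] at h2
  rw [← ENNReal.ofReal_sum_of_nonneg fun i hi => (hpos i hi).le,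
    ENNReal.ofReal_le_ofReal_iff (Finset.sum_nonneg fun i hi => (hpos i hi).le)] at h2
  linarith

/-- The packing problem for the intervals `[A i, Y i)`, `i < n`, and the target `[z, w)`. -/
def PackN (n τ : ℕ) (A Y : ℕ → ℝ) (z w : ℝ) : Prop :=
  ∃ (x : ℕ → ℝ) (M : Finset ℕ), M ⊆ Finset.range n ∧ M.card ≤ τ ∧
    (∀ i < n, i ∉ M → x i = A i) ∧
    (∀ i < n, ∀ j < n, i ≠ j → x i + (Y i - A i) ≤ x j ∨ x j + (Y j - A j) ≤ x i) ∧
    ∀ i < n, z ≤ x i ∧ x i + (Y i - A i) ≤ w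

/-- The segments `(start, length)` in `P` are lined up between `z` and `q`. -/
inductive LinedUp (z : ℝ) : Multiset (ℝ × ℝ) → ℝ → Prop
  | nil : LinedUp z 0 z
  | cons {P : Multiset (ℝ × ℝ)} {q s l : ℝ} : LinedUp z P q → q ≤ s → 0 < l →
      LinedUp z ((s, l) ::ₘ P) (s + l)

/-- The lengths in `c` are placed end to end, starting at the frontier. -/
theorem LinedUp.place {z q : ℝ} {P : Multiset (ℝ × ℝ)} (h : LinedUp z P q) (c : Multiset ℝ)
    (hc : ∀ ℓ ∈ c, 0 < ℓ) : ∃ P', P'.map Prod.snd = c ∧ LinedUp z (P + P') (q + c.sum) := by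
  induction c using Multiset.induction_on with
  | empty => exact ⟨0, by simp, by simpa using h⟩
  | cons ℓ c ih =>
    obtain ⟨P', h1, h2⟩ := ih fun x hx => hc x (Multiset.mem_cons_of_mem hx)
    refine ⟨(q + c.sum, ℓ) ::ₘ P', by simp [h1], ?_⟩
    rw [Multiset.add_cons, Multiset.sum_cons, add_comm ℓ, ← add_assoc]
    exact .cons h2 le_rfl (hc ℓ (Multiset.mem_cons_self _ _))

/-- Stated for every indexing `g` of the segments, since the owners of the anonymous segments are
chosen only later. The segment added last lies to the right of all others. -/
theorem LinedUp.order {z q : ℝ} {P : Multiset (ℝ × ℝ)} (h : LinedUp z P q) :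
    z ≤ q ∧ ∀ (S : Finset ℕ) (g : ℕ → ℝ × ℝ), S.val.map g = P →
      (∀ i ∈ S, z ≤ (g i).1 ∧ (g i).1 + (g i).2 ≤ q) ∧
      ∀ i ∈ S, ∀ j ∈ S, i ≠ j →
        (g i).1 + (g i).2 ≤ (g j).1 ∨ (g j).1 + (g j).2 ≤ (g i).1 := by
  induction h with
  | nil =>
    refine ⟨le_rfl, fun S g hS => ?_⟩
    rw [Multiset.map_eq_zero, Finset.val_eq_zero] at hS
    simp [hS]
  | @cons P q s l _ hqs hl ih =>
    refine ⟨by linarith [ih.1], fun S g hS => ?_⟩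
    have hmem : (s, l) ∈ S.val.map g := by rw [hS]; exact Multiset.mem_cons_self _ _
    obtain ⟨k, hk, hgk⟩ := Multiset.mem_map.1 hmem
    have hk' : k ∈ S := hk
    have hS' : (S.erase k).val.map g = P := by
      rw [← Finset.insert_erase hk', Finset.insert_val_of_notMem (Finset.notMem_erase k S),
        Multiset.map_cons, hgk, Multiset.cons_inj_right] at hS
      exact hS
    obtain ⟨h1, h2⟩ := ih.2 _ g hS'
    have h3 : ∀ i ∈ S, i ≠ k → z ≤ (g i).1 ∧ (g i).1 + (g i).2 ≤ q := fun i hi hne =>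
      h1 i (Finset.mem_erase.2 ⟨hne, hi⟩)
    refine ⟨fun i hi => ?_, fun i hi j hj hij => ?_⟩
    · by_cases hik : i = k
      · rw [hik, hgk]
        exact ⟨ih.1.trans hqs, le_rfl⟩
      · have := h3 i hi hik
        exact ⟨this.1, by linarith⟩
    · by_cases hik : i = k
      · have := h3 j hj (by rintro rfl; exact hij hik)
        right
        rw [hik, hgk]
        exact this.2.trans hqs
      · by_cases hjk : j = k
        · have := h3 i hi hik
          left
          rw [hjk, hgk]
          exact this.2.trans hqs
        · exact h2 i (Finset.mem_erase.2 ⟨hik, hi⟩) j (Finset.mem_erase.2 ⟨hjk, hj⟩) hij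

/-- Segments with the lengths of the intervals in `M` can be assigned to these intervals. -/
theorem exists_assign (M : Finset ℕ) (l : ℕ → ℝ) (P : Multiset (ℝ × ℝ))
    (h : P.map Prod.snd = M.val.map l) : ∃ x : ℕ → ℝ, M.val.map (fun i => (x i, l i)) = P := by
  induction M using Finset.induction_on generalizing P with
  | empty =>
    simp only [Finset.empty_val, Multiset.map_zero, Multiset.map_eq_zero] at h
    exact ⟨0, by simp [h]⟩
  | insert i M hi ih =>
    rw [Finset.insert_val_of_notMem hi, Multiset.map_cons] at h
    have hmem : l i ∈ P.map Prod.snd := by rw [h]; exact Multiset.mem_cons_self _ _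
    obtain ⟨⟨s, ℓ⟩, hp, hpl⟩ := Multiset.mem_map.1 hmem
    obtain rfl : ℓ = l i := hpl
    obtain ⟨P', rfl⟩ := Multiset.exists_cons_of_mem hp
    rw [Multiset.map_cons, Multiset.cons_inj_right] at h
    obtain ⟨x, hx⟩ := ih P' h
    refine ⟨Function.update x i s, ?_⟩
    rw [Finset.insert_val_of_notMem hi, Multiset.map_cons, Function.update_self, ← hx]
    congr 1
    refine Multiset.map_congr rfl fun j hj => ?_
    have : j ≠ i := by rintro rfl; exact hi hj
    rw [Function.update_of_ne this]

theorem map_val_sdiff_add {α : Type*} (S M : Finset ℕ) (h : M ⊆ S) (f : ℕ → α) :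
    (S \ M).val.map f + M.val.map f = S.val.map f := by
  rw [← Multiset.map_add, Finset.sdiff_val, Multiset.sub_add_cancel (Finset.val_le_iff.2 h)]

theorem map_val_union {α : Type*} {S T : Finset ℕ} (h : Disjoint S T) (f : ℕ → α) :
    (S ∪ T).val.map f = S.val.map f + T.val.map f := by
  rw [← Finset.disjUnion_eq_union _ _ h, ← Multiset.map_add]
  rfl

section Pack

variable {n τ : ℕ} {A Y : ℕ → ℝ} {z w : ℝ}

theorem Adm.pos {m : Multiset ℝ} (h : Adm n A Y m) (hlt : ∀ i < n, A i < Y i) {ℓ : ℝ}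
    (hℓ : ℓ ∈ m) : 0 < ℓ := by
  obtain ⟨j, hj, rfl⟩ := h ℓ hℓ
  linarith [hlt j hj]

/-- `M` collects the intervals whose lengths went into `a`. The kept intervals stand at their own
positions, while the placed lengths `b` are represented by segments `P` not yet assigned to
intervals. -/
theorem Reach.linedUp (hlt : ∀ i < n, A i < Y i) {i : ℕ} {a b : Multiset ℝ} {q : ℝ}
    (h : Reach n τ false A Y z i a b q) (hi : i ≤ n) : ∃ M ⊆ Finset.range i,
      M.val.map (fun j => Y j - A j) = a ∧ ∃ P : Multiset (ℝ × ℝ), P.map Prod.snd = b ∧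
      LinedUp z ((Finset.range i \ M).val.map (fun j => (A j, Y j - A j)) + P) q := by
  induction h with
  | start => exact ⟨∅, by simp, by simp, 0, by simp, by simpa using LinedUp.nil⟩
  | @keep i a b c q hr hc hz hq ih =>
    obtain ⟨M, hM, rfl, P, rfl, hP⟩ := ih (by omega)
    obtain ⟨P', rfl, hP'⟩ := hP.place c fun ℓ hℓ => hc.pos hlt hℓ
    have hiM : i ∉ M := fun h => absurd (Finset.mem_range.1 (hM h)) (lt_irrefl i)
    have hins : Finset.range (i + 1) \ M = insert i (Finset.range i \ M) := by
      rw [Finset.range_add_one, Finset.insert_sdiff_of_notMem _ hiM]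
    refine ⟨M, hM.trans (Finset.range_subset_range.2 (by omega)), rfl, P + P', by simp, ?_⟩
    rw [hins, Finset.insert_val_of_notMem (by simp), Multiset.map_cons, Multiset.cons_add,
      ← add_assoc]
    convert hP'.cons hq (sub_pos.2 (hlt i (by omega))) using 1
    ring
  | skip _ _ _ hm => cases hm
  | @move i a b c q hr hc hz hq ih =>
    obtain ⟨M, hM, rfl, P, rfl, hP⟩ := ih (by omega)
    obtain ⟨P', rfl, hP'⟩ := hP.place c fun ℓ hℓ => hc.pos hlt hℓ
    have hiM : i ∉ M := fun h => absurd (Finset.mem_range.1 (hM h)) (lt_irrefl i)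
    have hins : Finset.range (i + 1) \ insert i M = Finset.range i \ M := by
      ext j
      simp only [Finset.mem_sdiff, Finset.mem_range, Finset.mem_insert, not_or]
      constructor
      · rintro ⟨h1, h2, h3⟩; exact ⟨by omega, h3⟩
      · rintro ⟨h1, h3⟩; exact ⟨by omega, by omega, h3⟩
    refine ⟨insert i M, ?_, ?_, P + P', by simp, ?_⟩
    · rw [Finset.range_add_one]
      exact Finset.insert_subset_insert _ hM
    · rw [Finset.insert_val_of_notMem hiM, Multiset.map_cons]
    · rw [hins, ← add_assoc]
      exact hP'

/-- At the end `a = b + c`, so the anonymous segments have exactly the lengths of the intervals in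
`M` and can be assigned to them. -/
theorem Accept.packN (hlt : ∀ i < n, A i < Y i) (h : Accept n τ false A Y z w) :
    PackN n τ A Y z w := by
  obtain ⟨a, b, c, q, hr, hc, hz, rfl, hq⟩ := h
  have hcard := (hr.adm le_rfl).1.2
  obtain ⟨M, hM, ha, P, rfl, hP⟩ := hr.linedUp hlt le_rfl
  obtain ⟨P', rfl, hP'⟩ := hP.place c fun ℓ hℓ => hc.pos hlt hℓ
  obtain ⟨x', hx'⟩ := exists_assign M (fun j => Y j - A j) (P + P')
    (by rw [Multiset.map_add, ha])
  let x : ℕ → ℝ := fun i => if i ∈ M then x' i else A i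
  have hall : (Finset.range n).val.map (fun i => (x i, Y i - A i)) =
      (Finset.range n \ M).val.map (fun j => (A j, Y j - A j)) + P + P' := by
    rw [← map_val_sdiff_add _ M hM, add_assoc, ← hx']
    congr 1
    · refine Multiset.map_congr rfl fun j hj => ?_
      have : j ∉ M := (Finset.mem_sdiff.1 hj).2
      simp [x, this]
    · refine Multiset.map_congr rfl fun j hj => ?_
      have : j ∈ M := hj
      simp [x, this]
  obtain ⟨h1, h2⟩ := hP'.order.2 _ _ hall
  refine ⟨x, M, hM, ?_, fun i _ hi => by simp [x, hi], fun i hi j hj => ?_, fun i hi => ?_⟩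
  · rwa [← ha, Multiset.card_map] at hcard
  · exact h2 i (Finset.mem_range.2 hi) j (Finset.mem_range.2 hj)
  · obtain ⟨h3, h4⟩ := h1 i (Finset.mem_range.2 hi)
    exact ⟨h3, h4.trans hq⟩

theorem adm_map {S : Finset ℕ} (h : S ⊆ Finset.range n) :
    Adm n A Y (S.val.map fun j => Y j - A j) := by
  intro ℓ hℓ
  obtain ⟨j, hj, rfl⟩ := Multiset.mem_map.1 hℓ
  exact ⟨j, Finset.mem_range.1 (h hj), rfl⟩

theorem card_map_add_le {M U c : Finset ℕ} (f : ℕ → ℝ) (hU : U ⊆ M) (hc : c ⊆ M \ U)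
    (hM : M.card ≤ τ) :
    Multiset.card (U.val.map f) + Multiset.card (c.val.map f) ≤ τ := by
  rw [Multiset.card_map, Multiset.card_map]
  have hd : Disjoint U c := Finset.disjoint_left.2 fun j hj hj' =>
    (Finset.mem_sdiff.1 (hc hj')).2 hj
  have := Finset.card_le_card (Finset.union_subset hU (hc.trans Finset.sdiff_subset))
  rw [Finset.card_union_of_disjoint hd] at this
  exact this.trans hM

theorem filter_lt_succ_of_mem {M : Finset ℕ} {i : ℕ} (hi : i ∈ M) (f : ℕ → ℝ) :
    (M.filter (· < i + 1)).val.map f = f i ::ₘ (M.filter (· < i)).val.map f := by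
  have : M.filter (· < i + 1) = insert i (M.filter (· < i)) := by
    ext j
    simp only [Finset.mem_filter, Finset.mem_insert]
    constructor
    · rintro ⟨h1, h2⟩
      rcases Nat.lt_succ_iff_lt_or_eq.1 h2 with h | h
      · exact .inr ⟨h1, h⟩
      · exact .inl h
    · rintro (rfl | ⟨h1, h2⟩)
      · exact ⟨hi, by omega⟩
      · exact ⟨h1, by omega⟩
  rw [this, Finset.insert_val_of_notMem (by simp), Multiset.map_cons]

theorem filter_lt_succ_of_notMem {M : Finset ℕ} {i : ℕ} (hi : i ∉ M) :
    M.filter (· < i + 1) = M.filter (· < i) := by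
  ext j
  simp only [Finset.mem_filter]
  refine and_congr_right fun hj => ?_
  have : j ≠ i := by rintro rfl; exact hi hj
  omega

theorem card_filter_lt {M : Finset ℕ} {i : ℕ} (hi : i ∈ M) (f : ℕ → ℝ) (hM : M.card ≤ τ) :
    Multiset.card ((M.filter (· < i)).val.map f) + 1 ≤ τ := by
  have h1 := congrArg Multiset.card (filter_lt_succ_of_mem hi f)
  rw [Multiset.card_cons, Multiset.card_map] at h1
  rw [← h1]
  exact (Finset.card_filter_le _ _).trans hM

/-- Follow a given packing. Here `e` is the end of the last kept interval (initially `z`), and `U`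
is the set of moved intervals placed before it. When the next kept interval is reached, the moved
ones between `e` and `A i` are disjoint and hence fit end to end as well; those in `M \ U` all start
at or after `e`. -/
theorem PackN.accept (hlt : ∀ i < n, A i < Y i) (hmono : ∀ i j, i ≤ j → j < n → A i ≤ A j)
    (hzw : z ≤ w) (h : PackN n τ A Y z w) : Accept n τ false A Y z w := by
  obtain ⟨x, M, hM, hMτ, hkeep, hdis, hin⟩ := h
  have hMn : ∀ j ∈ M, j < n := fun j hj => Finset.mem_range.1 (hM hj)
  have key : ∀ i ≤ n, ∃ e q U, U ⊆ M ∧ q ≤ e ∧ z ≤ e ∧ e ≤ w ∧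
      Reach n τ false A Y z i ((M.filter (· < i)).val.map fun j => Y j - A j)
        (U.val.map fun j => Y j - A j) q ∧
      (∀ k, i ≤ k → k < n → k ∉ M → e ≤ A k) ∧ ∀ j ∈ M \ U, e ≤ x j := by
    intro i
    induction i with
    | zero =>
      refine fun _ => ⟨z, z, ∅, by simp, le_rfl, le_rfl, hzw, ?_, fun k _ hk hkM => ?_,
        fun j hj => (hin j (hMn j (Finset.mem_sdiff.1 hj).1)).1⟩
      · simpa using Reach.start
      · rw [← hkeep k hk hkM]
        exact (hin k hk).1
    | succ i ih =>
      intro hi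
      obtain ⟨e, q, U, hU, hqe, hze, hew, hr, hA, hx⟩ := ih (by omega)
      by_cases hiM : i ∈ M
      · refine ⟨e, q, U, hU, hqe, hze, hew, ?_, fun k hk => hA k (by omega), hx⟩
        rw [filter_lt_succ_of_mem hiM]
        -- Nothing is placed at a moved interval; placements are postponed to the next kept interval
        -- or to the end.
        have := Reach.move (c := 0) hr (by simp [Adm]) (by
            simpa using (Finset.card_le_card hU).trans hMτ) (card_filter_lt hiM _ hMτ)
        simpa using this
      · have hxi := hkeep i (by omega) hiM
        have hsep : ∀ j ∈ M, x j + (Y j - A j) ≤ A i ∨ Y i ≤ x j := by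
          intro j hj
          have hji : j ≠ i := by rintro rfl; exact hiM hj
          rcases hdis j (hMn j hj) i (by omega) hji with h | h
          · exact .inl (by rwa [hxi] at h)
          · right; rw [hxi] at h; linarith
        -- Starting before `A i` already means lying entirely before it, because these intervals are
        -- disjoint from the kept interval `i`.
        let c := (M \ U).filter fun j => x j < A i
        have hcM : c ⊆ M \ U := Finset.filter_subset _ _
        have hcn : ∀ j ∈ c, j ∈ M ∧ e ≤ x j ∧ x j + (Y j - A j) ≤ A i := by
          intro j hj
          obtain ⟨h1, h2⟩ := Finset.mem_filter.1 hj
          have h3 := (Finset.mem_sdiff.1 h1).1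
          refine ⟨h3, hx j h1, ?_⟩
          rcases hsep j h3 with h | h
          · exact h
          · linarith [hlt i (by omega)]
        have hsum := sum_len_le c x (fun j => Y j - A j) (hA i le_rfl (by omega) hiM)
          (fun j hj => sub_pos.2 (hlt j (hMn j (hcn j hj).1)))
          (fun j hj k hk => hdis j (hMn j (hcn j hj).1) k (hMn k (hcn k hk).1))
          fun j hj => (hcn j hj).2
        refine ⟨Y i, Y i, U ∪ c, Finset.union_subset hU (hcM.trans Finset.sdiff_subset), le_rfl,
          ?_, ?_, ?_, fun k hk hkn hkM => ?_, fun j hj => ?_⟩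
        · linarith [hA i le_rfl (by omega) hiM, hlt i (by omega)]
        · have := (hin i (by omega)).2
          rw [hxi] at this
          linarith
        · rw [filter_lt_succ_of_notMem hiM, map_val_union (Finset.disjoint_left.2
            fun j hj hj' => (Finset.mem_sdiff.1 (hcM hj')).2 hj)]
          refine .keep hr (adm_map (hcM.trans (Finset.sdiff_subset.trans hM)))
            (card_map_add_le _ hU hcM hMτ) ?_
          have : (c.val.map fun j => Y j - A j).sum = ∑ j ∈ c, (Y j - A j) := rfl
          linarith
        · have hxk := hkeep k hkn hkM
          rcases hdis i (by omega) k hkn (by omega) with h | h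
          · rw [hxi, hxk] at h; linarith
          · rw [hxi, hxk] at h
            linarith [hmono i k (by omega) hkn, hlt k hkn]
        · obtain ⟨h1, h2⟩ := Finset.mem_sdiff.1 hj
          rw [Finset.mem_union, not_or] at h2
          rcases hsep j h1 with h | h
          · refine absurd (Finset.mem_filter.2 ⟨Finset.mem_sdiff.2 ⟨h1, h2.1⟩, ?_⟩) h2.2
            linarith [hlt j (hMn j h1)]
          · exact h
  obtain ⟨e, q, U, hU, hqe, hze, hew, hr, hA, hx⟩ := key n le_rfl
  have hMM : ∀ j ∈ M \ U, j ∈ M := fun j hj => (Finset.mem_sdiff.1 hj).1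
  have hsum := sum_len_le (M \ U) x (fun j => Y j - A j) hew
    (fun j hj => sub_pos.2 (hlt j (hMn j (hMM j hj))))
    (fun j hj k hk => hdis j (hMn j (hMM j hj)) k (hMn k (hMM k hk)))
    fun j hj => ⟨hx j hj, (hin j (hMn j (hMM j hj))).2⟩
  refine ⟨_, _, (M \ U).val.map fun j => Y j - A j, q, hr,
    adm_map (Finset.sdiff_subset.trans hM), card_map_add_le _ hU subset_rfl hMτ, ?_, ?_⟩
  · rw [Finset.filter_true_of_mem hMn, add_comm, map_val_sdiff_add _ _ hU]
  · have : ((M \ U).val.map fun j => Y j - A j).sum = ∑ j ∈ M \ U, (Y j - A j) := rfl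
    linarith

theorem accept_iff_packN (hlt : ∀ i < n, A i < Y i) (hmono : ∀ i j, i ≤ j → j < n → A i ≤ A j)
    (hzw : z ≤ w) : Accept n τ false A Y z w ↔ PackN n τ A Y z w :=
  ⟨Accept.packN hlt, PackN.accept hlt hmono hzw⟩

end Pack

end MovingIntervals

namespace MovingIntervals

/-! ### Covering -/

/-- The covering problem for the intervals `[X i, E i)`, `i < n`, and the target `[z, w)`. -/
def CoverN (n τ : ℕ) (X E : ℕ → ℝ) (z w : ℝ) : Prop :=
  ∃ (x : ℕ → ℝ) (M : Finset ℕ), M ⊆ Finset.range n ∧ M.card ≤ τ ∧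
    (∀ i < n, i ∉ M → x i = X i) ∧
    ∀ t, z ≤ t → t < w → ∃ i < n, x i ≤ t ∧ t < x i + (E i - X i)

/-- In reflected coordinates the lengths `ℓ` are negative, so the segment `(s, ℓ)` stands for `[s, s
- ℓ)`. Placing `c` at the frontier extends the covered part from `-q` to `-(q + c.sum)`; signs are
irrelevant for this inclusion. -/
theorem exists_cover_segments (q : ℝ) (c : Multiset ℝ) : ∃ P : Multiset (ℝ × ℝ),
    P.map Prod.snd = c ∧ ∀ t, -q ≤ t → t < -(q + c.sum) → ∃ p ∈ P, p.1 ≤ t ∧ t < p.1 - p.2 := by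
  induction c using Multiset.induction_on with
  | empty => exact ⟨0, by simp, fun t h1 h2 => by simp at h2; linarith⟩
  | cons ℓ c ih =>
    obtain ⟨P, h1, h2⟩ := ih
    refine ⟨(-(q + c.sum), ℓ) ::ₘ P, by simp [h1], fun t h3 h4 => ?_⟩
    rw [Multiset.sum_cons] at h4
    by_cases ht : t < -(q + c.sum)
    · obtain ⟨p, hp, h⟩ := h2 t h3 ht
      exact ⟨p, Multiset.mem_cons_of_mem hp, h⟩
    · exact ⟨_, Multiset.mem_cons_self _ _, not_lt.1 ht, by simp only; linarith⟩

section Cover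

variable {n τ : ℕ} {A Y : ℕ → ℝ} {z w : ℝ}

/-- The part `[z, -q)` is covered by kept intervals and by segments with the lengths in `b`. The
condition for keeping interval `i` says that the coverage has reached its left endpoint `-A i`;
skipping uses only the segments. -/
theorem Reach.covers {i : ℕ} {a b : Multiset ℝ} {q : ℝ}
    (h : Reach n τ true A Y (-z) i a b q) : ∃ M ⊆ Finset.range i,
      M.val.map (fun j => Y j - A j) = a ∧ ∃ P : Multiset (ℝ × ℝ), P.map Prod.snd = b ∧
      ∀ t, z ≤ t → t < -q → (∃ k < i, k ∉ M ∧ -A k ≤ t ∧ t < -Y k) ∨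
        ∃ p ∈ P, p.1 ≤ t ∧ t < p.1 - p.2 := by
  induction h with
  | start =>
    refine ⟨∅, by simp, by simp, 0, by simp, fun t h1 h2 => ?_⟩
    rw [neg_neg] at h2
    linarith
  | @keep i a b c q hr hc hz hq ih =>
    obtain ⟨M, hM, rfl, P, rfl, hP⟩ := ih
    obtain ⟨P', rfl, hP'⟩ := exists_cover_segments q c
    have hiM : i ∉ M := fun h => absurd (Finset.mem_range.1 (hM h)) (lt_irrefl i)
    refine ⟨M, hM.trans (Finset.range_subset_range.2 (by omega)), rfl, P + P', by simp,
      fun t h1 h2 => ?_⟩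
    by_cases ht : t < -q
    · rcases hP t h1 ht with ⟨k, hk, h⟩ | ⟨p, hp, h⟩
      · exact .inl ⟨k, by omega, h⟩
      · exact .inr ⟨p, Multiset.mem_add.2 (.inl hp), h⟩
    · by_cases ht' : t < -A i
      · obtain ⟨p, hp, h⟩ := hP' t (not_lt.1 ht) (by linarith)
        exact .inr ⟨p, Multiset.mem_add.2 (.inr hp), h⟩
      · exact .inl ⟨i, by omega, hiM, not_lt.1 ht', h2⟩
  | @skip i a b c q hr hc hz hm ih =>
    obtain ⟨M, hM, rfl, P, rfl, hP⟩ := ih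
    obtain ⟨P', rfl, hP'⟩ := exists_cover_segments q c
    refine ⟨M, hM.trans (Finset.range_subset_range.2 (by omega)), rfl, P + P', by simp,
      fun t h1 h2 => ?_⟩
    by_cases ht : t < -q
    · rcases hP t h1 ht with ⟨k, hk, h⟩ | ⟨p, hp, h⟩
      · exact .inl ⟨k, by omega, h⟩
      · exact .inr ⟨p, Multiset.mem_add.2 (.inl hp), h⟩
    · obtain ⟨p, hp, h⟩ := hP' t (not_lt.1 ht) h2
      exact .inr ⟨p, Multiset.mem_add.2 (.inr hp), h⟩
  | @move i a b c q hr hc hz hq ih =>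
    obtain ⟨M, hM, rfl, P, rfl, hP⟩ := ih
    obtain ⟨P', rfl, hP'⟩ := exists_cover_segments q c
    have hiM : i ∉ M := fun h => absurd (Finset.mem_range.1 (hM h)) (lt_irrefl i)
    refine ⟨insert i M, ?_, ?_, P + P', by simp, fun t h1 h2 => ?_⟩
    · rw [Finset.range_add_one]
      exact Finset.insert_subset_insert _ hM
    · rw [Finset.insert_val_of_notMem hiM, Multiset.map_cons]
    · by_cases ht : t < -q
      · rcases hP t h1 ht with ⟨k, hk, hkM, h⟩ | ⟨p, hp, h⟩
        · refine .inl ⟨k, by omega, ?_, h⟩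
          rw [Finset.mem_insert, not_or]
          exact ⟨by omega, hkM⟩
        · exact .inr ⟨p, Multiset.mem_add.2 (.inl hp), h⟩
      · obtain ⟨p, hp, h⟩ := hP' t (not_lt.1 ht) h2
        exact .inr ⟨p, Multiset.mem_add.2 (.inr hp), h⟩

/-- As for packing, `a = b + c` allows the segments to be assigned to the moved intervals. -/
theorem Accept.coverN (h : Accept n τ true A Y (-z) (-w)) :
    CoverN n τ (fun i => -A i) (fun i => -Y i) z w := by
  obtain ⟨a, b, c, q, hr, hc, hz, rfl, hq⟩ := h
  have hcard := (hr.adm le_rfl).1.2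
  obtain ⟨M, hM, ha, P, rfl, hP⟩ := hr.covers
  obtain ⟨P', rfl, hP'⟩ := exists_cover_segments q c
  obtain ⟨x', hx'⟩ := exists_assign M (fun j => Y j - A j) (P + P')
    (by rw [Multiset.map_add, ha])
  refine ⟨fun i => if i ∈ M then x' i else -A i, M, hM, ?_, fun i _ hi => by simp [hi],
    fun t h1 h2 => ?_⟩
  · rwa [← ha, Multiset.card_map] at hcard
  · have hseg : ∀ p ∈ P + P', p.1 ≤ t ∧ t < p.1 - p.2 → ∃ i < n,
        (if i ∈ M then x' i else -A i) ≤ t ∧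
          t < (if i ∈ M then x' i else -A i) + (-Y i - -A i) := by
      intro p hp h
      rw [← hx'] at hp
      obtain ⟨i, hi, rfl⟩ := Multiset.mem_map.1 hp
      have hi' : i ∈ M := hi
      refine ⟨i, Finset.mem_range.1 (hM hi'), ?_⟩
      simp only [hi', if_true]
      exact ⟨h.1, by linarith [h.2]⟩
    by_cases ht : t < -q
    · rcases hP t h1 ht with ⟨k, hk, hkM, h⟩ | ⟨p, hp, h⟩
      · refine ⟨k, hk, ?_⟩
        simp only [hkM, if_false]
        exact ⟨h.1, by linarith [h.2]⟩
      · exact hseg p (Multiset.mem_add.2 (.inl hp)) h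
    · obtain ⟨p, hp, h⟩ := hP' t (not_lt.1 ht) (by linarith)
      exact hseg p (Multiset.mem_add.2 (.inr hp)) h

/-- Follow a given covering. The invariant says that every kept interval already processed and every
moved interval already used ends, when cut off at `w`, no later than the covered end `-q`. Points
beyond `-q` must thus be covered by other intervals. Before kept interval `i` these can only be
unused moved ones starting to the left of it, so their lengths suffice to fill the gap. -/
theorem CoverN.accept (hlt : ∀ i < n, Y i < A i) (hmono : ∀ i j, i ≤ j → j < n → A j ≤ A i)
    (h : CoverN n τ (fun i => -A i) (fun i => -Y i) z w) : Accept n τ true A Y (-z) (-w) := by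
  obtain ⟨x, M, hM, hMτ, hkeep, hcov⟩ := h
  simp only [sub_neg_eq_add] at hcov
  have hMn : ∀ j ∈ M, j < n := fun j hj => Finset.mem_range.1 (hM hj)
  have hsumneg : ∀ c : Finset ℕ, (c.val.map fun j => Y j - A j).sum = -∑ j ∈ c, (-Y j + A j) := by
    intro c
    rw [← Finset.sum_neg_distrib]
    change ∑ j ∈ c, (Y j - A j) = _
    exact Finset.sum_congr rfl fun j _ => by ring
  have key : ∀ i ≤ n, ∃ q U, U ⊆ M ∧ q ≤ -z ∧
      Reach n τ true A Y (-z) i ((M.filter (· < i)).val.map fun j => Y j - A j)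
        (U.val.map fun j => Y j - A j) q ∧
      (∀ k < i, k ∉ M → min w (-Y k) ≤ -q) ∧ ∀ j ∈ U, min w (x j + (-Y j + A j)) ≤ -q := by
    intro i
    induction i with
    | zero =>
      refine fun _ => ⟨-z, ∅, by simp, le_rfl, ?_, by simp, by simp⟩
      simpa using Reach.start
    | succ i ih =>
      intro hi
      obtain ⟨q, U, hU, hqz, hr, hA, hx⟩ := ih (by omega)
      by_cases hiM : i ∈ M
      · refine ⟨q, U, hU, hqz, ?_, fun k hk hkM => hA k ?_ hkM, hx⟩
        · rw [filter_lt_succ_of_mem hiM]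
          have := Reach.move (c := 0) hr (by simp [Adm]) (by
            simpa using (Finset.card_le_card hU).trans hMτ) (card_filter_lt hiM _ hMτ)
          simpa using this
        · have : k ≠ i := by rintro rfl; exact hkM hiM
          omega
      · let c := (M \ U).filter fun j => x j < -A i
        have hcM : c ⊆ M \ U := Finset.filter_subset _ _
        have hcpos : ∀ j ∈ c, 0 < -Y j + A j := fun j hj => by
          have := hlt j (hMn j (Finset.mem_sdiff.1 (hcM hj)).1)
          linarith
        -- points between the frontier and the interval are covered by `c`
        have hpt : ∀ t, -q ≤ t → t < w → t < -A i → ∃ j ∈ c, x j ≤ t ∧ t < x j + (-Y j + A j) := by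
          intro t h1 h2 h3
          obtain ⟨j, hj, h4, h5⟩ := hcov t (by linarith) h2
          have hjM : j ∈ M := by
            by_contra hjM
            rw [hkeep j hj hjM] at h4 h5
            rcases Nat.lt_or_ge j i with hji | hji
            · have := hA j hji hjM
              rcases min_le_iff.1 this with h | h <;> linarith
            · linarith [hmono i j hji hj]
          have hjU : j ∉ U := fun hjU => by
            rcases min_le_iff.1 (hx j hjU) with h | h <;> linarith
          exact ⟨j, Finset.mem_filter.2 ⟨Finset.mem_sdiff.2 ⟨hjM, hjU⟩, by linarith⟩, h4, h5⟩
        have hnew := hsumneg c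
        -- By subadditivity of length, placing `c` end to end covers at least as far as `c` did in
        -- the given solution.
        have hreach : min w (-A i) ≤ -q + ∑ j ∈ c, (-Y j + A j) :=
          le_sum_len c x (fun j => -Y j + A j) hcpos fun t h1 h2 =>
            hpt t h1 (lt_of_lt_of_le h2 (min_le_left _ _)) (lt_of_lt_of_le h2 (min_le_right _ _))
        have hsumnn : 0 ≤ ∑ j ∈ c, (-Y j + A j) := Finset.sum_nonneg fun j hj => (hcpos j hj).le
        -- An interval of `c` may reach beyond the left endpoint of interval `i`. From its start on
        -- it covers its part itself, and earlier points are covered by `c`; so the new frontier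
        -- passes its end, too.
        have hends : ∀ j ∈ U ∪ c, min w (x j + (-Y j + A j)) ≤
            -(q + (c.val.map fun j => Y j - A j).sum) := by
          intro j hj
          rw [hnew]
          rcases Finset.mem_union.1 hj with hj | hj
          · linarith [hx j hj]
          · have := le_sum_len c x (fun j => -Y j + A j) hcpos
              (u := -q) (v := min w (x j + (-Y j + A j))) fun t h1 h2 => by
                by_cases ht : x j ≤ t
                · exact ⟨j, hj, ht, lt_of_lt_of_le h2 (min_le_right _ _)⟩
                · exact hpt t h1 (lt_of_lt_of_le h2 (min_le_left _ _))
                    ((not_le.1 ht).trans (Finset.mem_filter.1 hj).2)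
            linarith
        have hadm : Adm n A Y (c.val.map fun j => Y j - A j) :=
          adm_map (hcM.trans (Finset.sdiff_subset.trans hM))
        have hcard := card_map_add_le (τ := τ) (fun j => Y j - A j) hU hcM hMτ
        have hun : (U ∪ c).val.map (fun j => Y j - A j) =
            U.val.map (fun j => Y j - A j) + c.val.map (fun j => Y j - A j) :=
          map_val_union (Finset.disjoint_left.2
            fun j hj hj' => (Finset.mem_sdiff.1 (hcM hj')).2 hj) _
        have hskip := Reach.skip (c := c.val.map fun j => Y j - A j) hr hadm hcard rfl
        rw [← hun] at hskip
        set q' := q + (c.val.map fun j => Y j - A j).sum with hq'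
        have hUc := Finset.union_subset hU (hcM.trans Finset.sdiff_subset)
        -- If the coverage is already past interval `i` or past the target, the interval is skipped,
        -- since keeping it could move the frontier back.
        by_cases hback : -Y i ≤ -q' ∨ w ≤ -q'
        · refine ⟨q', U ∪ c, hUc, by linarith, ?_, fun k hk hkM => ?_, hends⟩
          · rwa [filter_lt_succ_of_notMem hiM]
          · rcases Nat.lt_succ_iff_lt_or_eq.1 hk with hk | rfl
            · linarith [hA k hk hkM]
            · exact min_le_iff.2 hback.symm
        · rw [not_or, not_le, not_le] at hback
          have hle : q' ≤ A i := by
            rcases min_le_iff.1 hreach with h | h <;> linarith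
          have hk := Reach.keep (c := c.val.map fun j => Y j - A j) hr hadm hcard hle
          rw [← hun] at hk
          refine ⟨Y i, U ∪ c, hUc, by linarith, ?_, fun k hk hkM => ?_, fun j hj => ?_⟩
          · rwa [filter_lt_succ_of_notMem hiM]
          · rcases Nat.lt_succ_iff_lt_or_eq.1 hk with hk | rfl
            · linarith [hA k hk hkM]
            · exact min_le_right _ _
          · linarith [hends j hj]
  obtain ⟨q, U, hU, hqz, hr, hA, hx⟩ := key n le_rfl
  have hcpos : ∀ j ∈ M \ U, 0 < -Y j + A j := fun j hj => by
    have := hlt j (hMn j (Finset.mem_sdiff.1 hj).1)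
    linarith
  have hsum := le_sum_len (M \ U) x (fun j => -Y j + A j) hcpos (u := -q) (v := w)
    fun t h1 h2 => by
      obtain ⟨j, hj, h4, h5⟩ := hcov t (by linarith) h2
      have hjM : j ∈ M := by
        by_contra hjM
        rw [hkeep j hj hjM] at h4 h5
        rcases min_le_iff.1 (hA j hj hjM) with h | h <;> linarith
      have hjU : j ∉ U := fun hjU => by
        rcases min_le_iff.1 (hx j hjU) with h | h <;> linarith
      exact ⟨j, Finset.mem_sdiff.2 ⟨hjM, hjU⟩, h4, h5⟩
  refine ⟨_, _, (M \ U).val.map fun j => Y j - A j, q, hr,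
    adm_map (Finset.sdiff_subset.trans hM), card_map_add_le _ hU subset_rfl hMτ, ?_, ?_⟩
  · rw [Finset.filter_true_of_mem hMn, add_comm, map_val_sdiff_add _ _ hU]
  · rw [hsumneg]
    linarith

end Cover

/-! ### Joining -/

section Join

variable {n τ : ℕ} {A Y : ℕ → ℝ} {z : ℝ}

/-- If the intervals can be joined at `z`, then either they can be joined anywhere, or `z` is
determined by one of the first `τ + 1` intervals and the lengths of the intervals before it. -/
theorem PackN.candidate (hlt : ∀ i < n, A i < Y i) (hmono : ∀ i j, i ≤ j → j < n → A i ≤ A j)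
    (h : PackN n τ A Y z (z + ∑ i ∈ Finset.range n, (Y i - A i))) :
    (∀ z', PackN n τ A Y z' (z' + ∑ i ∈ Finset.range n, (Y i - A i))) ∨
      ∃ j < n, j ≤ τ ∧ ∃ c, Adm n A Y c ∧ Multiset.card c ≤ τ ∧ z = A j - c.sum := by
  obtain ⟨x, M, hM, hMτ, hkeep, hdis, hin⟩ := h
  -- Without a kept interval the whole arrangement can be translated to any start.
  by_cases hall : ∀ i < n, i ∈ M
  · left
    intro z'
    refine ⟨fun i => x i + (z' - z), M, hM, hMτ, fun i hi hiM => absurd (hall i hi) hiM,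
      fun i hi j hj hij => ?_, fun i hi => ?_⟩
    · rcases hdis i hi j hj hij with h | h
      · left; linarith
      · right; linarith
    · obtain ⟨h1, h2⟩ := hin i hi
      exact ⟨by linarith, by linarith⟩
  · right
    push Not at hall
    -- The first kept interval: all earlier ones are moved, whence `j ≤ τ`.
    obtain ⟨j, ⟨hjn, hjM⟩, hmin⟩ : ∃ j, (j < n ∧ j ∉ M) ∧ ∀ k < j, ¬ (k < n ∧ k ∉ M) :=
      ⟨Nat.find hall, Nat.find_spec hall, fun k hk => Nat.find_min hall hk⟩
    have hlow : ∀ k < j, k ∈ M := fun k hk => by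
      by_contra hkM
      exact hmin k hk ⟨by omega, hkM⟩
    have hjτ : j ≤ τ := by
      have : Finset.range j ⊆ M := fun k hk => hlow k (Finset.mem_range.1 hk)
      have := Finset.card_le_card this
      rw [Finset.card_range] at this
      omega
    have hxj := hkeep j hjn hjM
    let U := (Finset.range n).filter fun i => x i < A j
    have hUn : ∀ i ∈ U, i < n := fun i hi => Finset.mem_range.1 (Finset.mem_filter.1 hi).1
    have hUM : U ⊆ M := by
      intro i hi
      by_contra hiM
      have h1 := (Finset.mem_filter.1 hi).2
      rw [hkeep i (hUn i hi) hiM] at h1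
      rcases Nat.lt_or_ge i j with h | h
      · exact hiM (hlow i h)
      · linarith [hmono j i h (hUn i hi)]
    -- The intervals in `U` fit into `[z, A j)` and the others into the rest of the target. Both
    -- bounds are attained because the lengths add up to the length of the target; in particular `z`
    -- is `A j` minus the lengths of `U`.
    have h1 : ∑ i ∈ U, (Y i - A i) ≤ A j - z := by
      refine sum_len_le U x _ (by rw [← hxj]; exact (hin j hjn).1)
        (fun i hi => sub_pos.2 (hlt i (hUn i hi)))
        (fun i hi k hk => hdis i (hUn i hi) k (hUn k hk)) fun i hi => ⟨(hin i (hUn i hi)).1, ?_⟩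
      have hxi : x i < A j := (Finset.mem_filter.1 hi).2
      have hij : i ≠ j := by rintro rfl; rw [hxj] at hxi; exact lt_irrefl _ hxi
      rcases hdis i (hUn i hi) j hjn hij with h | h
      · rwa [hxj] at h
      · rw [hxj] at h; linarith [hlt j hjn]
    have hW : ∀ i ∈ (Finset.range n).filter (fun i => ¬ x i < A j), i < n ∧ A j ≤ x i :=
      fun i hi => ⟨Finset.mem_range.1 (Finset.mem_filter.1 hi).1,
        not_lt.1 (Finset.mem_filter.1 hi).2⟩
    have h2 : ∑ i ∈ (Finset.range n).filter (fun i => ¬ x i < A j), (Y i - A i) ≤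
        (z + ∑ i ∈ Finset.range n, (Y i - A i)) - A j := by
      refine sum_len_le _ x _ ?_ (fun i hi => sub_pos.2 (hlt i (hW i hi).1))
        (fun i hi k hk => hdis i (hW i hi).1 k (hW k hk).1)
        fun i hi => ⟨(hW i hi).2, (hin i (hW i hi).1).2⟩
      have := (hin j hjn).2
      rw [hxj] at this
      linarith [hlt j hjn]
    have h3 := Finset.sum_filter_add_sum_filter_not (Finset.range n) (fun i => x i < A j)
      (fun i => Y i - A i)
    have h4 : (U.val.map fun i => Y i - A i).sum = ∑ i ∈ U, (Y i - A i) := rfl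
    have h5 : ∑ i ∈ U, (Y i - A i) =
      ∑ i ∈ (Finset.range n).filter (fun i => x i < A j), (Y i - A i) := rfl
    refine ⟨j, hjn, hjτ, U.val.map fun i => Y i - A i, adm_map (hUM.trans hM), ?_, by linarith⟩
    rw [Multiset.card_map]
    exact (Finset.card_le_card hUM).trans hMτ

end Join

end MovingIntervals

namespace MovingIntervals

/-! ### From families to sequences -/

theorem Ico_disjoint_iff {a b l m : ℝ} (hl : 0 < l) (hm : 0 < m) :
    Disjoint (Set.Ico a (a + l)) (Set.Ico b (b + m)) ↔ a + l ≤ b ∨ b + m ≤ a := by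
  rw [Set.Ico_disjoint_Ico, min_le_iff, le_max_iff, le_max_iff]
  constructor
  · rintro ((h | h) | (h | h))
    · linarith
    · exact .inl h
    · exact .inr h
    · linarith
  · rintro (h | h)
    · exact .inl (.inr h)
    · exact .inr (.inl h)

theorem Ico_subset_iff {a l z w : ℝ} (hl : 0 < l) :
    Set.Ico a (a + l) ⊆ Set.Ico z w ↔ z ≤ a ∧ a + l ≤ w :=
  Set.Ico_subset_Ico_iff (by linarith)

namespace Family

variable (F : Family)

theorem len_pos (i : Fin F.n) : 0 < F.len i := sub_pos.2 (F.left_lt_right i)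

theorem totalLen_pos : 0 < F.totalLen := by
  have := F.n_pos
  exact Finset.sum_pos (fun i _ => F.len_pos i) ⟨⟨0, this⟩, Finset.mem_univ _⟩

/-- The packing problem for the target `[z, w)`. -/
def PackInto (z w : ℝ) : Prop :=
  ∃ x, F.IsMove x ∧ Pairwise (fun i j => Disjoint (F.placed x i) (F.placed x j)) ∧
    ∀ i, F.placed x i ⊆ Set.Ico z w

/-- Disjoint intervals are joined if and only if they fit into an interval of their total
length. -/
theorem joinedAt_iff (x : Fin F.n → ℝ) (z : ℝ) : F.JoinedAt x z ↔
    Pairwise (fun i j => Disjoint (F.placed x i) (F.placed x j)) ∧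
      ∀ i, F.placed x i ⊆ Set.Ico z (z + F.totalLen) := by
  refine and_congr_right fun hdis => ⟨fun h i => ?_, fun h => ?_⟩
  · rw [← h]
    exact Set.subset_iUnion _ i
  · refine subset_antisymm (Set.iUnion_subset h) fun t ht => ?_
    by_contra hcon
    rw [Set.mem_iUnion, not_exists] at hcon
    have hin : ∀ i, z ≤ x i ∧ x i + F.len i ≤ z + F.totalLen := fun i =>
      (Ico_subset_iff (F.len_pos i)).1 (h i)
    have hdis' : ∀ i j, i ≠ j → x i + F.len i ≤ x j ∨ x j + F.len j ≤ x i := fun i j hij =>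
      (Ico_disjoint_iff (F.len_pos i) (F.len_pos j)).1 (hdis hij)
    have hout : ∀ i, ¬ x i ≤ t → t < x i := fun i hi => not_le.1 hi
    -- An uncovered point `t` separates the intervals: those starting at or before `t` also end
    -- there or earlier.
    have h1 : ∑ i ∈ Finset.univ.filter (fun i => x i ≤ t), F.len i ≤ t - z := by
      refine sum_len_le _ x _ ht.1 (fun i _ => F.len_pos i) (fun i _ j _ => hdis' i j)
        fun i hi => ⟨(hin i).1, ?_⟩
      by_contra hlt
      exact hcon i ⟨(Finset.mem_filter.1 hi).2, not_le.1 hlt⟩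
    -- This bound is strict because the leftmost of these intervals starts strictly after `t`, or,
    -- if there is none, because `t` lies before the right end. The lengths then sum to less than
    -- their total.
    have h2 : ∑ i ∈ Finset.univ.filter (fun i => ¬ x i ≤ t), F.len i < (z + F.totalLen) - t := by
      rcases (Finset.univ.filter (fun i => ¬ x i ≤ t)).eq_empty_or_nonempty with he | hne
      · rw [he, Finset.sum_empty]
        linarith [ht.2]
      · obtain ⟨k, hk, hmin⟩ := Finset.exists_min_image _ x hne
        have hk' : t < x k := hout k (Finset.mem_filter.1 hk).2
        have := sum_len_le (Finset.univ.filter (fun i => ¬ x i ≤ t)) x F.len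
          (u := x k) (v := z + F.totalLen) (by linarith [(hin k).2, F.len_pos k])
          (fun i _ => F.len_pos i) (fun i _ j _ => hdis' i j)
          fun i hi => ⟨hmin i hi, (hin i).2⟩
        linarith
    have h3 := Finset.sum_filter_add_sum_filter_not Finset.univ (fun i => x i ≤ t) F.len
    have h4 : F.totalLen = ∑ i, F.len i := rfl
    linarith

theorem exists_joinedAt_iff (z : ℝ) :
    (∃ x, F.IsMove x ∧ F.JoinedAt x z) ↔ F.PackInto z (z + F.totalLen) := by
  simp only [F.joinedAt_iff, PackInto]

end Family

theorem join_iff (F : Family) : Join F ↔ ∃ z, F.PackInto z (z + F.totalLen) := by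
  simp only [← F.exists_joinedAt_iff]
  exact exists_comm

theorem pack_iff (F : TargetFamily) : Pack F ↔ F.PackInto F.bLeft F.bRight := Iff.rfl

theorem jPack_iff (F : TargetFamily) : JPack F ↔ ∃ z, (F.bLeft ≤ z ∧ z + F.totalLen ≤ F.bRight) ∧
    F.PackInto z (z + F.totalLen) := by
  simp only [← F.exists_joinedAt_iff, JPack, TargetFamily.B, Ico_subset_iff F.totalLen_pos]
  constructor
  · rintro ⟨x, z, h1, h2, h3⟩
    exact ⟨z, h3, x, h1, h2⟩
  · rintro ⟨z, h3, x, h1, h2⟩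
    exact ⟨x, z, h1, h2, h3⟩

theorem jCover_iff (F : TargetFamily) : JCover F ↔
    ∃ z, (z ≤ F.bLeft ∧ F.bRight ≤ z + F.totalLen) ∧ F.PackInto z (z + F.totalLen) := by
  simp only [← F.exists_joinedAt_iff, JCover, TargetFamily.B,
    Set.Ico_subset_Ico_iff F.bLeft_lt_bRight]
  constructor
  · rintro ⟨x, z, h1, h2, h3⟩
    exact ⟨z, h3, x, h1, h2⟩
  · rintro ⟨z, h3, x, h1, h2⟩
    exact ⟨x, z, h1, h2, h3⟩

theorem tile_iff (F : TargetFamily) : Tile F ↔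
    F.bLeft + F.totalLen = F.bRight ∧ F.PackInto F.bLeft F.bRight := by
  constructor
  · rintro ⟨x, z, h1, h2, h3⟩
    have hL := F.totalLen_pos
    have hB := F.bLeft_lt_bRight
    have e1 := (Ico_subset_iff hL).1 (show Set.Ico z (z + F.totalLen) ⊆ _ from h3.le)
    have e2 := (Set.Ico_subset_Ico_iff hB).1 (show Set.Ico F.bLeft F.bRight ⊆ _ from h3.ge)
    have hz : z = F.bLeft := le_antisymm e2.1 e1.1
    have hw : F.bLeft + F.totalLen = F.bRight := by rw [← hz]; exact le_antisymm e1.2 e2.2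
    refine ⟨hw, ?_⟩
    rw [← hw, ← F.exists_joinedAt_iff, ← hz]
    exact ⟨x, h1, h2⟩
  · rintro ⟨hw, h⟩
    rw [← hw, ← F.exists_joinedAt_iff] at h
    obtain ⟨x, h1, h2⟩ := h
    exact ⟨x, _, h1, h2, by rw [hw]; rfl⟩

/-- The intervals of `F` in the order `e`. -/
structure Lists (F : Family) (e : Fin F.n ≃ Fin F.n) (X E : ℕ → ℝ) : Prop where
  left : ∀ o (h : o < F.n), X o = F.left (e ⟨o, h⟩)
  right : ∀ o (h : o < F.n), E o = F.right (e ⟨o, h⟩)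

/-- Reindexes along the sorting order and replaces exactly `τ` moved intervals by at most `τ`, which
is equivalent because moves of distance zero are allowed and `τ ≤ n`. -/
theorem exists_isMove_iff (F : Family) (e : Fin F.n ≃ Fin F.n) (Φ : (Fin F.n → ℝ) → Prop) :
    (∃ x, F.IsMove x ∧ Φ x) ↔ ∃ (x : ℕ → ℝ) (M : Finset ℕ), M ⊆ Finset.range F.n ∧ M.card ≤ F.τ ∧
      (∀ o (h : o < F.n), o ∉ M → x o = F.left (e ⟨o, h⟩)) ∧ Φ (fun i => x (e.symm i)) := by
  constructor
  · rintro ⟨x, ⟨M, hM, hx⟩, hΦ⟩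
    refine ⟨fun o => if h : o < F.n then x (e ⟨o, h⟩) else 0, M.image fun i => (e.symm i).val,
      fun o ho => ?_, Finset.card_image_le.trans hM.le, fun o h ho => ?_, ?_⟩
    · obtain ⟨i, -, rfl⟩ := Finset.mem_image.1 ho
      exact Finset.mem_range.2 (e.symm i).2
    · simp only [h, dif_pos]
      refine hx _ fun hmem => ho (Finset.mem_image.2 ⟨_, hmem, by simp⟩)
    · convert hΦ using 1
      ext i
      simp
  · rintro ⟨x, M, hM, hτ, hx, hΦ⟩
    have hcard : (Finset.univ.filter fun i : Fin F.n => (e.symm i).val ∈ M).card ≤ F.τ := by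
      refine (Finset.card_le_card_of_injOn (fun i => (e.symm i).val) (fun i hi => ?_)
        fun i _ j _ hij => ?_).trans hτ
      · simpa using hi
      · exact e.symm.injective (Fin.ext hij)
    -- The additional intervals are moved by distance zero.
    obtain ⟨M', hsub, hM'⟩ := Finset.exists_superset_card_eq hcard
      (by rw [Fintype.card_fin]; exact F.τ_le)
    refine ⟨fun i => x (e.symm i), ⟨M', hM', fun i hi => ?_⟩, hΦ⟩
    have : (e.symm i).val ∉ M := fun h => hi (hsub (by simpa using h))
    simp only [hx _ (e.symm i).2 this]
    simp

theorem Lists.packInto_iff {F : Family} {e : Fin F.n ≃ Fin F.n} {A Y : ℕ → ℝ} (h : Lists F e A Y)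
    (z w : ℝ) : F.PackInto z w ↔ PackN F.n F.τ A Y z w := by
  have hlen : ∀ o (ho : o < F.n), Y o - A o = F.len (e ⟨o, ho⟩) := fun o ho => by
    rw [h.left o ho, h.right o ho]; rfl
  rw [Family.PackInto, exists_isMove_iff F e]
  refine exists_congr fun x => exists_congr fun M => and_congr_right fun _ =>
    and_congr_right fun _ => and_congr ?_ (and_congr ?_ ?_)
  · exact forall_congr' fun o => forall_congr' fun ho => by rw [h.left o ho]
  · constructor
    · intro hd i hi j hj hij
      have hne : e ⟨i, hi⟩ ≠ e ⟨j, hj⟩ := fun he => hij (Fin.ext_iff.1 (e.injective he))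
      have := (Ico_disjoint_iff (F.len_pos _) (F.len_pos _)).1 (hd hne)
      simpa [hlen i hi, hlen j hj] using this
    · intro hd i j hij
      refine (Ico_disjoint_iff (F.len_pos _) (F.len_pos _)).2 ?_
      have := hd (e.symm i) (e.symm i).2 (e.symm j) (e.symm j).2
        (fun he => hij (e.symm.injective (Fin.ext he)))
      simpa [hlen _ (e.symm i).2, hlen _ (e.symm j).2] using this
  · constructor
    · intro hd o ho
      have := (Ico_subset_iff (F.len_pos _)).1 (hd (e ⟨o, ho⟩))
      simpa [hlen o ho] using this
    · intro hd i
      refine (Ico_subset_iff (F.len_pos _)).2 ?_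
      simpa [hlen _ (e.symm i).2] using hd (e.symm i) (e.symm i).2

theorem Lists.cover_iff {F : TargetFamily} {e : Fin F.n ≃ Fin F.n} {X E : ℕ → ℝ}
    (h : Lists F.toFamily e X E) : Cover F ↔ CoverN F.n F.τ X E F.bLeft F.bRight := by
  have hlen : ∀ o (ho : o < F.n), E o - X o = F.len (e ⟨o, ho⟩) := fun o ho => by
    rw [h.left o ho, h.right o ho]; rfl
  rw [Cover, exists_isMove_iff F.toFamily e]
  refine exists_congr fun x => exists_congr fun M => and_congr_right fun _ =>
    and_congr_right fun _ => and_congr ?_ ?_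
  · exact forall_congr' fun o => forall_congr' fun ho => by rw [h.left o ho]
  · constructor
    · intro hc t h1 h2
      obtain ⟨i, hi⟩ := Set.mem_iUnion.1 (hc ⟨h1, h2⟩)
      refine ⟨e.symm i, (e.symm i).2, hi.1, ?_⟩
      rw [hlen _ (e.symm i).2]
      simpa using hi.2
    · rintro hc t ⟨h1, h2⟩
      obtain ⟨o, ho, h3, h4⟩ := hc t h1 h2
      refine Set.mem_iUnion.2 ⟨e ⟨o, ho⟩, ?_⟩
      rw [hlen o ho] at h4
      simpa [Family.placed] using ⟨h3, h4⟩

theorem Lists.lt {F : Family} {e : Fin F.n ≃ Fin F.n} {A Y : ℕ → ℝ} (h : Lists F e A Y) :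
    ∀ i < F.n, A i < Y i := fun i hi => by
  rw [h.left i hi, h.right i hi]; exact F.left_lt_right _

theorem Lists.sum_eq {F : Family} {e : Fin F.n ≃ Fin F.n} {A Y : ℕ → ℝ} (h : Lists F e A Y) :
    ∑ i ∈ Finset.range F.n, (Y i - A i) = F.totalLen := by
  rw [Finset.sum_range, Family.totalLen, ← e.sum_comp F.len]
  refine Finset.sum_congr rfl fun i _ => ?_
  rw [h.left i i.2, h.right i i.2]
  rfl

theorem Lists.image_eq {F : Family} {e : Fin F.n ≃ Fin F.n} {A Y : ℕ → ℝ} (h : Lists F e A Y) :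
    (Finset.range F.n).image (fun i => Y i - A i) = Finset.univ.image F.len := by
  ext ℓ
  simp only [Finset.mem_image, Finset.mem_range, Finset.mem_univ, true_and]
  constructor
  · rintro ⟨i, hi, rfl⟩
    exact ⟨e ⟨i, hi⟩, by rw [h.left i hi, h.right i hi]; rfl⟩
  · rintro ⟨i, rfl⟩
    refine ⟨e.symm i, (e.symm i).2, ?_⟩
    rw [h.left _ (e.symm i).2, h.right _ (e.symm i).2]
    simp [Family.len]

end MovingIntervals

namespace RealRAM

open MovingIntervals

/-! ### The complete programs -/

/-- Sort, find the distinct lengths, list the multisets. -/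
def prepare (neg : Bool) : Cmd := .seq (sort neg) (.seq findLens listMultisets)

/-- Run the dynamic program if the condition `side` is satisfied. -/
def attempt (mode : Bool) (side : BExp) : Cmd := .branch side (dynProg mode) .skip

/-- Try all start points that are determined by one of the first `τ + 1` intervals and the lengths
of the intervals before it. -/
def candidates (side : BExp) : Cmd :=
  .seq (.setNat 16 (.const 0))
    (.loop (.and (.natLe (.add (.reg 16) (.const 1)) (.reg 0)) (.natLe (.reg 16) (.reg 1)))
      (.seq (forLoop 17 3 (.seq (.seq (.setReal 3 (.sub (.read 2 (.reg 16)) (.read 5 (.reg 17))))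
          (.setReal 4 (.add (.reg 3) (.reg 5)))) (attempt false side)))
        (.setNat 16 (.add (.reg 16) (.const 1)))))

/-- Tests write nothing. Rewriting with this removes the variable `side`, so that the remaining list
is closed and accessible to `decide`. -/
theorem natRegs_attempt (mode : Bool) (side : BExp) :
    (attempt mode side).natRegs = (dynProg mode).natRegs ++ [] := rfl

/-- The decision procedure with start `z₀`, target `w₀` and a further search `more`. -/
def decider (mode : Bool) (z₀ w₀ : RExp) (side : BExp) (more : Cmd) : Cmd :=
  .seq (prepare mode) (.seq (.seq (.setReal 3 z₀) (.setReal 4 w₀))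
    (.seq (attempt mode side) (.seq more (.setNat 0 (.reg 7)))))

/-- The tables are ready, there is fresh memory, and the flag tells whether `P` holds. -/
structure Searching (n τ K S : ℕ) (A Y lenT : ℕ → ℝ) (ix : ℝ → ℕ) (V : ℕ → Multiset ℝ)
    (b₀ b₁ L : ℝ) (P : Prop) (s : State) : Prop where
  ready : Ready n τ K S A Y lenT ix V s
  fresh : ∀ x, s.natReg 5 ≤ x → s.natArr 6 x = 0
  left_eq : s.realReg 0 = b₀
  right_eq : s.realReg 1 = b₁
  len_eq : s.realReg 5 = L
  yes : P → s.natReg 7 = 1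
  no : ¬ P → s.natReg 7 = 0

section Searching

variable {n τ K S : ℕ} {A Y lenT : ℕ → ℝ} {ix : ℝ → ℕ} {V : ℕ → Multiset ℝ} {b₀ b₁ L : ℝ}
  {P : Prop} {s : State}

theorem Searching.of_frame {c : Cmd} {s' : State}
    (h : Searching n τ K S A Y lenT ix V b₀ b₁ L P s) (hf : Frame c s s')
    (h₁ : ∀ r ∈ [0, 1, 3, 4, 5, 7], r ∉ c.natRegs) (h₂ : ∀ r ∈ [2, 3, 4, 5, 6], r ∉ c.natArrs)
    (h₃ : ∀ r ∈ [2, 3, 5], r ∉ c.realArrs) (h₄ : ∀ r ∈ [0, 1, 5], r ∉ c.realRegs) :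
    Searching n τ K S A Y lenT ix V b₀ b₁ L P s' := by
  have r7 := hf.natReg 7 (h₁ 7 (by decide))
  refine ⟨h.ready.of_frame hf (fun r hr => h₁ r ?_) (fun r hr => h₂ r ?_) h₃, ?_, ?_, ?_, ?_, ?_, ?_⟩
  · revert r; decide
  · revert r; decide
  · rw [hf.natReg 5 (h₁ 5 (by decide)), hf.natArr 6 (h₂ 6 (by decide))]; exact h.fresh
  · rw [hf.realReg 0 (h₄ 0 (by decide)), h.left_eq]
  · rw [hf.realReg 1 (h₄ 1 (by decide)), h.right_eq]
  · rw [hf.realReg 5 (h₄ 5 (by decide)), h.len_eq]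
  · rw [r7]; exact h.yes
  · rw [r7]; exact h.no

theorem Searching.congr {P' : Prop} (h : Searching n τ K S A Y lenT ix V b₀ b₁ L P s)
    (hP : P ↔ P') : Searching n τ K S A Y lenT ix V b₀ b₁ L P' s :=
  ⟨h.ready, h.fresh, h.left_eq, h.right_eq, h.len_eq, fun hp => h.yes (hP.2 hp),
    fun hp => h.no fun hp' => hp (hP.1 hp')⟩

/-- The test `side` expresses the condition `Sd` on the start and the target. -/
def Expresses (b₀ b₁ L : ℝ) (side : BExp) (Sd : ℝ → ℝ → Prop) : Prop :=
  side.cost ≤ 40 ∧ ∀ s : State, s.realReg 0 = b₀ → s.realReg 1 = b₁ → s.realReg 5 = L →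
    (side.Holds s ↔ Sd (s.realReg 3) (s.realReg 4))

/-- The outcome is added disjunctively to the proposition `P` recorded in the flag, so that attempts
can be chained. -/
theorem runs_attempt {mode : Bool} {side : BExp} {Sd : ℝ → ℝ → Prop} (hn : 0 < n)
    (hSd : Expresses b₀ b₁ L side Sd) (h : Searching n τ K S A Y lenT ix V b₀ b₁ L P s) :
    Runs (attempt mode side) s (700 * (n * S ^ 3)) (Searching n τ K S A Y lenT ix V b₀ b₁ L
      (P ∨ Sd (s.realReg 3) (s.realReg 4) ∧
        Accept n τ mode A Y (s.realReg 3) (s.realReg 4))) := by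
  have hS3 : 1 ≤ S ^ 3 := Nat.one_le_pow _ _ h.ready.pos
  have e2 : 1 ≤ n * S ^ 3 := Nat.mul_pos hn hS3
  have hcost := hSd.1
  have hiff := hSd.2 s h.left_eq h.right_eq h.len_eq
  refine (Runs.branch (T := 600 * (n * S ^ 3)) (fun hb => ?_) fun hb => ?_).mono (by omega)
    fun _ _ h => h
  · refine (runs_dynProg (mode := mode) h.ready hn h.fresh).mono le_rfl ?_
    rintro s' hf ⟨k1, k2, k3⟩
    have hsd := hiff.1 hb
    refine ⟨h.ready.of_frame hf (by cases mode <;> decide) (by cases mode <;> decide)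
      (by cases mode <;> decide), k1, ?_, ?_, ?_, fun hp => ?_, fun hp => ?_⟩
    · rw [hf.realReg 0 (by cases mode <;> decide), h.left_eq]
    · rw [hf.realReg 1 (by cases mode <;> decide), h.right_eq]
    · rw [hf.realReg 5 (by cases mode <;> decide), h.len_eq]
    · by_cases ha : Accept n τ mode A Y (s.realReg 3) (s.realReg 4)
      · exact k2 ha
      · rw [k3 ha]
        exact h.yes (hp.resolve_right fun h' => ha h'.2)
    · rw [not_or] at hp
      rw [k3 fun ha => hp.2 ⟨hsd, ha⟩]
      exact h.no hp.1
  · refine .flat rfl (by simp only [Cmd.flatCost]; omega) (h.congr ?_)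
    exact ⟨.inl, fun hp => hp.resolve_right fun h' => hb (hiff.2 h'.1)⟩

/-- At most `(τ + 1) * S` start points, each with one run costing a multiple of `n * S ^ 3`. Ranging
over the listed multisets is the same as ranging over all admissible `c` of at most `τ` elements. -/
theorem runs_candidates {side : BExp} {Sd : ℝ → ℝ → Prop} (hn : 0 < n)
    (hSd : Expresses b₀ b₁ L side Sd) (h : Searching n τ K S A Y lenT ix V b₀ b₁ L P s) :
    Runs (candidates side) s (900 * ((τ + 1) * (n * S ^ 4)))
      (Searching n τ K S A Y lenT ix V b₀ b₁ L
        (P ∨ ∃ j < n, j ≤ τ ∧ ∃ c, Adm n A Y c ∧ Multiset.card c ≤ τ ∧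
          Sd (A j - c.sum) (A j - c.sum + L) ∧
          Accept n τ false A Y (A j - c.sum) (A j - c.sum + L))) := by
  have hS := h.ready.pos
  have h1 : Runs (.setNat 16 (.const 0)) s 2 (fun s' => s' = s.setNat 16 0) :=
    .flat rfl (by decide) rfl
  refine (h1.seq (T₂ := (τ + 1) * ((S * ((12 + 700 * (n * S ^ 3)) + 10) + 8 + 4) + 9 + 1) +
    (9 + 1)) ?_).mono ?_ fun _ _ h => h
  · rintro s₁ hf₁ rfl
    have hI₀ := h.of_frame hf₁ (by decide) (by decide) (by decide) (by decide)
    refine (Runs.while (b := (.and (.natLe (.add (.reg 16) (.const 1)) (.reg 0))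
      (.natLe (.reg 16) (.reg 1)))) (fun k s' => s'.natReg 16 + k = τ + 1 ∧
      Searching n τ K S A Y lenT ix V b₀ b₁ L (P ∨ ∃ j < s'.natReg 16, j < n ∧
        ∃ p < S, Sd (A j - (V p).sum) (A j - (V p).sum + L) ∧
          Accept n τ false A Y (A j - (V p).sum) (A j - (V p).sum + L)) s')
      (S * ((12 + 700 * (n * S ^ 3)) + 10) + 8 + 4) ?_ (s₀ := s.setNat 16 0) (k := τ + 1) ?_).mono
      (by simp only [BExp.cost, NExp.cost]; exact le_rfl) fun _ _ h => h
    · rintro k s₂ hf₂ ⟨g1, g2⟩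
      have r0 := g2.ready.n_eq
      have r1 := g2.ready.τ_eq
      set j := s₂.natReg 16 with hj
      by_cases hlt : j < n ∧ j ≤ τ
      · refine .inr ⟨by simp only [BExp.Holds, NExp.eval, r0, r1, ← hj]; omega, k - 1, by omega, ?_⟩
        refine Runs.seq (Runs.forLoop (N := S) (s₀ := s₂) g2.ready.S_eq (by decide)
          (by simp only [Cmd.natRegs, natRegs_attempt]; decide)
          (by simp only [Cmd.natRegs, natRegs_attempt]; decide) (fun m s' => Searching n τ K S A Y lenT ix V b₀ b₁ L
            ((P ∨ ∃ j' < j, j' < n ∧ ∃ p < S, Sd (A j' - (V p).sum) (A j' - (V p).sum + L) ∧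
              Accept n τ false A Y (A j' - (V p).sum) (A j' - (V p).sum + L)) ∨
              ∃ p < m, Sd (A j - (V p).sum) (A j - (V p).sum + L) ∧
              Accept n τ false A Y (A j - (V p).sum) (A j - (V p).sum + L)) s')
          _ ?_ (g2.congr (by simp)) ?_) ?_
        · intro m t v ht
          refine ht.of_frame (c := .setNat 17 (.const v)) ⟨fun r hr => ?_, fun _ _ => rfl,
            fun _ _ => rfl, fun _ _ => rfl⟩ (by simp [Cmd.natRegs]) (by simp [Cmd.natArrs])
              (by simp [Cmd.realArrs]) (by simp [Cmd.realRegs])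
          simp only [Cmd.natRegs, List.mem_singleton] at hr
          simp [hr]
        · intro p s₃ hp hf₃ h17 hI
          have r16 : s₃.natReg 16 = j := hf₃.natReg 16
            (by simp only [forLoop, Cmd.natRegs, natRegs_attempt]; decide)
          have hset : Runs (.seq (.setReal 3 (.sub (.read 2 (.reg 16)) (.read 5 (.reg 17))))
              (.setReal 4 (.add (.reg 3) (.reg 5)))) s₃ 12 (fun s' =>
                s'.realReg 3 = A j - (V p).sum ∧ s'.realReg 4 = A j - (V p).sum + L) := by
            refine .flat rfl (by decide) ?_
            simp [Cmd.run, r16, h17, hI.ready.left, hI.ready.entries.tot p hp, hI.len_eq]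
          refine hset.seq ?_
          rintro s₄ hf₄ ⟨k3, k4⟩
          have := runs_attempt (mode := false) hn hSd
            (hI.of_frame hf₄ (by decide) (by decide) (by decide) (by decide))
          rw [k3, k4] at this
          refine this.mono le_rfl fun s' _ hs' => hs'.congr ?_
          rw [Nat.exists_lt_succ_right, or_assoc]
        · rintro s₃ hf₃ ⟨hI, -⟩
          have r16 : s₃.natReg 16 = j := hf₃.natReg 16
            (by simp only [forLoop, Cmd.natRegs, natRegs_attempt]; decide)
          refine ⟨4, s₃.setNat 16 (j + 1), ?_, le_rfl, by simp; omega, ?_⟩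
          · have := Exec.setNat s₃ 16 (.add (.reg 16) (.const 1))
            simpa [r16, NExp.cost] using this
          · have := hI.of_frame (c := .setNat 16 (.const 0)) (s' := s₃.setNat 16 (j + 1))
              ⟨fun r hr => by
                simp only [Cmd.natRegs, List.mem_singleton] at hr
                simp [hr], fun _ _ => rfl, fun _ _ => rfl, fun _ _ => rfl⟩
              (by decide) (by decide) (by decide) (by decide)
            refine this.congr ?_
            simp only [State.natReg_setNat, if_true]
            rw [Nat.exists_lt_succ_right, or_assoc]
            simp only [hlt.1, true_and]
      · refine .inl ⟨by simp only [BExp.Holds, NExp.eval, r0, r1, ← hj]; omega, g2.congr ?_⟩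
        refine or_congr_right ⟨?_, ?_⟩
        · rintro ⟨j', h1, h2, p, hp, h3⟩
          exact ⟨j', h2, by omega, V p, g2.ready.adm hp, g2.ready.entries.card_le p hp, h3⟩
        · rintro ⟨j', h1, h2, c, hc, hc', h3⟩
          obtain ⟨p, hp, rfl⟩ := g2.ready.exists_index hc hc'
          exact ⟨j', by omega, h1, p, hp, h3⟩
    · exact ⟨by simp, hI₀.congr (by simp)⟩
  · have e0 : 1 ≤ n * S ^ 4 := Nat.mul_pos hn (by positivity)
    have e1 : S * ((12 + 700 * (n * S ^ 3)) + 10) = 700 * (n * S ^ 4) + 22 * S := by ring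
    have e2 : S ≤ n * S ^ 4 := (Nat.le_self_pow (by norm_num) S).trans (Nat.le_mul_of_pos_left _ hn)
    rw [e1]
    have e3 : (τ + 1) * (700 * (n * S ^ 4) + 22 * S + 8 + 4 + 9 + 1) ≤
        (τ + 1) * (744 * (n * S ^ 4)) := Nat.mul_le_mul_left _ (by omega)
    have e4 : (τ + 1) * (744 * (n * S ^ 4)) = 744 * ((τ + 1) * (n * S ^ 4)) := by ring
    have e5 : 1 ≤ (τ + 1) * (n * S ^ 4) := Nat.mul_pos (by omega) e0
    omega

end Searching

end RealRAM

/-! ### Correctness of the preparation -/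

namespace MovingIntervals

open RealRAM

/-- The input in memory, with the numbers `b₀` and `b₁` in the first two real registers. -/
noncomputable def Family.loadWith (F : Family) (b₀ b₁ : ℝ) : State :=
  { F.load with realReg := fun r => if r = 0 then b₀ else if r = 1 then b₁ else 0 }

theorem Family.load_eq (F : Family) : F.load = F.loadWith 0 0 := by
  simp [Family.loadWith, Family.load]

/-- The number of multisets of at most `τ` lengths. -/
noncomputable def Family.numMultisets (F : Family) : ℕ := (F.κ + F.τ).choose F.τ

theorem signed_signed (neg : Bool) (x : ℝ) : signed neg (signed neg x) = x := by
  cases neg <;> simp [signed]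

theorem signed_sub_signed (neg : Bool) (x y : ℝ) :
    signed neg x - signed neg y = signed neg (x - y) := by
  cases neg
  · simp [signed]
  · simp only [signed, if_true]
    ring

theorem signed_injective (neg : Bool) : Function.Injective (signed neg) :=
  Function.LeftInverse.injective (signed_signed neg)

/-- The order computed by sorting is an injective self-map of a finite set, hence a permutation.
Undoing the sign recovers the original endpoints. -/
theorem exists_lists {F : Family} {neg : Bool} {l r : ℕ → ℝ} {ord : ℕ → ℕ} {A Y : ℕ → ℝ}
    (h : SortedBy neg F.n l r ord A Y) (hl : ∀ i : Fin F.n, l i = F.left i)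
    (hr : ∀ i : Fin F.n, r i = F.right i) :
    (∃ e, Lists F e (fun i => signed neg (A i)) (fun i => signed neg (Y i))) ∧
      ∀ i j, i ≤ j → j < F.n → signed neg (A i) ≤ signed neg (A j) := by
  have hinj : Function.Injective fun i : Fin F.n => (⟨ord i, h.lt i i.2⟩ : Fin F.n) :=
    fun i j hij => Fin.ext (h.inj i i.2 j j.2 (Fin.ext_iff.1 hij))
  refine ⟨⟨Equiv.ofBijective _ (Finite.injective_iff_bijective.1 hinj), fun o ho => ?_,
    fun o ho => ?_⟩, fun i j hij hj => ?_⟩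
  · simp [h.left o ho, signed_signed, ← hl]
  · simp [h.right o ho, signed_signed, ← hr]
  · rw [h.left i (by omega), h.left j hj, signed_signed, signed_signed]
    exact h.mono i j hij hj

/-- Reflection is injective on lengths, so the number of distinct lengths found by the machine is
`κ` in both modes. -/
theorem card_signed_lengths {F : Family} {e : Fin F.n ≃ Fin F.n} {neg : Bool} {A Y : ℕ → ℝ}
    (h : Lists F e (fun i => signed neg (A i)) (fun i => signed neg (Y i))) :
    F.κ = ((Finset.range F.n).image fun i => Y i - A i).card := by
  rw [Family.κ, ← h.image_eq, ← Finset.card_image_of_injective _ (signed_injective neg),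
    Finset.image_image]
  congr 2
  ext i
  simp [signed_sub_signed, signed_signed]

end MovingIntervals

namespace RealRAM

open MovingIntervals

theorem runs_prepare (F : Family) (neg : Bool) (b₀ b₁ : ℝ) :
    Runs (prepare neg) (F.loadWith b₀ b₁) (F.n * (70 * (Nat.log 2 F.n + 1) + 300) +
      (200 * (F.n * ((F.κ + 1) * (F.τ + 1))) + 100 * ((F.κ + 1) * F.numMultisets))) (fun s' =>
      ∃ K S A Y lenT ix V, S ≤ F.numMultisets ∧
        (∃ e, Lists F e (fun i => signed neg (A i)) (fun i => signed neg (Y i))) ∧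
        (∀ i j, i ≤ j → j < F.n → signed neg (A i) ≤ signed neg (A j)) ∧
        Searching F.n F.τ K S A Y lenT ix V b₀ b₁ (∑ i ∈ Finset.range F.n, (Y i - A i)) False
          s') := by
  set s := F.loadWith b₀ b₁ with hs
  have hn : s.natReg 0 = F.n := rfl
  have hτ : s.natReg 1 = F.τ := rfl
  have hz : ∀ a, s.natArr a = fun _ => 0 := fun _ => rfl
  have hL : Nat.log 2 (F.n + F.n) ≤ Nat.log 2 F.n + 1 := by
    rw [← mul_two, Nat.log_mul_base (by norm_num) F.n_pos.ne']
  refine (runs_sort hn F.n_pos hL rfl).seq ?_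
  intro s₁ hf₁ hsort
  obtain ⟨⟨e, hlist⟩, hmono⟩ := exists_lists hsort
    (fun i => by simp [hs, Family.loadWith, Family.load])
    (fun i => by simp [hs, Family.loadWith, Family.load])
  refine (runs_findLens (s := s₁) (len := fun i => s₁.realArr 3 i - s₁.realArr 2 i) (n := F.n)
    (τ := F.τ) (hf₁.natReg 0 (by cases neg <;> decide)) (hf₁.natReg 1 (by cases neg <;> decide))
    (hf₁.natReg 2 (by cases neg <;> decide)) (hf₁.realReg 5 (by cases neg <;> decide))
    (fun _ _ => rfl) (card_signed_lengths hlist) F.n_pos).seq ?_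
  rintro s₂ hf₂ ⟨g1, g2, g3, g4, g5⟩
  set K := s₂.natReg 2 with hK
  -- The function `ix` of the specification is chosen as an inverse of the table of lengths. The
  -- machine never evaluates it; it only uses the stored weights.
  have hinj : Set.InjOn (s₂.realArr 4) (Set.Iio K) := fun k hk k' hk' he => g2.inj k hk k' hk' he
  have hix : ∀ k < K, Function.invFunOn (s₂.realArr 4) (Set.Iio K) (s₂.realArr 4 k) = k :=
    fun k hk => hinj.leftInvOn_invFunOn hk
  have hN : (K + F.τ).choose F.τ ≤ F.numMultisets := Nat.choose_le_choose _ (by omega)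
  have key : ∀ a ∈ [3, 4, 5, 6], s₂.natArr a = fun _ => 0 := fun a ha => by
    rw [hf₂.natArr a (by revert a; decide), hf₁.natArr a (by cases neg <;> (revert a; decide)), hz]
  refine (runs_listMultisets (s := s₂) (K := K) (τ := F.τ) (N := F.numMultisets) ?_ rfl hix g2.pow
    g3 (by rw [key 3 (by decide)]) (by rw [key 4 (by decide)]) (by rw [key 5 (by decide)]) ?_
    hN).mono ?_ ?_
  · rw [hf₂.natReg 1 (by decide), hf₁.natReg 1 (by cases neg <;> decide), hτ]
  · rw [hf₂.realArr 5 (by decide), hf₁.realArr 5 (by cases neg <;> decide)]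
    simp [hs, Family.loadWith, Family.load]
  · gcongr
  rintro s₃ hf₃ ⟨V, k1, k2, k3⟩
  have reg : ∀ r ∈ [0, 1, 5, 7], s₃.natReg r = s.natReg r := fun r hr => by
    rw [hf₃.natReg r (by revert r; decide), hf₂.natReg r (by revert r; decide),
      hf₁.natReg r (by cases neg <;> (revert r; decide))]
  have a2 : s₃.realArr 2 = s₁.realArr 2 := by
    rw [hf₃.realArr 2 (by decide), hf₂.realArr 2 (by decide)]
  have a3 : s₃.realArr 3 = s₁.realArr 3 := by
    rw [hf₃.realArr 3 (by decide), hf₂.realArr 3 (by decide)]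
  refine ⟨K, s₃.natReg 3, s₁.realArr 2, s₁.realArr 3, s₂.realArr 4, _, V, k3, ⟨e, hlist⟩, hmono,
    ⟨reg 0 (by decide), reg 1 (by decide), rfl, ?_, a2, a3, hix, k1, k2, fun m => ⟨?_, ?_⟩, ?_⟩,
    ?_, ?_, ?_, ?_, False.elim, fun _ => reg 7 (by decide)⟩
  · rw [hf₃.natReg 4 (by decide), g4]
  · intro h ℓ hℓ
    obtain ⟨k, hk, rfl⟩ := h ℓ hℓ
    obtain ⟨i, hi, h'⟩ := g2.src k hk
    exact ⟨i, hi, h'.symm⟩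
  · intro h ℓ hℓ
    obtain ⟨i, hi, rfl⟩ := h ℓ hℓ
    obtain ⟨k, hk, h', -⟩ := g2.weight i hi
    exact ⟨k, hk, h'⟩
  · intro i hi
    obtain ⟨k, hk, h', h''⟩ := g2.weight i hi
    rw [hf₃.natArr 2 (by decide), h'', ← h', hix k hk]
  · intro x _
    rw [hf₃.natArr 6 (by decide), key 6 (by decide)]
  · rw [hf₃.realReg 0 (by decide), hf₂.realReg 0 (by decide),
      hf₁.realReg 0 (by cases neg <;> decide)]
    rfl
  · rw [hf₃.realReg 1 (by decide), hf₂.realReg 1 (by decide),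
      hf₁.realReg 1 (by cases neg <;> decide)]
    rfl
  · rw [hf₃.realReg 5 (by decide), g5]

end RealRAM

/-! ### The running time -/

namespace MovingIntervals

open RealRAM

/-- The factor in the running time that depends on the number of distinct lengths and the number of
moved intervals only. -/
def timeFactor (κ τ : ℕ) : ℕ := (κ + 1) * (τ + 1) * (κ + τ).choose τ ^ 4

theorem timeFactor_pos (κ τ : ℕ) : 0 < timeFactor κ τ :=
  Nat.mul_pos (Nat.mul_pos κ.succ_pos τ.succ_pos) (pow_pos (Nat.choose_pos (by omega)) _)

/-- The binomial coefficient is at most `(κ + τ) ^ τ` and, by symmetry, at most `(κ + τ) ^ κ`. With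
one parameter equal to `c` and the other at most `n`, the exponent is therefore the constant `c`. -/
theorem polyWhenOneConstant_timeFactor : PolyWhenOneConstant timeFactor := by
  intro c
  refine ⟨(Polynomial.C (c + 1)) * (Polynomial.X + 1) * ((Polynomial.C c + Polynomial.X) ^ c) ^ 4,
    fun n κ τ hκ hτ h => ?_⟩
  simp only [Polynomial.eval_mul, Polynomial.eval_add, Polynomial.eval_pow, Polynomial.eval_C,
    Polynomial.eval_X, Polynomial.eval_one, timeFactor]
  rcases h with rfl | rfl
  · have : (κ + τ).choose τ ≤ (κ + n) ^ κ := by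
      rw [Nat.choose_symm_add.symm]
      exact (Nat.choose_le_pow _ _).trans (Nat.pow_le_pow_left (by omega) _)
    gcongr
  · have : (κ + τ).choose τ ≤ (τ + n) ^ τ :=
      (Nat.choose_le_pow _ _).trans (Nat.pow_le_pow_left (by omega) _)
    rw [Nat.mul_comm (κ + 1)]
    gcongr

/-- The running time of the decision procedure. -/
noncomputable def Family.time (F : Family) : ℕ :=
  70 * (F.n * Nat.log 2 F.n) + 2300 * (F.n * timeFactor F.κ F.τ)

theorem Family.time_le_nearLinear (F : Family) :
    (F.time : ℝ) ≤ 2300 * F.nearLinear timeFactor := by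
  -- The factor 2 suffices because `log 2 ≥ 1 / 2`.
  have h1 : (Nat.log 2 F.n : ℝ) ≤ 2 * Real.log F.n := by
    have h := Real.natLog_le_logb F.n 2
    have h2 := Real.log_two_gt_d9
    have hl : 0 ≤ Real.log F.n := Real.log_natCast_nonneg _
    rw [Real.logb] at h
    refine h.trans ?_
    push_cast
    rw [div_le_iff₀ (by linarith)]
    nlinarith
  have h3 : (0 : ℝ) ≤ F.n := Nat.cast_nonneg _
  have h4 := mul_le_mul_of_nonneg_left h1 h3
  have hl : 0 ≤ F.n * Real.log F.n := mul_nonneg h3 (Real.log_natCast_nonneg _)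
  simp only [Family.time, Family.nearLinear]
  push_cast
  linarith

/-- A mere weakening, by `log n ≤ n`: the same time bound holds for covering as for the other
problems. The constant is `70 + 2300`. -/
theorem Family.time_le_quadratic (F : Family) :
    (F.time : ℝ) ≤ 2370 * F.quadratic timeFactor := by
  have h : F.time ≤ 2370 * (F.n ^ 2 * timeFactor F.κ F.τ) := by
    have h1 : F.n * Nat.log 2 F.n ≤ F.n ^ 2 * timeFactor F.κ F.τ := by
      rw [pow_two]
      exact (Nat.mul_le_mul_left _ (Nat.log_le_self _ _)).trans
        (Nat.le_mul_of_pos_right _ (timeFactor_pos _ _))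
    have h2 : F.n * timeFactor F.κ F.τ ≤ F.n ^ 2 * timeFactor F.κ F.τ :=
      Nat.mul_le_mul_right _ (Nat.le_self_pow (by norm_num) _)
    rw [Family.time]
    omega
  rw [Family.quadratic]
  exact_mod_cast h

end MovingIntervals

/-! ### The decision procedures for the six problems -/

namespace RealRAM

open MovingIntervals

/-- The first natural register tells whether `P` holds. -/
def Answers (P : Prop) (s : State) : Prop := (P → s.natReg 0 = 1) ∧ (¬ P → s.natReg 0 = 0)

theorem admitsAlgorithm_of_runs {α : Type} {load : α → State} {yes : α → Prop} {time : α → ℝ}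
    (P : Cmd) (T : α → ℕ) (C : ℝ) (hT : ∀ I, (T I : ℝ) ≤ C * time I)
    (h : ∀ I, Runs P (load I) (T I) (Answers (yes I))) : AdmitsAlgorithm load yes time := by
  refine ⟨P, C, fun I => ?_⟩
  obtain ⟨t, s, he, ht, hs⟩ := h I
  exact ⟨t, s, he, (Nat.cast_le.2 ht).trans (hT I), hs⟩

/-- Apart from the logarithmic term, every summand is at most a multiple of `n * timeFactor κ τ`;
the multiples add up to `370 + 200 + 100 + 700 + 900 + 14 ≤ 2300`. -/
theorem time_le (n l κ τ S N : ℕ) (hn : 0 < n) (hN : 0 < N) (hS : S ≤ N) :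
    n * (70 * (l + 1) + 300) + (200 * (n * ((κ + 1) * (τ + 1))) + 100 * ((κ + 1) * N)) +
      (12 + (700 * (n * S ^ 3) + (900 * ((τ + 1) * (n * S ^ 4)) + 2))) ≤
    70 * (n * l) + 2300 * (n * ((κ + 1) * (τ + 1) * N ^ 4)) := by
  have hN4 : 0 < N ^ 4 := pow_pos hN 4
  have e1 : n * ((κ + 1) * (τ + 1)) ≤ n * ((κ + 1) * (τ + 1) * N ^ 4) :=
    Nat.mul_le_mul_left _ (Nat.le_mul_of_pos_right _ hN4)
  have e2 : (κ + 1) * N ≤ n * ((κ + 1) * (τ + 1) * N ^ 4) := by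
    refine le_trans ?_ (Nat.le_mul_of_pos_left _ hn)
    exact Nat.mul_le_mul (Nat.le_mul_of_pos_right _ τ.succ_pos) (Nat.le_self_pow (by norm_num) _)
  have e3 : n * S ^ 3 ≤ n * ((κ + 1) * (τ + 1) * N ^ 4) := by
    refine Nat.mul_le_mul_left _ (le_trans ?_ (Nat.le_mul_of_pos_left _ (by positivity)))
    exact (Nat.pow_le_pow_left hS 3).trans (Nat.pow_le_pow_right hN (by norm_num))
  have e4 : (τ + 1) * (n * S ^ 4) ≤ n * ((κ + 1) * (τ + 1) * N ^ 4) := by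
    rw [Nat.mul_left_comm]
    refine Nat.mul_le_mul_left _ (Nat.mul_le_mul (Nat.le_mul_of_pos_left _ κ.succ_pos) ?_)
    exact Nat.pow_le_pow_left hS 4
  have e5 : n ≤ n * ((κ + 1) * (τ + 1) * N ^ 4) := Nat.le_mul_of_pos_right _ (by positivity)
  have e6 : n * (70 * (l + 1) + 300) = 70 * (n * l) + 370 * n := by ring
  omega

/-- Correctness of the decision procedure, where `more` is a further search for `More`. -/
theorem runs_decider {F : Family} {b₀ b₁ : ℝ} {mode : Bool} {z₀ w₀ : RExp} {side : BExp}
    {more : Cmd} {Sd : ℝ → ℝ → Prop} {z w : ℝ} {Ans : Prop} {More : (ℕ → ℝ) → (ℕ → ℝ) → Prop}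
    (hcost : z₀.cost + w₀.cost ≤ 10)
    (hSd : Expresses b₀ b₁ (signed mode F.totalLen) side Sd)
    (hz : ∀ s : State, s.realReg 0 = b₀ → s.realReg 2 = 0 → z₀.eval s = z)
    (hw : ∀ s : State, s.realReg 1 = b₁ → s.realReg 2 = 0 → s.realReg 3 = z →
      s.realReg 5 = signed mode F.totalLen → w₀.eval s = w)
    (hmore : ∀ {K S A Y lenT ix V P s},
      Searching F.n F.τ K S A Y lenT ix V b₀ b₁ (signed mode F.totalLen) P s →
      Runs more s (900 * ((F.τ + 1) * (F.n * S ^ 4)))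
        (Searching F.n F.τ K S A Y lenT ix V b₀ b₁ (signed mode F.totalLen) (P ∨ More A Y)))
    (hans : ∀ e A Y, Lists F e (fun i => signed mode (A i)) (fun i => signed mode (Y i)) →
      (∀ i j, i ≤ j → j < F.n → signed mode (A i) ≤ signed mode (A j)) →
      (Ans ↔ Sd z w ∧ Accept F.n F.τ mode A Y z w ∨ More A Y)) :
    Runs (decider mode z₀ w₀ side more) (F.loadWith b₀ b₁) F.time (Answers Ans) := by
  obtain ⟨t, s₁, he, ht, K, S, A, Y, lenT, ix, V, hS, ⟨e, hlist⟩, hmono, hP⟩ :=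
    runs_prepare F mode b₀ b₁
  have hsum : ∑ i ∈ Finset.range F.n, (Y i - A i) = signed mode F.totalLen := by
    rw [← hlist.sum_eq, ← signed_signed mode (∑ i ∈ Finset.range F.n, (Y i - A i))]
    congr 1
    cases mode
    · rfl
    · simp only [signed, if_true, zero_sub, ← Finset.sum_neg_distrib]
      exact Finset.sum_congr rfl fun i _ => by ring
  rw [hsum] at hP
  have r2 : s₁.realReg 2 = 0 := by
    rw [he.frame.realReg 2 (by cases mode <;> decide)]
    simp [Family.loadWith]
  have hN : 0 < F.numMultisets := Nat.choose_pos (by omega)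
  refine Runs.mono (T := t + (12 + (700 * (F.n * S ^ 3) +
    (900 * ((F.τ + 1) * (F.n * S ^ 4)) + 2)))) ?_
    ((Nat.add_le_add_right ht _).trans (time_le _ _ _ _ _ _ F.n_pos hN hS)) fun _ _ h => h
  -- The number `S` of multisets is known only after the preparation, while the time bound for the
  -- rest depends on it. So the state reached by the preparation is fixed first and used as the
  -- postcondition.
  refine Runs.seq (Q₁ := (· = s₁)) ⟨t, s₁, he, le_rfl, rfl⟩ ?_
  intro s₁' _ hs
  subst s₁'
  have hset : Runs (.seq (.setReal 3 z₀) (.setReal 4 w₀)) s₁ 12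
      (fun s' => s'.realReg 3 = z ∧ s'.realReg 4 = w) := by
    refine .flat rfl (by simp only [Cmd.flatCost]; omega) ?_
    have h3 := hz s₁ hP.left_eq r2
    have h4 := hw (s₁.setReal 3 z) (by simpa using hP.right_eq) (by simpa using r2) (by simp)
      (by simpa using hP.len_eq)
    simp [Cmd.run, h3, h4]
  refine hset.seq ?_
  rintro s₂ hf₂ ⟨r3, r4⟩
  have h := runs_attempt (mode := mode) F.n_pos hSd
    (hP.of_frame hf₂ (by simp [Cmd.natRegs]) (by simp [Cmd.natArrs]) (by simp [Cmd.realArrs])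
      (by simp [Cmd.realRegs]))
  rw [r3, r4] at h
  refine h.seq ?_
  intro s₃ _ h₃
  refine (hmore h₃).seq ?_
  intro s₄ _ h₄
  refine .flat rfl (by simp [Cmd.flatCost, NExp.cost]) ?_
  have hA := (hans e A Y hlist hmono)
  rw [← (false_or (Sd z w ∧ Accept F.n F.τ mode A Y z w))] at hA
  exact ⟨fun ha => by simpa [Cmd.run] using h₄.yes (hA.1 ha),
    fun ha => by simpa [Cmd.run] using h₄.no fun h => ha (hA.2 h)⟩

/-- A test that is always satisfied. -/
def always : BExp := .natLe (.const 0) (.const 0)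

theorem expresses_always (b₀ b₁ L : ℝ) : Expresses b₀ b₁ L always fun _ _ => True :=
  ⟨by decide, fun s _ _ _ => by simp [always, BExp.Holds]⟩

theorem runs_skip_searching {n τ K S : ℕ} {A Y lenT : ℕ → ℝ} {ix : ℝ → ℕ} {V : ℕ → Multiset ℝ}
    {b₀ b₁ L : ℝ} {P : Prop} {s : State} (hn : 0 < n)
    (h : Searching n τ K S A Y lenT ix V b₀ b₁ L P s) :
    Runs .skip s (900 * ((τ + 1) * (n * S ^ 4)))
      (Searching n τ K S A Y lenT ix V b₀ b₁ L (P ∨ False)) := by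
  have : 0 < (τ + 1) * (n * S ^ 4) :=
    Nat.mul_pos τ.succ_pos (Nat.mul_pos hn (pow_pos h.ready.pos 4))
  exact .flat rfl (by simp only [Cmd.flatCost]; omega) (h.congr (by simp))

theorem admitsAlgorithm_pack :
    AdmitsAlgorithm TargetFamily.load Pack (fun F => F.toFamily.nearLinear timeFactor) := by
  refine admitsAlgorithm_of_runs (decider false (.reg 0) (.reg 1) always .skip)
    (fun F => F.toFamily.time) 2300 (fun F => F.toFamily.time_le_nearLinear) fun F => ?_
  refine runs_decider (F := F.toFamily) (b₀ := F.bLeft) (b₁ := F.bRight) (z := F.bLeft)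
    (w := F.bRight) (More := fun _ _ => False) (by decide) (expresses_always _ _ _)
    (fun s h _ => h) (fun s h _ _ _ => h) (runs_skip_searching F.n_pos) fun e A Y hl hm => ?_
  rw [accept_iff_packN (A := A) (Y := Y) hl.lt hm F.bLeft_lt_bRight.le, ← Lists.packInto_iff (A := A) (Y := Y) hl,
    pack_iff]
  simp

theorem admitsAlgorithm_tile :
    AdmitsAlgorithm TargetFamily.load Tile (fun F => F.toFamily.nearLinear timeFactor) := by
  refine admitsAlgorithm_of_runs (decider false (.reg 0) (.reg 1)
    (.and (.realLe (.add (.reg 0) (.reg 5)) (.reg 1)) (.realLe (.reg 1) (.add (.reg 0) (.reg 5))))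
    .skip) (fun F => F.toFamily.time) 2300 (fun F => F.toFamily.time_le_nearLinear) fun F => ?_
  refine runs_decider (F := F.toFamily) (b₀ := F.bLeft) (b₁ := F.bRight) (z := F.bLeft)
    (w := F.bRight) (More := fun _ _ => False)
    (Sd := fun _ _ => F.bLeft + F.totalLen = F.bRight) (by decide)
    ⟨by decide, fun s h0 h1 h5 => ?_⟩
    (fun s h _ => h) (fun s h _ _ _ => h) (runs_skip_searching F.n_pos) fun e A Y hl hm => ?_
  · simp only [BExp.Holds, RExp.eval, h0, h1, h5]
    exact le_antisymm_iff.symm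
  · rw [accept_iff_packN (A := A) (Y := Y) hl.lt hm F.bLeft_lt_bRight.le, ← Lists.packInto_iff (A := A) (Y := Y) hl,
      tile_iff]
    simp

/-- Mode `true` sorts by left endpoint but stores negated coordinates; accordingly the run goes from
`-bLeft` to `-bRight`. -/
theorem admitsAlgorithm_cover :
    AdmitsAlgorithm TargetFamily.load Cover (fun F => F.toFamily.quadratic timeFactor) := by
  refine admitsAlgorithm_of_runs
    (decider true (.sub (.reg 2) (.reg 0)) (.sub (.reg 2) (.reg 1)) always .skip)
    (fun F => F.toFamily.time) 2370 (fun F => F.toFamily.time_le_quadratic) fun F => ?_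
  refine runs_decider (F := F.toFamily) (b₀ := F.bLeft) (b₁ := F.bRight) (z := -F.bLeft)
    (w := -F.bRight) (More := fun _ _ => False) (by decide) (expresses_always _ _ _)
    (fun s h h2 => by simp [RExp.eval, h, h2]) (fun s h h2 _ _ => by simp [RExp.eval, h, h2])
    (runs_skip_searching F.n_pos) fun e A Y hl hm => ?_
  simp only [signed, if_true, zero_sub] at hl hm
  rw [hl.cover_iff]
  simp only [true_and, or_false]
  refine ⟨fun h => h.accept (fun i hi => ?_) fun i j hij hj => ?_, Accept.coverN⟩
  · exact neg_lt_neg_iff.1 (hl.lt i hi)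
  · exact neg_le_neg_iff.1 (hm i j hij hj)

/-- If the intervals can be joined at a position with the property `Side`, then they can be joined
at `b` or at a candidate position. -/
theorem exists_packInto_iff {F : Family} {e : Fin F.n ≃ Fin F.n} {A Y : ℕ → ℝ} (hl : Lists F e A Y)
    (hm : ∀ i j, i ≤ j → j < F.n → A i ≤ A j) {Side : ℝ → Prop} {b : ℝ}
    (hb : ∀ z, Side z → Side b) :
    (∃ z, Side z ∧ F.PackInto z (z + F.totalLen)) ↔
      Side b ∧ Accept F.n F.τ false A Y b (b + F.totalLen) ∨
      ∃ j < F.n, j ≤ F.τ ∧ ∃ c, Adm F.n A Y c ∧ Multiset.card c ≤ F.τ ∧ Side (A j - c.sum) ∧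
        Accept F.n F.τ false A Y (A j - c.sum) (A j - c.sum + F.totalLen) := by
  have hacc : ∀ z, F.PackInto z (z + F.totalLen) ↔
      Accept F.n F.τ false A Y z (z + F.totalLen) := fun z => by
    rw [accept_iff_packN hl.lt hm (by linarith [F.totalLen_pos]), hl.packInto_iff]
  constructor
  · rintro ⟨z, hz, hp⟩
    have hp' := (hl.packInto_iff _ _).1 hp
    rw [← hl.sum_eq] at hp'
    rcases PackN.candidate hl.lt hm hp' with h | ⟨j, hj, hj', c, hc, hc', he⟩
    · refine .inl ⟨hb z hz, (hacc b).1 ((hl.packInto_iff _ _).2 ?_)⟩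
      rw [← hl.sum_eq]
      exact h b
    · exact .inr ⟨j, hj, hj', c, hc, hc', he ▸ hz, he ▸ (hacc z).1 hp⟩
  · rintro (⟨h, h'⟩ | ⟨j, -, -, c, -, -, h, h'⟩)
    · exact ⟨_, h, (hacc _).2 h'⟩
    · exact ⟨_, h, (hacc _).2 h'⟩

/-- Search for a joined position that satisfies `side`. -/
def joinDecider (side : BExp) : Cmd :=
  decider false (.reg 0) (.add (.reg 3) (.reg 5)) side (candidates side)

theorem runs_joinDecider {F : Family} {b₀ b₁ : ℝ} {side : BExp} {Sd : ℝ → ℝ → Prop} {Ans : Prop}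
    (hSd : Expresses b₀ b₁ F.totalLen side Sd)
    (hb : ∀ z, Sd z (z + F.totalLen) → Sd b₀ (b₀ + F.totalLen))
    (hans : Ans ↔ ∃ z, Sd z (z + F.totalLen) ∧ F.PackInto z (z + F.totalLen)) :
    Runs (joinDecider side) (F.loadWith b₀ b₁) F.time (Answers Ans) := by
  refine runs_decider (z := b₀) (w := b₀ + F.totalLen) (by decide) hSd (fun s h _ => h)
    (fun s _ _ h3 h5 => by simp only [RExp.eval, h3, h5]; rfl) (fun h => runs_candidates F.n_pos hSd h)
    fun e A Y hl hm => ?_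
  rw [hans]
  exact exists_packInto_iff hl hm hb

theorem admitsAlgorithm_join :
    AdmitsAlgorithm Family.load Join (fun F => F.nearLinear timeFactor) := by
  refine admitsAlgorithm_of_runs (joinDecider always) Family.time 2300 Family.time_le_nearLinear fun F => ?_
  rw [F.load_eq]
  exact runs_joinDecider (expresses_always _ _ _) (fun _ h => h) (by simpa using join_iff F)

theorem admitsAlgorithm_jPack :
    AdmitsAlgorithm TargetFamily.load JPack (fun F => F.toFamily.nearLinear timeFactor) := by
  refine admitsAlgorithm_of_runs
    (joinDecider (.and (.realLe (.reg 0) (.reg 3)) (.realLe (.reg 4) (.reg 1))))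
    (fun F => F.toFamily.time) 2300
    (fun F => F.toFamily.time_le_nearLinear) fun F => ?_
  refine runs_joinDecider (F := F.toFamily) (b₀ := F.bLeft) (b₁ := F.bRight)
    (Sd := fun z w => F.bLeft ≤ z ∧ w ≤ F.bRight) ⟨by decide, fun s h0 h1 _ => ?_⟩
    -- If every interval is moved, the start `bLeft` is as good as any: it leaves the most room on
    -- the right.
    (fun z hz => ⟨le_rfl, by linarith [hz.1, hz.2]⟩) (jPack_iff F)
  simp only [BExp.Holds, RExp.eval, h0, h1]

theorem admitsAlgorithm_jCover :
    AdmitsAlgorithm TargetFamily.load JCover (fun F => F.toFamily.nearLinear timeFactor) := by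
  refine admitsAlgorithm_of_runs
    (joinDecider (.and (.realLe (.reg 3) (.reg 0)) (.realLe (.reg 1) (.reg 4))))
    (fun F => F.toFamily.time) 2300
    (fun F => F.toFamily.time_le_nearLinear) fun F => ?_
  refine runs_joinDecider (F := F.toFamily) (b₀ := F.bLeft) (b₁ := F.bRight)
    (Sd := fun z w => z ≤ F.bLeft ∧ F.bRight ≤ w) ⟨by decide, fun s h0 h1 _ => ?_⟩
    -- Here `bLeft` is the rightmost admissible start and so reaches furthest.
    (fun z hz => ⟨le_rfl, by linarith [hz.1, hz.2]⟩) (jCover_iff F)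
  simp only [BExp.Holds, RExp.eval, h0, h1]

end RealRAM

open RealRAM MovingIntervals in
theorem proposition1 :
    ∃ f : ℕ → ℕ → ℕ, PolyWhenOneConstant f ∧
      AdmitsAlgorithm TargetFamily.load Pack (fun F => F.toFamily.nearLinear f) ∧
      AdmitsAlgorithm Family.load Join (fun F => F.nearLinear f) ∧
      AdmitsAlgorithm TargetFamily.load JPack (fun F => F.toFamily.nearLinear f) ∧
      AdmitsAlgorithm TargetFamily.load JCover (fun F => F.toFamily.nearLinear f) ∧
      AdmitsAlgorithm TargetFamily.load Tile (fun F => F.toFamily.nearLinear f) ∧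
      AdmitsAlgorithm TargetFamily.load Cover (fun F => F.toFamily.quadratic f) :=
  ⟨timeFactor, polyWhenOneConstant_timeFactor, admitsAlgorithm_pack, admitsAlgorithm_join,
    admitsAlgorithm_jPack, admitsAlgorithm_jCover, admitsAlgorithm_tile, admitsAlgorithm_cover⟩
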